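/- Let $\Omega=(a,b)$ with $a<b$, $T>0$, $\beta\in\mathbb R$, and let $m\ge 2$ be an integer. Let $H^m_{\rm per}(\Omega)$ be the set of $\phi\in H^m(\Omega)$ with $\phi^{(k)}(a)=\phi^{(k)}(b)$ for $0\le k\le m-1$. Let the real-valued potential satisfy $$V\in C([0,T];L^\infty(\Omega))\cap C^1([0,T];L^2(\Omega)),$$ and let $$\psi\in C([0,T];H^m_{\rm per}(\Omega))\cap C^1([0,T];L^2(\Omega))$$ be a solution of the Gross–Pitaevskii equation $i\partial_t\psi=-\partial_{xx}\psi+V\psi+\beta|\psi|^2\psi$ on $\Omega\times(0,T)$ with $\psi(\cdot,0)=\psi_0$. For a positive even integer $N$ and $\tau>0$ put $h=(b-a)/N$, $x_j=a+jh$ $(0\le j\le N)$, $t_n=n\tau$, $\mathcal T_N=\{-N/2,\dots,N/2-1\}$, $\mu_l=2\pi l/(b-a)$, and $$\widehat u_l=\frac1{b-a}\int_a^b u(x)e^{-i\mu_l(x-a)}\,dx,\qquad (I_Nv)(x)=\sum_{l\in\mathcal T_N}\Big(\frac1N\sum_{j=0}^{N-1}v_je^{-i\mu_l(x_j-a)}\Big)e^{i\mu_l(x-a)}$$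 for $u\in L^2(\Omega)$ and $v=(v_0,\dots,v_N)\in\mathbb C^{N+1}$. The Lawson-time-splitting extended Fourier pseudospectral (LTSeFP) approximations $\psi^n=(\psi^n_0,\dots,\psi^n_N)$ are defined by $\psi^0_j=\psi_0(x_j)$ and, for $n\ge0$, $$\psi^{(1)}(x)=\big(1-i\tau V(x,t_n)\big)\,I_N\big(\psi^n e^{-i\tau\beta|\psi^n|^2}\big)(x),\qquad \psi^{n+1}_j=\sum_{l\in\mathcal T_N}e^{-i\tau\mu_l^2}\,\widehat{(\psi^{(1)})}_l\,e^{i\mu_l(x_j-a)},\quad 0\le j\le N,$$ where $\psi^n e^{-i\tau\beta|\psi^n|^2}$ is taken componentwise. Then there are $h_0>0$ and $C>0$, independent of $N$ (that is, of $h$), $\tau$ and $n$, such that whenever $0<h<h_0$ and $0<\tau\le h^2/\pi$, $$\|\psi(\cdot,t_n)-I_N\psi^n\|_{L^2(\Omega)}\le C(\tau+h^m),\qquad \|\psi(\cdot,t_n)-I_N\psi^n\|_{H^1(\Omega)}\le C(\tau^{1/2}+h^{m-1})$$ for all integers $n$ with $0\le n\le T/\tau$. -/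

import Mathlib

open MeasureTheory Set Filter Topology
open scoped ENNReal ContDiff

noncomputable section

namespace GPE

/-- Lebesgue measure on the interval `Ω = (a, b)`. -/
abbrev volΩ (a b : ℝ) : Measure ℝ := volume.restrict (Ioo a b)

/-! ### Sobolev spaces on `(a, b)` -/

/-- `v` is the `k`-th weak derivative of `u` on `(a, b)`: both are locally integrable, and
`∫ u η⁽ᵏ⁾ = (-1)ᵏ ∫ v η` for all smooth `η` with compact support in `(a, b)`. -/
def IsWeakDeriv (a b : ℝ) (k : ℕ) (u v : ℝ → ℂ) : Prop :=
  LocallyIntegrableOn u (Ioo a b) ∧ LocallyIntegrableOn v (Ioo a b) ∧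
    ∀ η : ℝ → ℂ, ContDiff ℝ ∞ η → HasCompactSupport η → tsupport η ⊆ Ioo a b →
      ∫ x in Ioo a b, u x * iteratedDeriv k η x = (-1 : ℂ) ^ k * ∫ x in Ioo a b, v x * η x

/-- `D 0, …, D m` are weak derivatives of `u` of orders `0, …, m`, all in `L²(a, b)`. -/
def HasWeakDerivs (a b : ℝ) (m : ℕ) (u : ℝ → ℂ) (D : ℕ → ℝ → ℂ) : Prop :=
  ∀ k ≤ m, IsWeakDeriv a b k u (D k) ∧ MemLp (D k) 2 (volΩ a b)

/-- The `H^m(a, b)` norm `(∑_{k ≤ m} ‖u⁽ᵏ⁾‖²_{L²})^{1/2}`. Weak derivatives are unique almost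
everywhere, so the infimum is over a single value; it is `∞` exactly if `u ∉ H^m(a, b)`. -/
def sobolevNorm (a b : ℝ) (m : ℕ) (u : ℝ → ℂ) : ℝ≥0∞ :=
  ⨅ (D : ℕ → ℝ → ℂ) (_ : HasWeakDerivs a b m u D),
    (∑ k ∈ Finset.range (m + 1), eLpNorm (D k) 2 (volΩ a b) ^ 2) ^ (1 / 2 : ℝ)

/-- `φ` is (the continuous representative on `[a, b]` of) an element of `H^m_per(a, b)`, `m ≥ 1`:
`φ ∈ H^m(a, b)` and the derivatives of order `k < m`, which are continuous on `[a, b]`,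
have equal values at `a` and `b`. -/
def MemHper (a b : ℝ) (m : ℕ) (φ : ℝ → ℂ) : Prop :=
  ∃ D : ℕ → ℝ → ℂ, EqOn (D 0) φ (Icc a b) ∧ HasWeakDerivs a b m φ D ∧
    ∀ k < m, ContinuousOn (D k) (Icc a b) ∧ D k a = D k b

/-! ### Functions of time with values in spaces of functions of `x`

A space-time function is written `u t x`. -/

/-- `U t` is the class of `u t` in `L^p(a, b)`, for every `t ∈ [0, T]`. -/
def Represents {E : Type*} [NormedAddCommGroup E] (a b T : ℝ) (p : ℝ≥0∞)
    (u : ℝ → ℝ → E) (U : ℝ → Lp E p (volΩ a b)) : Prop :=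
  ∀ t ∈ Icc (0 : ℝ) T, ⇑(U t) =ᵐ[volΩ a b] u t

/-- `u ∈ C([0, T]; L^p(a, b))`. -/
def MemCLp {E : Type*} [NormedAddCommGroup E] (a b T : ℝ) (p : ℝ≥0∞) [Fact (1 ≤ p)]
    (u : ℝ → ℝ → E) : Prop :=
  ∃ U : ℝ → Lp E p (volΩ a b), Represents a b T p u U ∧ ContinuousOn U (Icc 0 T)

/-- `u ∈ C¹([0, T]; L²(a, b))`. -/
def MemC1L2 {E : Type*} [NormedAddCommGroup E] [NormedSpace ℝ E] (a b T : ℝ)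
    (u : ℝ → ℝ → E) : Prop :=
  ∃ U : ℝ → Lp E 2 (volΩ a b), Represents a b T 2 u U ∧ ContDiffOn ℝ 1 U (Icc 0 T)

/-- `ψ ∈ C([0, T]; H^m_per(a, b))`. -/
def MemCHper (a b T : ℝ) (m : ℕ) (ψ : ℝ → ℝ → ℂ) : Prop :=
  (∀ t ∈ Icc (0 : ℝ) T, MemHper a b m (ψ t)) ∧
    ∀ t ∈ Icc (0 : ℝ) T,
      Tendsto (fun s => sobolevNorm a b m (fun x => ψ s x - ψ t x)) (𝓝[Icc 0 T] t) (𝓝 0)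

/-- `ψ` solves `i ∂ₜψ = -∂ₓₓψ + V ψ + β |ψ|² ψ` on `(a, b) × (0, T)`, `ψ(·, 0) = ψ₀` on `[a, b]`:
the time derivative `W` is taken in `L²(a, b)`, the space derivative `ψxx` in the weak sense.
(The periodic boundary conditions are part of `MemCHper`.) -/
def IsSolution (a b T β : ℝ) (V : ℝ → ℝ → ℝ) (ψ₀ : ℝ → ℂ) (ψ : ℝ → ℝ → ℂ) : Prop :=
  (∀ x ∈ Icc a b, ψ 0 x = ψ₀ x) ∧
    ∃ U : ℝ → Lp ℂ 2 (volΩ a b), Represents a b T 2 ψ U ∧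
      ∀ t ∈ Ioo 0 T, ∃ (W : Lp ℂ 2 (volΩ a b)) (ψxx : ℝ → ℂ),
        HasDerivAt U W t ∧ IsWeakDeriv a b 2 (ψ t) ψxx ∧
          ∀ᵐ x ∂(volΩ a b), Complex.I * W x =
            -ψxx x + (V t x : ℂ) * ψ t x + (β : ℂ) * ((‖ψ t x‖ ^ 2 : ℝ) : ℂ) * ψ t x

/-! ### The numerical scheme -/

/-- The mesh size `h = (b - a) / N`. -/
def mesh (a b : ℝ) (N : ℕ) : ℝ := (b - a) / N

/-- The grid points `x_j = a + j h`. -/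
def node (a b : ℝ) (N j : ℕ) : ℝ := a + j * mesh a b N

/-- The frequencies `{-N/2, …, N/2 - 1}` (`N` is even). -/
def freqs (N : ℕ) : Finset ℤ := Finset.Ico (-((N : ℤ) / 2)) ((N : ℤ) / 2)

/-- `μ_l = 2 π l / (b - a)`. -/
def freq (a b : ℝ) (l : ℤ) : ℝ := 2 * Real.pi * l / (b - a)

/-- `e^{i μ_l (x - a)}`. -/
def mode (a b : ℝ) (l : ℤ) (x : ℝ) : ℂ :=
  Complex.exp (Complex.I * ((freq a b l * (x - a) : ℝ) : ℂ))

/-- The Fourier coefficient `û_l = (b - a)⁻¹ ∫_a^b u(x) e^{-i μ_l (x - a)} dx`. -/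
def fourierHat (a b : ℝ) (u : ℝ → ℂ) (l : ℤ) : ℂ :=
  1 / ((b - a : ℝ) : ℂ) *
    ∫ x in a..b, u x * Complex.exp (-(Complex.I * ((freq a b l * (x - a) : ℝ) : ℂ)))

/-- The discrete Fourier coefficient `N⁻¹ ∑_{j < N} v_j e^{-i μ_l (x_j - a)}` of
`v = (v_0, …, v_N)`. -/
def discreteHat (a b : ℝ) (N : ℕ) (v : Fin (N + 1) → ℂ) (l : ℤ) : ℂ :=
  1 / (N : ℂ) * ∑ j : Fin N, v j.castSucc *
    Complex.exp (-(Complex.I * ((freq a b l * (node a b N j - a) : ℝ) : ℂ)))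

/-- The trigonometric interpolant `I_N v`. -/
def interp (a b : ℝ) (N : ℕ) (v : Fin (N + 1) → ℂ) (x : ℝ) : ℂ :=
  ∑ l ∈ freqs N, discreteHat a b N v l * mode a b l x

/-- `ψ⁽¹⁾(x) = (1 - i τ V(x, t)) I_N(v e^{-i τ β |v|²})(x)`. -/
def potentialStep (a b β : ℝ) (V : ℝ → ℝ → ℝ) (N : ℕ) (τ t : ℝ) (v : Fin (N + 1) → ℂ)
    (x : ℝ) : ℂ :=
  (1 - Complex.I * (τ : ℂ) * (V t x : ℂ)) *
    interp a b N
      (fun j => v j * Complex.exp (-(Complex.I * ((τ * (β * ‖v j‖ ^ 2) : ℝ) : ℂ)))) x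

/-- One step of the scheme at time `t`:
`v ↦ (∑_l e^{-i τ μ_l²} (ψ⁽¹⁾)^_l e^{i μ_l (x_j - a)})_{0 ≤ j ≤ N}`. -/
def schemeStep (a b β : ℝ) (V : ℝ → ℝ → ℝ) (N : ℕ) (τ t : ℝ) (v : Fin (N + 1) → ℂ) :
    Fin (N + 1) → ℂ :=
  fun j => ∑ l ∈ freqs N, Complex.exp (-(Complex.I * ((τ * freq a b l ^ 2 : ℝ) : ℂ))) *
    fourierHat a b (potentialStep a b β V N τ t v) l * mode a b l (node a b N j)

/-- The LTSeFP approximations `ψⁿ = (ψⁿ_0, …, ψⁿ_N)`, with `ψ⁰_j = ψ₀(x_j)`, at `t_n = n τ`. -/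
def scheme (a b β : ℝ) (V : ℝ → ℝ → ℝ) (ψ₀ : ℝ → ℂ) (N : ℕ) (τ : ℝ) :
    ℕ → Fin (N + 1) → ℂ
  | 0 => fun j => ψ₀ (node a b N j)
  | n + 1 => schemeStep a b β V N τ (n * τ) (scheme a b β V ψ₀ N τ n)

/-- The error `ψ(·, t_n) - I_N ψⁿ` at `t_n = n τ`. -/
def error (a b β : ℝ) (V : ℝ → ℝ → ℝ) (ψ₀ : ℝ → ℂ) (ψ : ℝ → ℝ → ℂ) (N : ℕ) (τ : ℝ) (n : ℕ)
    (x : ℝ) : ℂ :=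
  ψ (n * τ) x - interp a b N (scheme a b β V ψ₀ N τ n) x

end GPE

end

/-!
The proof takes place on the Fourier side. Let `p(t)` be the vector of Fourier coefficients
`ψ̂_l(t)`, `l ∈ freqs N`, let `g(t)` be that of the forcing `G = V ψ + β |ψ|² ψ`, let `q` be the
vector of discrete Fourier coefficients of the grid function, and `S = diag (e^{-i τ μ_l²})`. All
these vectors live in a Euclidean space whose norm is, by Parseval's identity, a multiple of the
`L²` norm of the corresponding trigonometric polynomials.

*Time.* The forcing is only Lipschitz continuous in time with values in `L²`, without any regularity
in space. Duhamel's formula gives `p(t + τ) = S p(t) - i Φ g(t) + O(τ²)`, whereas the scheme uses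
`S τ` in place of the diagonal matrix `Φ` of the integrals `∫₀^τ e^{-i (τ - s) μ_l²} ds`. The
difference is of size `τ² μ_l²`, hence not `O(τ²)`, but it oscillates in time. The step size
restriction gives `τ μ_l² ≤ π`, so `1 - e^{-i τ μ_l²}` is bounded below by a multiple of `τ μ_l²`,
and `i (Φ - τ S) = (1 - S) Γ` with a diagonal matrix `Γ = O(τ)` (`corrector`). For the corrected
coefficients `p + Γ g` the local error is therefore `O(τ²)` (`IsRegular.norm_local_error_le`); this
is a summation by parts in time done once and for all.

*Space.* On `H^m_per` both the projection error (`PerBound.l2_sub_trig_le`) and the interpolation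
error (`PerBound.norm_vec_fourierHat_sub_discreteHat_le`) are `O(h^m)`. They enter each step with a
factor `τ`, because the nonlinear substep changes the grid values by `O(τ)`, and because
`|ψ|² ψ ∈ H^m_per`, the space being an algebra (`PerBound.exists_mul`).

*Stability.* As long as the grid values are bounded, one step multiplies the error by at most
`1 + C τ` and adds `C τ (τ + h^m)` (`exists_step_bound`). The error `O(τ + h^m) = O(h²)` in `L²`
controls the grid values up to `O(h^{3/2})` by the inverse inequality, so the bound on the grid
values propagates for small `h` (`exists_coefficient_error_bound`). The `H¹` estimate follows from
the `L²` estimate for the coefficients, since `|μ_l| ≤ π / h` and `τ / h ≤ τ^{1/2}`.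
-/

/-! ### Absolutely continuous functions -/

namespace GPE

/-- `f` is a primitive of the integrable function `f'` on `[a, b]`, i.e. `f` is absolutely
continuous on `[a, b]` with almost everywhere derivative `f'`. -/
structure IsPrimitive (a b : ℝ) (f f' : ℝ → ℂ) : Prop where
  integrable : IntervalIntegrable f' volume a b
  eq_add_integral : ∀ x ∈ Icc a b, f x = f a + ∫ t in a..x, f' t

lemma absolutelyContinuousOnInterval_integral {f : ℝ → ℂ} {a b : ℝ}
    (hf : IntervalIntegrable f volume a b) :
    AbsolutelyContinuousOnInterval (fun x ↦ ∫ t in a..x, f t) a b := by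
  have h1 := hf.norm.absolutelyContinuousOnInterval_intervalIntegral (c := a) (by simp)
  rw [absolutelyContinuousOnInterval_iff] at h1 ⊢
  intro ε hε
  obtain ⟨δ, hδ, H⟩ := h1 ε hε
  refine ⟨δ, hδ, fun E hE hlt ↦ (Finset.sum_le_sum fun i hi ↦ ?_).trans_lt (H E hE hlt)⟩
  have hsub : ∀ x ∈ uIcc a b, IntervalIntegrable f volume a x := fun x hx ↦
    hf.mono_set (uIcc_subset_uIcc_left hx)
  have hx := hsub _ (hE.1 i hi).1
  have hy := hsub _ (hE.1 i hi).2
  simp only [dist_eq_norm, Real.norm_eq_abs]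
  rw [intervalIntegral.integral_interval_sub_left hx hy,
    intervalIntegral.integral_interval_sub_left hx.norm hy.norm]
  exact intervalIntegral.norm_integral_le_abs_integral_norm

namespace IsPrimitive

variable {a b : ℝ} {f f' g g' : ℝ → ℂ}

lemma absolutelyContinuousOnInterval (hab : a ≤ b) (hf : IsPrimitive a b f f') :
    AbsolutelyContinuousOnInterval f a b := by
  have h1 := absolutelyContinuousOnInterval_integral hf.integrable
  have h2 : AbsolutelyContinuousOnInterval (fun _ : ℝ ↦ f a) a b :=
    (LipschitzWith.const (f a)).lipschitzOnWith.absolutelyContinuousOnInterval (K := 0)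
  have h3 := h2.add h1
  rw [absolutelyContinuousOnInterval_iff] at h3 ⊢
  intro ε hε
  obtain ⟨δ, hδ, H⟩ := h3 ε hε
  refine ⟨δ, hδ, fun E hE hlt ↦ lt_of_eq_of_lt (Finset.sum_congr rfl fun i hi ↦ ?_) (H E hE hlt)⟩
  have hx := (hE.1 i hi).1
  have hy := (hE.1 i hi).2
  rw [uIcc_of_le hab] at hx hy
  rw [hf.eq_add_integral _ hx, hf.eq_add_integral _ hy]
  rfl

lemma continuousOn (hab : a ≤ b) (hf : IsPrimitive a b f f') : ContinuousOn f (Icc a b) := by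
  simpa [uIcc_of_le hab] using (hf.absolutelyContinuousOnInterval hab).continuousOn

lemma ae_hasDerivAt (hab : a ≤ b) (hf : IsPrimitive a b f f') :
    ∀ᵐ x, x ∈ uIcc a b → HasDerivAt f (f' x) x := by
  have ha : ∀ᵐ x : ℝ, x ≠ a := by simp [ae_iff, measure_singleton]
  have hb : ∀ᵐ x : ℝ, x ≠ b := by simp [ae_iff, measure_singleton]
  filter_upwards [hf.integrable.ae_hasDerivAt_integral, ha, hb] with x hx hxa hxb hxm
  have h1 := (hx hxm a (by simp)).const_add (f a)
  rw [uIcc_of_le hab] at hxm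
  refine h1.congr_of_eventuallyEq ?_
  filter_upwards [Ioo_mem_nhds (lt_of_le_of_ne hxm.1 hxa.symm) (lt_of_le_of_ne hxm.2 hxb)]
    with y hy
  exact hf.eq_add_integral y (Ioo_subset_Icc_self hy)

lemma integrable_mul (hab : a ≤ b) (hf : IsPrimitive a b f f') (hg : IsPrimitive a b g g') :
    IntervalIntegrable (fun x ↦ f' x * g x + f x * g' x) volume a b := by
  have hfc := hf.continuousOn hab
  have hgc := hg.continuousOn hab
  rw [← uIcc_of_le hab] at hfc hgc
  exact (hf.integrable.mul_continuousOn hgc).add (hg.integrable.continuousOn_mul hfc)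

/-- The product rule for absolutely continuous functions. -/
lemma mul (hab : a ≤ b) (hf : IsPrimitive a b f f') (hg : IsPrimitive a b g g') :
    IsPrimitive a b (fun x ↦ f x * g x) (fun x ↦ f' x * g x + f x * g' x) := by
  have hint := hf.integrable_mul hab hg
  refine ⟨hint, fun x hx ↦ ?_⟩
  have hac : AbsolutelyContinuousOnInterval
      (fun x ↦ f x * g x - ∫ t in a..x, (f' t * g t + f t * g' t)) a b :=
    ((hf.absolutelyContinuousOnInterval hab).smul
      (hg.absolutelyContinuousOnInterval hab)).sub
      (absolutelyContinuousOnInterval_integral hint)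
  obtain ⟨c, hc⟩ := hac.const_of_ae_hasDerivAt_zero (by
    filter_upwards [hf.ae_hasDerivAt hab, hg.ae_hasDerivAt hab, hint.ae_hasDerivAt_integral]
      with x h1 h2 h3 hx
    convert! ((h1 hx).mul (h2 hx)).sub (h3 hx a (by simp)) using 1
    simp)
  have h1 := hc x (by rwa [uIcc_of_le hab])
  have h2 := hc a (by simp)
  simp only [intervalIntegral.integral_same, sub_zero] at h2
  rw [h2, ← h1]
  ring

lemma add (hf : IsPrimitive a b f f') (hg : IsPrimitive a b g g') :
    IsPrimitive a b (fun x ↦ f x + g x) (fun x ↦ f' x + g' x) := by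
  refine ⟨hf.integrable.add hg.integrable, fun x hx ↦ ?_⟩
  have hs : uIcc a x ⊆ uIcc a b := by
    rw [uIcc_of_le hx.1, uIcc_of_le (hx.1.trans hx.2)]
    exact Icc_subset_Icc_right hx.2
  rw [intervalIntegral.integral_add (hf.integrable.mono_set hs) (hg.integrable.mono_set hs),
    hf.eq_add_integral x hx, hg.eq_add_integral x hx]
  ring

lemma const_mul (c : ℂ) (hf : IsPrimitive a b f f') :
    IsPrimitive a b (fun x ↦ c * f x) (fun x ↦ c * f' x) := by
  refine ⟨hf.integrable.const_mul c, fun x hx ↦ ?_⟩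
  rw [intervalIntegral.integral_const_mul, hf.eq_add_integral x hx]
  ring

lemma conj (hf : IsPrimitive a b f f') :
    IsPrimitive a b (fun x ↦ starRingEnd ℂ (f x)) (fun x ↦ starRingEnd ℂ (f' x)) := by
  have hc := hf.integrable
  refine ⟨?_, fun x hx ↦ ?_⟩
  · constructor
    · exact (LinearIsometryEquiv.integrable_comp_iff Complex.conjLIE).2 hc.1
    · exact (LinearIsometryEquiv.integrable_comp_iff Complex.conjLIE).2 hc.2
  · rw [hf.eq_add_integral x hx, map_add, intervalIntegral.integral_of_le hx.1,
      intervalIntegral.integral_of_le hx.1, integral_conj]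

end IsPrimitive

lemma isPrimitive_of_hasDerivAt {a b : ℝ} {f f' : ℝ → ℂ}
    (hf : ∀ x, HasDerivAt f (f' x) x) (hf' : Continuous f') : IsPrimitive a b f f' := by
  refine ⟨hf'.intervalIntegrable _ _, fun x _ ↦ ?_⟩
  rw [intervalIntegral.integral_eq_sub_of_hasDerivAt (fun y _ ↦ hf y)
    (hf'.intervalIntegrable _ _)]
  ring

end GPE

/-! ### Fourier coefficients and trigonometric polynomials -/

namespace GPE

/-- The norm of `L²(a, b)` as a real number. -/
noncomputable abbrev l2 (a b : ℝ) (f : ℝ → ℂ) : ℝ := lpNorm f 2 (volΩ a b)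

lemma l2_nonneg (a b : ℝ) (f : ℝ → ℂ) : 0 ≤ l2 a b f := lpNorm_nonneg

/-- The trigonometric polynomial with coefficients `c l`, `l ∈ freqs N`. -/
noncomputable def trig (a b : ℝ) (N : ℕ) (c : ℤ → ℂ) (x : ℝ) : ℂ :=
  ∑ l ∈ freqs N, c l * mode a b l x

/-- The coefficients `c l`, `l ∈ freqs N`, as a vector of a Euclidean space. -/
noncomputable def vec (N : ℕ) (c : ℤ → ℂ) : EuclideanSpace ℂ (freqs N) :=
  WithLp.toLp 2 fun l ↦ c l

lemma norm_vec_sq (N : ℕ) (c : ℤ → ℂ) : ‖vec N c‖ ^ 2 = ∑ l ∈ freqs N, ‖c l‖ ^ 2 := by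
  rw [EuclideanSpace.norm_sq_eq]
  exact Finset.sum_coe_sort (freqs N) fun l ↦ ‖c l‖ ^ 2

lemma norm_vec_le_of_le {N : ℕ} {c d : ℤ → ℂ} (r : ℝ) (hr : 0 ≤ r)
    (h : ∀ l ∈ freqs N, ‖c l‖ ≤ r * ‖d l‖) : ‖vec N c‖ ≤ r * ‖vec N d‖ := by
  refine le_of_sq_le_sq ?_ (by positivity)
  rw [mul_pow, norm_vec_sq, norm_vec_sq, Finset.mul_sum]
  refine Finset.sum_le_sum fun l hl ↦ ?_
  rw [← mul_pow]
  gcongr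
  exact h l hl

lemma vec_add (N : ℕ) (c d : ℤ → ℂ) : vec N (fun l ↦ c l + d l) = vec N c + vec N d := rfl

lemma vec_sub (N : ℕ) (c d : ℤ → ℂ) : vec N (fun l ↦ c l - d l) = vec N c - vec N d := rfl

lemma vec_const_mul (N : ℕ) (r : ℂ) (c : ℤ → ℂ) : vec N (fun l ↦ r * c l) = r • vec N c := rfl

lemma vec_congr {N : ℕ} {c d : ℤ → ℂ} (h : ∀ l ∈ freqs N, c l = d l) : vec N c = vec N d := by
  ext l
  exact h l l.2

variable {a b : ℝ}

lemma restrict_Ioc_eq_volΩ (a b : ℝ) : volume.restrict (Ioc a b) = volΩ a b :=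
  restrict_Ioo_eq_restrict_Ioc.symm

lemma intervalIntegrable_iff_volΩ (hab : a ≤ b) {f : ℝ → ℂ} :
    IntervalIntegrable f volume a b ↔ Integrable f (volΩ a b) := by
  rw [intervalIntegrable_iff_integrableOn_Ioc_of_le hab, IntegrableOn, restrict_Ioc_eq_volΩ]

lemma _root_.MeasureTheory.MemLp.intervalIntegrable_volΩ (hab : a ≤ b) {f : ℝ → ℂ}
    (hf : MemLp f 2 (volΩ a b)) : IntervalIntegrable f volume a b :=
  (intervalIntegrable_iff_volΩ hab).2 (hf.integrable one_le_two)

lemma l2_sq (hab : a ≤ b) {f : ℝ → ℂ} (hf : MemLp f 2 (volΩ a b)) :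
    l2 a b f ^ 2 = ∫ x in a..b, ‖f x‖ ^ 2 := by
  rw [l2, lpNorm_eq_integral_norm_rpow_toReal (by simp) (by simp) hf.1,
    intervalIntegral.integral_of_le hab, restrict_Ioc_eq_volΩ]
  simp only [ENNReal.toReal_ofNat, Real.rpow_ofNat]
  rw [← Real.rpow_natCast, ← Real.rpow_mul (integral_nonneg fun x ↦ by positivity)]
  norm_num

lemma mode_neg (l : ℤ) (x : ℝ) :
    mode a b (-l) x = Complex.exp (-(Complex.I * ((freq a b l * (x - a) : ℝ) : ℂ))) := by
  rw [mode, freq, freq]; congr 1; push_cast; ring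

lemma mode_mul_mode (l k : ℤ) (x : ℝ) : mode a b l x * mode a b k x = mode a b (l + k) x := by
  rw [mode, mode, mode, ← Complex.exp_add, freq, freq, freq]; congr 1; push_cast; ring

lemma mode_left (l : ℤ) : mode a b l a = 1 := by simp [mode]

lemma mode_right (hab : a < b) (l : ℤ) : mode a b l b = 1 := by
  rw [mode, freq, Complex.exp_eq_one_iff]
  have : b - a ≠ 0 := by linarith
  refine ⟨l, ?_⟩
  rw [div_mul_cancel₀ _ this]
  push_cast
  ring

lemma mode_zero (x : ℝ) : mode a b 0 x = 1 := by simp [mode, freq]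

lemma hasDerivAt_mode (l : ℤ) (x : ℝ) :
    HasDerivAt (mode a b l) (Complex.I * freq a b l * mode a b l x) x := by
  have h1 : HasDerivAt (fun x : ℝ ↦ Complex.I * ((freq a b l * (x - a) : ℝ) : ℂ))
      (Complex.I * freq a b l) x := by
    have := (((hasDerivAt_id x).sub_const a).const_mul (freq a b l)).ofReal_comp.const_mul
      Complex.I
    simpa using this
  have := h1.cexp
  rw [mul_comm] at this
  exact this

lemma continuous_mode (l : ℤ) : Continuous (mode a b l) := by
  unfold mode; fun_prop

lemma isPrimitive_mode (l : ℤ) :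
    IsPrimitive a b (mode a b l) (fun x ↦ Complex.I * freq a b l * mode a b l x) :=
  isPrimitive_of_hasDerivAt (hasDerivAt_mode l) (continuous_const.mul (continuous_mode l))

lemma fourierHat_eq (u : ℝ → ℂ) (l : ℤ) :
    fourierHat a b u l = ((b - a : ℝ) : ℂ)⁻¹ * ∫ x in a..b, u x * mode a b (-l) x := by
  simp only [fourierHat, mode_neg, one_div]

lemma integral_mode (hab : a < b) (l : ℤ) :
    ∫ x in a..b, mode a b l x = if l = 0 then ((b - a : ℝ) : ℂ) else 0 := by
  split_ifs with h
  · simp [h, mode_zero]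
  · have h1 := (isPrimitive_mode (a := a) (b := b) l).eq_add_integral b (right_mem_Icc.2 hab.le)
    rw [mode_left, mode_right hab, intervalIntegral.integral_const_mul] at h1
    have h2 : freq a b l ≠ 0 := by
      have : b - a ≠ 0 := by linarith
      have : (l : ℝ) ≠ 0 := by exact_mod_cast h
      rw [freq]; positivity
    have h3 : Complex.I * (freq a b l : ℂ) ≠ 0 :=
      mul_ne_zero Complex.I_ne_zero (by exact_mod_cast h2)
    have h4 : Complex.I * (freq a b l : ℂ) * ∫ x in a..b, mode a b l x = 0 := by
      linear_combination -h1
    exact (mul_eq_zero.1 h4).resolve_left h3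

lemma continuous_trig (N : ℕ) (c : ℤ → ℂ) : Continuous (trig a b N c) :=
  continuous_finsetSum _ fun l _ ↦ continuous_const.mul (continuous_mode l)

lemma fourierHat_trig (hab : a < b) (N : ℕ) (c : ℤ → ℂ) (l : ℤ) :
    fourierHat a b (trig a b N c) l = if l ∈ freqs N then c l else 0 := by
  have hba : ((b - a : ℝ) : ℂ) ≠ 0 := by
    have : b - a ≠ 0 := by linarith
    exact_mod_cast this
  have h1 : ∀ x, trig a b N c x * mode a b (-l) x =
      ∑ k ∈ freqs N, c k * mode a b (k - l) x := by
    intro x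
    rw [trig, Finset.sum_mul]
    refine Finset.sum_congr rfl fun k _ ↦ ?_
    rw [mul_assoc, mode_mul_mode, sub_eq_add_neg]
  rw [fourierHat_eq]
  simp only [h1]
  rw [intervalIntegral.integral_finsetSum fun k _ ↦
    ((continuous_mode (k - l)).const_mul (c k)).intervalIntegrable _ _]
  simp only [intervalIntegral.integral_const_mul, integral_mode hab, sub_eq_zero, mul_ite,
    mul_zero, Finset.sum_ite_eq']
  split_ifs
  · field_simp
  · simp

lemma intervalIntegrable_mul_mode {f : ℝ → ℂ} (hf : IntervalIntegrable f volume a b) (l : ℤ) :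
    IntervalIntegrable (fun x ↦ f x * mode a b l x) volume a b :=
  hf.mul_continuousOn (continuous_mode l).continuousOn

lemma fourierHat_add {f g : ℝ → ℂ} (hf : IntervalIntegrable f volume a b)
    (hg : IntervalIntegrable g volume a b) (l : ℤ) :
    fourierHat a b (fun x ↦ f x + g x) l = fourierHat a b f l + fourierHat a b g l := by
  simp only [fourierHat_eq, add_mul]
  rw [intervalIntegral.integral_add (intervalIntegrable_mul_mode hf _)
    (intervalIntegrable_mul_mode hg _), mul_add]

lemma fourierHat_sub {f g : ℝ → ℂ} (hf : IntervalIntegrable f volume a b)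
    (hg : IntervalIntegrable g volume a b) (l : ℤ) :
    fourierHat a b (fun x ↦ f x - g x) l = fourierHat a b f l - fourierHat a b g l := by
  simp only [fourierHat_eq, sub_mul]
  rw [intervalIntegral.integral_sub (intervalIntegrable_mul_mode hf _)
    (intervalIntegrable_mul_mode hg _), mul_sub]

lemma fourierHat_const_mul (r : ℂ) (f : ℝ → ℂ) (l : ℤ) :
    fourierHat a b (fun x ↦ r * f x) l = r * fourierHat a b f l := by
  simp only [fourierHat_eq, mul_assoc]
  rw [intervalIntegral.integral_const_mul]
  ring

lemma fourierHat_congr_ae (hab : a ≤ b) {f g : ℝ → ℂ} (h : f =ᵐ[volΩ a b] g) (l : ℤ) :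
    fourierHat a b f l = fourierHat a b g l := by
  simp only [fourierHat_eq, intervalIntegral.integral_of_le hab, restrict_Ioc_eq_volΩ]
  congr 1
  refine integral_congr_ae ?_
  filter_upwards [h] with x hx
  rw [hx]

/-- Integration by parts: differentiation multiplies the Fourier coefficients of a periodic
function by `i μ_l`. -/
lemma fourierHat_deriv (hab : a < b) {f f' : ℝ → ℂ} (hf : IsPrimitive a b f f')
    (hper : f b = f a) (l : ℤ) :
    fourierHat a b f' l = Complex.I * freq a b l * fourierHat a b f l := by
  have hm := isPrimitive_mode (a := a) (b := b) (-l)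
  have h1 := (hf.mul hab.le hm).eq_add_integral b (right_mem_Icc.2 hab.le)
  have hfc : ContinuousOn f (uIcc a b) := by
    rw [uIcc_of_le hab.le]; exact hf.continuousOn hab.le
  rw [mode_left, mode_right hab, hper, intervalIntegral.integral_add
    (intervalIntegrable_mul_mode hf.integrable _) (hm.integrable.continuousOn_mul hfc)] at h1
  have h2 : ∀ x, f x * (Complex.I * freq a b (-l) * mode a b (-l) x) =
      -(Complex.I * freq a b l) * (f x * mode a b (-l) x) := by
    intro x
    have : freq a b (-l) = - freq a b l := by simp [freq]; ring
    rw [this]; push_cast; ring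
  simp only [h2, intervalIntegral.integral_const_mul] at h1
  rw [fourierHat_eq, fourierHat_eq]
  linear_combination (-((b - a : ℝ) : ℂ)⁻¹) * h1

/-- Parseval's identity. -/
lemma hasSum_sq_fourierHat (hab : a < b) {f : ℝ → ℂ} (hf : MemLp f 2 (volΩ a b)) :
    HasSum (fun l ↦ ‖fourierHat a b f l‖ ^ 2) ((b - a)⁻¹ * l2 a b f ^ 2) := by
  have h := hasSum_sq_fourierCoeffOn hab (f := f) (by rwa [restrict_Ioc_eq_volΩ])
  rw [← l2_sq hab.le hf, smul_eq_mul] at h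
  convert h using 3 with l
  -- the two conventions differ by the unimodular factor `e^{i μ_l a}`
  have hba : ((b - a : ℝ) : ℂ) ≠ 0 := by
    have : b - a ≠ 0 := by linarith
    exact_mod_cast this
  have h1 : ∀ x : ℝ, f x * mode a b (-l) x =
      Complex.exp ((freq a b l * a : ℝ) * Complex.I) *
        (fourier (-l) (x : AddCircle (b - a)) • f x) := by
    intro x
    rw [fourier_coe_apply, smul_eq_mul, ← mul_assoc, ← Complex.exp_add, mul_comm, mode, freq,
      freq]
    congr 2
    push_cast at hba ⊢
    field_simp
    ring
  rw [fourierHat_eq, fourierCoeffOn_eq_integral]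
  simp only [h1, intervalIntegral.integral_const_mul]
  rw [norm_mul, norm_mul, Complex.norm_exp_ofReal_mul_I, norm_smul, one_mul, norm_inv,
    Complex.norm_real, norm_div, norm_one, one_div]

/-- Bessel's inequality. -/
lemma norm_vec_fourierHat_le (hab : a < b) {f : ℝ → ℂ} (hf : MemLp f 2 (volΩ a b)) (N : ℕ) :
    ‖vec N (fourierHat a b f)‖ ≤ √(b - a)⁻¹ * l2 a b f := by
  have hba : 0 < b - a := by linarith
  refine le_of_sq_le_sq ?_ (mul_nonneg (by positivity) (l2_nonneg _ _ _))
  rw [norm_vec_sq, mul_pow, Real.sq_sqrt (by positivity)]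
  exact sum_le_hasSum _ (fun _ _ ↦ by positivity) (hasSum_sq_fourierHat hab hf)

lemma memLp_of_continuousOn {f : ℝ → ℂ} (hf : ContinuousOn f (Icc a b)) :
    MemLp f 2 (volΩ a b) := by
  have : MemLp f 2 (volume.restrict (Icc a b)) := by
    obtain ⟨C, hC⟩ := isCompact_Icc.exists_bound_of_continuousOn hf
    exact MemLp.of_bound (hf.aestronglyMeasurable measurableSet_Icc) C
      ((ae_restrict_iff' measurableSet_Icc).2 (ae_of_all _ hC))
  exact this.mono_measure (Measure.restrict_mono Ioo_subset_Icc_self le_rfl)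

lemma memLp_trig (N : ℕ) (c : ℤ → ℂ) : MemLp (trig a b N c) 2 (volΩ a b) :=
  memLp_of_continuousOn (continuous_trig N c).continuousOn

lemma le_abs_freq_of_notMem (hab : a < b) {N : ℕ} (hN : 0 < N) (hN2 : Even N) {l : ℤ}
    (hl : l ∉ freqs N) : Real.pi / mesh a b N ≤ |freq a b l| := by
  have hba : 0 < b - a := by linarith
  have hl' : (N : ℤ) ≤ 2 * |l| := by
    obtain ⟨k, rfl⟩ := hN2
    simp only [freqs, Finset.mem_Ico, not_and_or, not_le, not_lt] at hl
    push_cast at hl ⊢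
    rcases abs_cases l with h | h <;> omega
  have hl2 : (N : ℝ) ≤ 2 * |(l : ℝ)| := by exact_mod_cast hl'
  rw [mesh, freq, abs_div, abs_mul, abs_mul, abs_of_pos hba, abs_of_pos Real.pi_pos]
  rw [div_div_eq_mul_div, abs_two]
  have := Real.pi_pos
  gcongr ?_ / _
  nlinarith

lemma abs_freq_le_of_mem (hab : a < b) {N : ℕ} (hN : 0 < N) (hN2 : Even N) {l : ℤ}
    (hl : l ∈ freqs N) : |freq a b l| ≤ Real.pi / mesh a b N := by
  have hba : 0 < b - a := by linarith
  have hl' : 2 * |l| ≤ (N : ℤ) := by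
    obtain ⟨k, rfl⟩ := hN2
    simp only [freqs, Finset.mem_Ico] at hl
    push_cast at hl ⊢
    rcases abs_cases l with h | h <;> omega
  have hl2 : 2 * |(l : ℝ)| ≤ (N : ℝ) := by exact_mod_cast hl'
  rw [mesh, freq, abs_div, abs_mul, abs_mul, abs_of_pos hba, abs_of_pos Real.pi_pos]
  rw [div_div_eq_mul_div, abs_two]
  have := Real.pi_pos
  gcongr ?_ / _
  nlinarith

lemma mesh_pos (hab : a < b) {N : ℕ} (hN : 0 < N) : 0 < mesh a b N := by
  have : (0 : ℝ) < N := by exact_mod_cast hN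
  have hba : 0 < b - a := by linarith
  exact div_pos hba this

end GPE

/-! ### Periodic Sobolev functions -/

namespace GPE

variable {a b : ℝ}

lemma memLp_of_ae_le {E F : Type*} [NormedAddCommGroup E] [NormedAddCommGroup F] {f : ℝ → E}
    {g : ℝ → F} {K : ℝ} (hf : AEStronglyMeasurable f (volΩ a b)) (hg : MemLp g 2 (volΩ a b))
    (h : ∀ᵐ x ∂volΩ a b, ‖f x‖ ≤ K * ‖g x‖) : MemLp f 2 (volΩ a b) :=
  hg.of_le_mul hf h

lemma lpNorm_le_of_ae_le {E F : Type*} [NormedAddCommGroup E] [NormedAddCommGroup F] {f : ℝ → E}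
    {g : ℝ → F} {K : ℝ} (hK : 0 ≤ K) (hf : AEStronglyMeasurable f (volΩ a b))
    (hg : MemLp g 2 (volΩ a b)) (h : ∀ᵐ x ∂volΩ a b, ‖f x‖ ≤ K * ‖g x‖) :
    lpNorm f 2 (volΩ a b) ≤ K * lpNorm g 2 (volΩ a b) := by
  rw [← toReal_eLpNorm hf, ← toReal_eLpNorm hg.1, ← ENNReal.toReal_ofReal hK,
    ← ENNReal.toReal_mul]
  exact ENNReal.toReal_mono (ENNReal.mul_ne_top (by simp) hg.2.ne)
    (eLpNorm_le_mul_eLpNorm_of_ae_le_mul h 2)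

lemma l2_const (hab : a ≤ b) (c : ℂ) : l2 a b (fun _ ↦ c) = √(b - a) * ‖c‖ := by
  have h := l2_sq hab (memLp_const (μ := volΩ a b) (p := 2) c)
  have hba : 0 ≤ b - a := by linarith
  refine (sq_eq_sq₀ (l2_nonneg _ _ _) (by positivity)).1 ?_
  rw [h, mul_pow, Real.sq_sqrt hba]
  simp

lemma l2_le_of_ae_bound (hab : a ≤ b) {f : ℝ → ℂ} {M : ℝ} (hM : 0 ≤ M)
    (hf : AEStronglyMeasurable f (volΩ a b)) (h : ∀ᵐ x ∂volΩ a b, ‖f x‖ ≤ M) :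
    l2 a b f ≤ √(b - a) * M := by
  have := lpNorm_le_of_ae_le (g := fun _ : ℝ ↦ (1 : ℂ)) hM hf (memLp_const _) (by simpa using h)
  have h1 := l2_const hab 1
  rw [l2, norm_one, mul_one] at h1
  rw [h1] at this
  linarith

lemma ae_volΩ_of_forall_Icc {p : ℝ → Prop} (h : ∀ x ∈ Icc a b, p x) : ∀ᵐ x ∂volΩ a b, p x :=
  (ae_restrict_iff' measurableSet_Ioo).2 (ae_of_all _ fun x hx ↦ h x (Ioo_subset_Icc_self hx))

/-- `PerBound a b M m f` says that `f` belongs to `H^m_per(a, b)` with derivatives up to order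
`m` bounded by `M`, where the derivatives of order `< m` are measured in the supremum norm and the
last one in `L²(a, b)`. -/
def PerBound (a b M : ℝ) : ℕ → (ℝ → ℂ) → Prop
  | 0, f => MemLp f 2 (volΩ a b) ∧ l2 a b f ≤ M
  | m + 1, f => ∃ f', PerBound a b M m f' ∧ IsPrimitive a b f f' ∧ f b = f a ∧
      ∀ x ∈ Icc a b, ‖f x‖ ≤ M

namespace PerBound

variable {f g : ℝ → ℂ} {M M' : ℝ} {m : ℕ}

lemma nonneg (hf : PerBound a b M m f) : 0 ≤ M := by
  induction m generalizing f with
  | zero => exact (l2_nonneg _ _ _).trans hf.2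
  | succ m ih => obtain ⟨f', h, _⟩ := hf; exact ih h

lemma mono (hM : M ≤ M') (hf : PerBound a b M m f) : PerBound a b M' m f := by
  induction m generalizing f with
  | zero => exact ⟨hf.1, hf.2.trans hM⟩
  | succ m ih =>
    obtain ⟨f', h, h1, h2, h3⟩ := hf
    exact ⟨f', ih h, h1, h2, fun x hx ↦ (h3 x hx).trans hM⟩

lemma continuousOn (hab : a ≤ b) (hf : PerBound a b M (m + 1) f) : ContinuousOn f (Icc a b) := by
  obtain ⟨f', -, h, -⟩ := hf
  exact h.continuousOn hab

lemma memLp (hab : a ≤ b) (hf : PerBound a b M m f) : MemLp f 2 (volΩ a b) := by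
  cases m with
  | zero => exact hf.1
  | succ m => exact memLp_of_continuousOn (hf.continuousOn hab)

lemma norm_le (hf : PerBound a b M (m + 1) f) {x : ℝ} (hx : x ∈ Icc a b) : ‖f x‖ ≤ M := by
  obtain ⟨f', -, -, -, h⟩ := hf
  exact h x hx

lemma pred (hab : a ≤ b) (hf : PerBound a b M (m + 1) f) :
    PerBound a b (max 1 √(b - a) * M) m f := by
  have hM := hf.nonneg
  induction m generalizing f with
  | zero =>
    refine ⟨hf.memLp hab, (l2_le_of_ae_bound hab hM (hf.memLp hab).1
      (ae_volΩ_of_forall_Icc fun x hx ↦ hf.norm_le hx)).trans ?_⟩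
    gcongr
    exact le_max_right _ _
  | succ m ih =>
    obtain ⟨f', h, h1, h2, h3⟩ := hf
    refine ⟨f', ih h, h1, h2, fun x hx ↦ (h3 x hx).trans ?_⟩
    exact le_mul_of_one_le_left hM (le_max_left _ _)

lemma add (hf : PerBound a b M m f) (hg : PerBound a b M' m g) :
    PerBound a b (M + M') m (fun x ↦ f x + g x) := by
  induction m generalizing f g with
  | zero =>
    exact ⟨hf.1.add hg.1, (lpNorm_add_le hf.1 one_le_two).trans (add_le_add hf.2 hg.2)⟩
  | succ m ih =>
    obtain ⟨f', h, h1, h2, h3⟩ := hf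
    obtain ⟨g', k, k1, k2, k3⟩ := hg
    exact ⟨_, ih h k, h1.add k1, by simp only [h2, k2],
      fun x hx ↦ (norm_add_le _ _).trans (add_le_add (h3 x hx) (k3 x hx))⟩

lemma const_mul (r : ℂ) (hf : PerBound a b M m f) :
    PerBound a b (‖r‖ * M) m (fun x ↦ r * f x) := by
  induction m generalizing f with
  | zero =>
    refine ⟨hf.1.const_mul r, ?_⟩
    refine (lpNorm_le_of_ae_le (norm_nonneg r) (hf.1.const_mul r).1 hf.1
      (ae_of_all _ fun x ↦ (norm_mul _ _).le)).trans ?_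
    gcongr
    exact hf.2
  | succ m ih =>
    obtain ⟨f', h, h1, h2, h3⟩ := hf
    refine ⟨_, ih h, h1.const_mul r, by simp only [h2], fun x hx ↦ ?_⟩
    rw [norm_mul]
    gcongr
    exact h3 x hx

lemma conj (hf : PerBound a b M m f) : PerBound a b M m (fun x ↦ starRingEnd ℂ (f x)) := by
  induction m generalizing f with
  | zero =>
    have h : MemLp (fun x ↦ starRingEnd ℂ (f x)) 2 (volΩ a b) :=
      hf.1.of_le (Complex.continuous_conj.comp_aestronglyMeasurable hf.1.1)
        (ae_of_all _ fun x ↦ by simp)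
    refine ⟨h, le_trans ?_ hf.2⟩
    simpa using lpNorm_le_of_ae_le zero_le_one h.1 hf.1 (ae_of_all _ fun x ↦ by simp)
  | succ m ih =>
    obtain ⟨f', h, h1, h2, h3⟩ := hf
    exact ⟨_, ih h, h1.conj, by simp only [h2], fun x hx ↦ by simpa using h3 x hx⟩

/-- For `m ≥ 1` the space `H^m_per(a, b)` is an algebra. -/
lemma exists_mul (hab : a ≤ b) (m : ℕ) : ∃ C : ℝ, 0 ≤ C ∧ ∀ (f g : ℝ → ℂ) (M M' : ℝ),
    PerBound a b M (m + 1) f → PerBound a b M' (m + 1) g →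
      PerBound a b (C * M * M') (m + 1) (fun x ↦ f x * g x) := by
  induction m with
  | zero =>
    refine ⟨2, by norm_num, fun f g M M' hf hg ↦ ?_⟩
    have hM := hf.nonneg
    have hM' := hg.nonneg
    have hfL := hf.memLp hab
    have hgL := hg.memLp hab
    have hf0 := fun x hx ↦ hf.norm_le (x := x) hx
    have hg0 := fun x hx ↦ hg.norm_le (x := x) hx
    obtain ⟨f', h, h1, h2, -⟩ := hf
    obtain ⟨g', k, k1, k2, -⟩ := hg
    have e1 : PerBound a b (M * M') 0 (fun x ↦ f' x * g x) := by
      have hm : AEStronglyMeasurable (fun x ↦ f' x * g x) (volΩ a b) := h.1.1.mul hgL.1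
      have hle : ∀ᵐ x ∂volΩ a b, ‖f' x * g x‖ ≤ M' * ‖f' x‖ :=
        ae_volΩ_of_forall_Icc fun x hx ↦ by
          rw [norm_mul, mul_comm]
          exact mul_le_mul_of_nonneg_right (hg0 x hx) (norm_nonneg _)
      refine ⟨memLp_of_ae_le hm h.1 hle, (lpNorm_le_of_ae_le hM' hm h.1 hle).trans ?_⟩
      rw [mul_comm M]
      exact mul_le_mul_of_nonneg_left h.2 hM'
    have e2 : PerBound a b (M * M') 0 (fun x ↦ f x * g' x) := by
      have hm : AEStronglyMeasurable (fun x ↦ f x * g' x) (volΩ a b) := hfL.1.mul k.1.1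
      have hle : ∀ᵐ x ∂volΩ a b, ‖f x * g' x‖ ≤ M * ‖g' x‖ :=
        ae_volΩ_of_forall_Icc fun x hx ↦ by
          rw [norm_mul]
          exact mul_le_mul_of_nonneg_right (hf0 x hx) (norm_nonneg _)
      exact ⟨memLp_of_ae_le hm k.1 hle, (lpNorm_le_of_ae_le hM hm k.1 hle).trans
        (mul_le_mul_of_nonneg_left k.2 hM)⟩
    refine ⟨_, (e1.add e2).mono (le_of_eq (by ring)), h1.mul hab k1, by simp only [h2, k2],
      fun x hx ↦ ?_⟩
    rw [norm_mul]
    have := mul_le_mul (hf0 x hx) (hg0 x hx) (norm_nonneg _) hM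
    have := mul_nonneg hM hM'
    linarith
  | succ m ih =>
    obtain ⟨C, hC, H⟩ := ih
    set κ := max 1 √(b - a) with hκ
    have hκ1 : 1 ≤ κ := le_max_left _ _
    refine ⟨2 * C * κ + 1, by positivity, fun f g M M' hf hg ↦ ?_⟩
    have hM := hf.nonneg
    have hM' := hg.nonneg
    have hfp := hf.pred hab
    have hgp := hg.pred hab
    have hf0 := fun x hx ↦ hf.norm_le (x := x) hx
    have hg0 := fun x hx ↦ hg.norm_le (x := x) hx
    obtain ⟨f', h, h1, h2, -⟩ := hf
    obtain ⟨g', k, k1, k2, -⟩ := hg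
    have hMM := mul_nonneg hM hM'
    have hCκ : 0 ≤ C * κ := by positivity
    refine ⟨_, ((H _ _ _ _ h hgp).add (H _ _ _ _ hfp k)).mono ?_, h1.mul hab k1,
      by simp only [h2, k2], fun x hx ↦ ?_⟩
    · rw [← hκ]
      nlinarith
    · rw [norm_mul]
      have := mul_le_mul (hf0 x hx) (hg0 x hx) (norm_nonneg _) hM
      nlinarith

/-- The derivative of order `m`, seen on the Fourier side. -/
lemma exists_iterate_deriv (hab : a < b) (hf : PerBound a b M m f) :
    ∃ d : ℝ → ℂ, MemLp d 2 (volΩ a b) ∧ l2 a b d ≤ M ∧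
      ∀ l, ‖fourierHat a b d l‖ = |freq a b l| ^ m * ‖fourierHat a b f l‖ := by
  induction m generalizing f with
  | zero => exact ⟨f, hf.1, hf.2, by simp⟩
  | succ m ih =>
    obtain ⟨f', h, h1, h2, -⟩ := hf
    obtain ⟨d, k, k1, k2⟩ := ih h
    refine ⟨d, k, k1, fun l ↦ ?_⟩
    rw [k2, fourierHat_deriv hab h1 h2, norm_mul, norm_mul, Complex.norm_I, Complex.norm_real,
      Real.norm_eq_abs]
    ring

/-- The `L²` distance of `f ∈ H^m_per` to a trigonometric polynomial: the frequencies outside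
`freqs N` contribute the projection error `(h / π)^m M`, the others the distance of the
coefficients. -/
lemma l2_sub_trig_le (hab : a < b) (hf : PerBound a b M m f) {N : ℕ} (hN : 0 < N) (hN2 : Even N)
    (c : ℤ → ℂ) :
    l2 a b (fun x ↦ f x - trig a b N c x) ≤
      (mesh a b N / Real.pi) ^ m * M + √(b - a) * ‖vec N (fourierHat a b f) - vec N c‖ := by
  have hba : 0 < b - a := by linarith
  have hh := mesh_pos hab hN
  have hpi := Real.pi_pos
  have hM := hf.nonneg
  have hfL := hf.memLp hab.le
  obtain ⟨d, hd, hd1, hd2⟩ := hf.exists_iterate_deriv hab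
  have hgL : MemLp (fun x ↦ f x - trig a b N c x) 2 (volΩ a b) := hfL.sub (memLp_trig N c)
  set r := (mesh a b N / Real.pi) ^ m with hr
  have h1 := hasSum_sq_fourierHat hab hgL
  have h2 : HasSum (fun l ↦ if l ∈ freqs N then ‖fourierHat a b f l - c l‖ ^ 2 else 0)
      (∑ l ∈ freqs N, if l ∈ freqs N then ‖fourierHat a b f l - c l‖ ^ 2 else 0) :=
    hasSum_sum_of_ne_finset_zero fun l hl ↦ by simp [hl]
  have h3 := h2.add ((hasSum_sq_fourierHat hab hd).mul_left (r ^ 2))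
  have h4 := hasSum_le (fun l ↦ ?_) h1 h3
  · rw [Finset.sum_congr rfl fun l hl ↦ if_pos hl,
      ← norm_vec_sq N (fun l ↦ fourierHat a b f l - c l), vec_sub] at h4
    set v := ‖vec N (fourierHat a b f) - vec N c‖
    have hv : 0 ≤ v := norm_nonneg _
    have hd0 := l2_nonneg a b d
    have h5 : l2 a b (fun x ↦ f x - trig a b N c x) ^ 2 ≤ (b - a) * v ^ 2 + r ^ 2 * M ^ 2 := by
      have h6 : l2 a b d ^ 2 ≤ M ^ 2 := by gcongr
      have h7 : r ^ 2 * l2 a b d ^ 2 ≤ r ^ 2 * M ^ 2 := by gcongr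
      have h8 := mul_le_mul_of_nonneg_left h4 hba.le
      have e1 : ∀ y, (b - a) * ((b - a)⁻¹ * y) = y := fun y ↦ by field_simp
      rw [e1, mul_add, mul_left_comm (r ^ 2), e1] at h8
      linarith
    refine le_of_sq_le_sq (h5.trans ?_) (by positivity)
    have hs := Real.sq_sqrt hba.le
    have : 0 ≤ r * M * (√(b - a) * v) := by positivity
    nlinarith
  · rw [fourierHat_sub (hfL.intervalIntegrable_volΩ hab.le)
      ((memLp_trig N c).intervalIntegrable_volΩ hab.le), fourierHat_trig hab]
    split_ifs with hl
    · have : 0 ≤ r ^ 2 * ‖fourierHat a b d l‖ ^ 2 := by positivity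
      linarith
    · rw [sub_zero, zero_add, ← mul_pow, hd2, ← mul_assoc, hr, ← mul_pow]
      gcongr
      refine le_mul_of_one_le_left (norm_nonneg _) (one_le_pow₀ ?_)
      have h5 := le_abs_freq_of_notMem hab hN hN2 hl
      calc (1 : ℝ) = mesh a b N / Real.pi * (Real.pi / mesh a b N) := by field_simp
        _ ≤ _ := by gcongr

end PerBound

end GPE

/-! ### The discrete Fourier transform -/

namespace GPE

variable {a b : ℝ}

/-- The `N`-th roots of unity `e^{2 π i k / N}`. -/
noncomputable def rootOfUnity (N : ℕ) (k : ℤ) : ℂ :=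
  Complex.exp (2 * Real.pi * Complex.I * k / N)

lemma rootOfUnity_add (N : ℕ) (k l : ℤ) :
    rootOfUnity N (k + l) = rootOfUnity N k * rootOfUnity N l := by
  rw [rootOfUnity, rootOfUnity, rootOfUnity, ← Complex.exp_add]; congr 1; push_cast; ring

lemma conj_rootOfUnity (N : ℕ) (k : ℤ) :
    starRingEnd ℂ (rootOfUnity N k) = rootOfUnity N (-k) := by
  rw [rootOfUnity, rootOfUnity, ← Complex.exp_conj]; congr 1
  simp only [map_div₀, map_mul, map_natCast, map_intCast, Complex.conj_I, Complex.conj_ofReal,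
    map_ofNat]
  push_cast
  ring

lemma mode_node (hab : a < b) {N : ℕ} (l : ℤ) (j : ℕ) :
    mode a b l (node a b N j) = rootOfUnity N (l * j) := by
  have hba : ((b : ℂ) - a) ≠ 0 := by
    have : b - a ≠ 0 := by linarith
    exact_mod_cast this
  rw [mode, rootOfUnity, freq, node, mesh]
  congr 1
  push_cast
  rw [add_sub_cancel_left]
  field_simp

lemma node_mem_Icc (hab : a < b) {N : ℕ} (hN : 0 < N) (j : Fin (N + 1)) :
    node a b N j ∈ Icc a b := by
  have hh := mesh_pos hab hN
  have h1 : (N : ℝ) * mesh a b N = b - a := by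
    have : (N : ℝ) ≠ 0 := by exact_mod_cast hN.ne'
    rw [mesh]; field_simp
  have h2 : ((j : ℕ) : ℝ) ≤ N := by exact_mod_cast Nat.lt_succ_iff.1 j.2
  have h3 : ((j : ℕ) : ℝ) * mesh a b N ≤ N * mesh a b N := by gcongr
  have h4 : 0 ≤ ((j : ℕ) : ℝ) * mesh a b N := by positivity
  exact ⟨by rw [node]; linarith, by rw [node]; linarith⟩

lemma sum_rootOfUnity {N : ℕ} {d : ℤ} (hd : |d| < N) :
    ∑ j ∈ Finset.range N, rootOfUnity N (d * j) = if d = 0 then (N : ℂ) else 0 := by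
  split_ifs with h
  · simp [h, rootOfUnity]
  · have hN : (N : ℂ) ≠ 0 := by
      rintro h0
      have : N = 0 := by exact_mod_cast h0
      subst this
      exact absurd hd (by simp)
    have h1 : ∀ j : ℕ, rootOfUnity N (d * j) = rootOfUnity N d ^ j := by
      intro j
      rw [rootOfUnity, rootOfUnity, ← Complex.exp_nat_mul]; congr 1; push_cast; ring
    have h2 : rootOfUnity N d ^ N = 1 := by
      rw [rootOfUnity, ← Complex.exp_nat_mul, Complex.exp_eq_one_iff]
      exact ⟨d, by field_simp⟩
    have h3 : rootOfUnity N d ≠ 1 := by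
      rw [rootOfUnity, Ne, Complex.exp_eq_one_iff]
      rintro ⟨n, hn⟩
      have h4 : (d : ℂ) = n * N := by
        have := Complex.two_pi_I_ne_zero
        field_simp at hn
        linear_combination hn
      have h5 : d = n * N := by exact_mod_cast h4
      rw [h5, abs_mul] at hd
      have hn0 : n ≠ 0 := by rintro rfl; simp at h5; exact h h5
      have := Int.one_le_abs hn0
      simp at hd
      nlinarith
    simp only [h1]
    rw [geom_sum_eq h3, h2, sub_self, zero_div]

lemma sum_freqs_rootOfUnity {N : ℕ} (hN2 : Even N) {d : ℤ} (hd : |d| < N) :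
    ∑ l ∈ freqs N, rootOfUnity N (l * d) = if d = 0 then (N : ℂ) else 0 := by
  obtain ⟨K, rfl⟩ := hN2
  have h1 : ∑ l ∈ freqs (K + K), rootOfUnity (K + K) (l * d) =
      ∑ j ∈ Finset.range (K + K), rootOfUnity (K + K) (-K * d) * rootOfUnity (K + K) (d * j) := by
    refine Finset.sum_bij' (fun l _ ↦ (l + K).toNat) (fun j _ ↦ (j : ℤ) - K) ?_ ?_ ?_ ?_ ?_
    · intro l hl
      simp only [freqs, Finset.mem_Ico, Finset.mem_range] at hl ⊢
      omega
    · intro j hj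
      simp only [freqs, Finset.mem_Ico, Finset.mem_range] at hj ⊢
      omega
    · intro l hl
      simp only [freqs, Finset.mem_Ico] at hl
      omega
    · intro j hj
      simp
    · intro l hl
      have : (((l + K).toNat : ℕ) : ℤ) = l + K := by
        simp only [freqs, Finset.mem_Ico] at hl
        omega
      rw [this, ← rootOfUnity_add]
      congr 1
      ring
  rw [h1, ← Finset.mul_sum, sum_rootOfUnity hd]
  split_ifs with h
  · simp [h, rootOfUnity]
  · simp

lemma discreteHat_eq (hab : a < b) {N : ℕ} (v : Fin (N + 1) → ℂ) (l : ℤ) :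
    discreteHat a b N v l =
      (N : ℂ)⁻¹ * ∑ j : Fin N, v j.castSucc * rootOfUnity N (-(l * j)) := by
  rw [discreteHat, one_div]
  congr 1
  refine Finset.sum_congr rfl fun j _ ↦ ?_
  rw [← mode_neg, mode_node hab, neg_mul]

lemma discreteHat_add {N : ℕ} (v w : Fin (N + 1) → ℂ) (l : ℤ) :
    discreteHat a b N (fun j ↦ v j + w j) l = discreteHat a b N v l + discreteHat a b N w l := by
  simp only [discreteHat, add_mul, Finset.sum_add_distrib, mul_add]

lemma discreteHat_sub {N : ℕ} (v w : Fin (N + 1) → ℂ) (l : ℤ) :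
    discreteHat a b N (fun j ↦ v j - w j) l = discreteHat a b N v l - discreteHat a b N w l := by
  simp only [discreteHat, sub_mul, Finset.sum_sub_distrib, mul_sub]

lemma discreteHat_const_mul {N : ℕ} (r : ℂ) (v : Fin (N + 1) → ℂ) (l : ℤ) :
    discreteHat a b N (fun j ↦ r * v j) l = r * discreteHat a b N v l := by
  simp only [discreteHat, mul_assoc, ← Finset.mul_sum]
  ring

/-- The trigonometric interpolant takes the given values at the nodes. -/
lemma interp_node (hab : a < b) {N : ℕ} (hN : 0 < N) (hN2 : Even N) (v : Fin (N + 1) → ℂ)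
    (j : Fin N) : interp a b N v (node a b N j) = v j.castSucc := by
  have hN0 : (N : ℂ) ≠ 0 := by exact_mod_cast hN.ne'
  have h1 : ∀ l ∈ freqs N, discreteHat a b N v l * mode a b l (node a b N j) =
      ∑ i : Fin N, (N : ℂ)⁻¹ * v i.castSucc * rootOfUnity N (l * ((j : ℤ) - i)) := by
    intro l _
    rw [discreteHat_eq hab, mode_node hab, mul_assoc, Finset.sum_mul, Finset.mul_sum]
    refine Finset.sum_congr rfl fun i _ ↦ ?_
    rw [mul_assoc, mul_assoc, ← rootOfUnity_add]
    congr 3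
    ring
  rw [interp, Finset.sum_congr rfl h1, Finset.sum_comm]
  have h2 : ∀ i : Fin N, ∑ l ∈ freqs N,
      (N : ℂ)⁻¹ * v i.castSucc * rootOfUnity N (l * ((j : ℤ) - i)) =
      if i = j then v i.castSucc else 0 := by
    intro i
    rw [← Finset.mul_sum, sum_freqs_rootOfUnity hN2 (by rw [abs_lt]; omega)]
    have : ((j : ℤ) - i = 0) ↔ i = j := by rw [Fin.ext_iff]; omega
    simp only [this]
    split_ifs
    · field_simp
    · simp
  simp [h2]

/-- Parseval's identity for the discrete Fourier transform. -/
lemma norm_vec_discreteHat_sq (hab : a < b) {N : ℕ} (hN : 0 < N) (hN2 : Even N)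
    (v : Fin (N + 1) → ℂ) :
    (N : ℝ) * ‖vec N (discreteHat a b N v)‖ ^ 2 = ∑ j : Fin N, ‖v j.castSucc‖ ^ 2 := by
  have hN0 : (N : ℂ) ≠ 0 := by exact_mod_cast hN.ne'
  rw [← Complex.ofReal_inj, norm_vec_sq]
  push_cast
  simp only [← Complex.mul_conj']
  have h1 : ∀ j : Fin N, v j.castSucc * starRingEnd ℂ (v j.castSucc) =
      ∑ l ∈ freqs N, starRingEnd ℂ (discreteHat a b N v l) *
        (v j.castSucc * rootOfUnity N (-(l * j))) := by
    intro j
    nth_rw 2 [← interp_node hab hN hN2 v j]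
    rw [interp, map_sum, Finset.mul_sum]
    refine Finset.sum_congr rfl fun l _ ↦ ?_
    rw [map_mul, mode_node hab, conj_rootOfUnity]
    ring
  rw [Finset.sum_congr rfl fun j _ ↦ h1 j, Finset.sum_comm, Finset.mul_sum]
  refine Finset.sum_congr rfl fun l _ ↦ ?_
  rw [← Finset.mul_sum]
  nth_rw 1 [discreteHat_eq hab]
  field_simp

/-- The discrete Fourier transform recovers the coefficients of a trigonometric polynomial. -/
lemma discreteHat_trig (hab : a < b) {N : ℕ} (hN : 0 < N) (c : ℤ → ℂ) {l : ℤ}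
    (hl : l ∈ freqs N) :
    discreteHat a b N (fun j ↦ trig a b N c (node a b N j)) l = c l := by
  have hN0 : (N : ℂ) ≠ 0 := by exact_mod_cast hN.ne'
  rw [discreteHat_eq hab]
  have h1 : ∀ j : Fin N, trig a b N c (node a b N (j.castSucc : Fin (N + 1))) *
      rootOfUnity N (-(l * j)) = ∑ k ∈ freqs N, c k * rootOfUnity N ((k - l) * (j : ℕ)) := by
    intro j
    rw [trig, Finset.sum_mul]
    refine Finset.sum_congr rfl fun k _ ↦ ?_
    rw [mode_node hab, mul_assoc, ← rootOfUnity_add]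
    congr 2
    simp
    ring
  rw [Finset.sum_congr rfl fun j _ ↦ h1 j, Finset.sum_comm]
  have h2 : ∀ k ∈ freqs N, ∑ j : Fin N, c k * rootOfUnity N ((k - l) * (j : ℕ)) =
      if k = l then N * c k else 0 := by
    intro k hk
    rw [← Finset.mul_sum, Fin.sum_univ_eq_sum_range (fun j ↦ rootOfUnity N ((k - l) * (j : ℕ))),
      sum_rootOfUnity]
    · simp only [sub_eq_zero]
      split_ifs
      · ring
      · simp
    · simp only [freqs, Finset.mem_Ico] at hk hl
      rw [abs_lt]
      omega
  rw [Finset.sum_congr rfl h2, Finset.sum_ite_eq', if_pos hl]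
  field_simp

/-- If `|v_j| ≤ r |w_j|` at the nodes, the same holds for the `ℓ²` norms of the discrete Fourier
coefficients. -/
lemma norm_vec_discreteHat_le_of_le (hab : a < b) {N : ℕ} (hN : 0 < N) (hN2 : Even N)
    {v w : Fin (N + 1) → ℂ} {r : ℝ} (hr : 0 ≤ r)
    (h : ∀ j : Fin N, ‖v j.castSucc‖ ≤ r * ‖w j.castSucc‖) :
    ‖vec N (discreteHat a b N v)‖ ≤ r * ‖vec N (discreteHat a b N w)‖ := by
  have hN0 : (0 : ℝ) < N := by exact_mod_cast hN
  refine le_of_sq_le_sq ?_ (by positivity)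
  refine le_of_mul_le_mul_left ?_ hN0
  rw [mul_pow, mul_left_comm, norm_vec_discreteHat_sq hab hN hN2,
    norm_vec_discreteHat_sq hab hN hN2, Finset.mul_sum]
  refine Finset.sum_le_sum fun j _ ↦ ?_
  rw [← mul_pow]
  gcongr
  exact h j

lemma norm_vec_discreteHat_le_of_bound (hab : a < b) {N : ℕ} (hN : 0 < N) (hN2 : Even N)
    {v : Fin (N + 1) → ℂ} {r : ℝ} (hr : 0 ≤ r) (h : ∀ j : Fin N, ‖v j.castSucc‖ ≤ r) :
    ‖vec N (discreteHat a b N v)‖ ≤ r := by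
  have hN0 : (0 : ℝ) < N := by exact_mod_cast hN
  refine le_of_sq_le_sq ?_ (by positivity)
  refine le_of_mul_le_mul_left ?_ hN0
  rw [norm_vec_discreteHat_sq hab hN hN2]
  calc _ ≤ ∑ j : Fin N, r ^ 2 := by gcongr with j; exact h j
    _ = _ := by simp

/-- The inverse inequality between the maximum over the nodes and the `L²` norm. -/
lemma norm_le_sqrt_mul_norm_vec (hab : a < b) {N : ℕ} (hN : 0 < N) (hN2 : Even N)
    (v : Fin (N + 1) → ℂ) (j : Fin N) :
    ‖v j.castSucc‖ ≤ √N * ‖vec N (discreteHat a b N v)‖ := by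
  refine le_of_sq_le_sq ?_ (by positivity)
  rw [mul_pow, Real.sq_sqrt (by positivity), norm_vec_discreteHat_sq hab hN hN2]
  exact Finset.single_le_sum (f := fun j : Fin N ↦ ‖v j.castSucc‖ ^ 2)
    (fun _ _ ↦ by positivity) (Finset.mem_univ j)

end GPE

/-! ### The interpolation error -/

namespace GPE

variable {a b : ℝ}

/-- The Cauchy–Schwarz inequality against the constant function `1`. -/
lemma sq_integral_norm_le {c d : ℝ} (hcd : c < d) {f : ℝ → ℂ}
    (h1 : IntervalIntegrable f volume c d)
    (h2 : IntervalIntegrable (fun x ↦ ‖f x‖ ^ 2) volume c d) :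
    (∫ x in c..d, ‖f x‖) ^ 2 ≤ (d - c) * ∫ x in c..d, ‖f x‖ ^ 2 := by
  have hdc : 0 < d - c := by linarith
  set A := ∫ x in c..d, ‖f x‖ with hA
  have h3 : 0 ≤ ∫ x in c..d, (‖f x‖ - A / (d - c)) ^ 2 :=
    intervalIntegral.integral_nonneg hcd.le fun x _ ↦ by positivity
  have h4 : ∀ x, (‖f x‖ - A / (d - c)) ^ 2 =
      ‖f x‖ ^ 2 - 2 * (A / (d - c)) * ‖f x‖ + (A / (d - c)) ^ 2 := fun x ↦ by ring
  simp only [h4] at h3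
  rw [intervalIntegral.integral_add (h2.sub (h1.norm.const_mul _)) (by simp),
    intervalIntegral.integral_sub h2 (h1.norm.const_mul _), intervalIntegral.integral_const_mul,
    ← hA, intervalIntegral.integral_const, smul_eq_mul] at h3
  have h5 : (d - c) * (∫ x in c..d, ‖f x‖ ^ 2) - A ^ 2 =
      (d - c) * ((∫ x in c..d, ‖f x‖ ^ 2) - 2 * (A / (d - c)) * A +
        (d - c) * (A / (d - c)) ^ 2) := by field_simp; ring
  have h6 := mul_nonneg hdc.le h3
  linarith

lemma IsPrimitive.mono {c d : ℝ} {f f' : ℝ → ℂ} (hac : a ≤ c) (hcd : c ≤ d) (hdb : d ≤ b)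
    (hf : IsPrimitive a b f f') : IsPrimitive c d f f' := by
  have hs : ∀ {x y : ℝ}, a ≤ x → x ≤ y → y ≤ b → IntervalIntegrable f' volume x y := by
    intro x y h1 h2 h3
    refine hf.integrable.mono_set ?_
    rw [uIcc_of_le h2, uIcc_of_le (h1.trans (h2.trans h3))]
    exact Icc_subset_Icc h1 h3
  refine ⟨hs hac hcd hdb, fun x hx ↦ ?_⟩
  rw [hf.eq_add_integral x ⟨hac.trans hx.1, hx.2.trans hdb⟩,
    hf.eq_add_integral c ⟨hac, hcd.trans hdb⟩, add_assoc,
    intervalIntegral.integral_add_adjacent_intervals (hs le_rfl hac (hcd.trans hdb))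
      (hs hac hx.1 (hx.2.trans hdb))]

/-- The value of an absolutely continuous function at the left end point of an interval is
controlled by its `H¹` norm on the interval. -/
lemma IsPrimitive.norm_sq_left_le {c d : ℝ} (hcd : c < d) {f f' : ℝ → ℂ}
    (hf : IsPrimitive c d f f') (h2 : IntervalIntegrable (fun x ↦ ‖f' x‖ ^ 2) volume c d) :
    (d - c) * ‖f c‖ ^ 2 ≤ 2 * (∫ x in c..d, ‖f x‖ ^ 2) +
      2 * (d - c) ^ 2 * ∫ x in c..d, ‖f' x‖ ^ 2 := by
  have hdc : 0 < d - c := by linarith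
  set A := ∫ x in c..d, ‖f' x‖ with hA
  have hfc : ContinuousOn f (uIcc c d) := by
    rw [uIcc_of_le hcd.le]; exact hf.continuousOn hcd.le
  have hint : IntervalIntegrable (fun x ↦ ‖f x‖ ^ 2) volume c d :=
    (hfc.norm.pow 2).intervalIntegrable
  have h3 : ∀ y ∈ Icc c d, ‖f c‖ ^ 2 ≤ 2 * ‖f y‖ ^ 2 + 2 * A ^ 2 := by
    intro y hy
    have h4 := hf.eq_add_integral y hy
    have h5 : ‖∫ t in c..y, f' t‖ ≤ A :=
      (intervalIntegral.norm_integral_le_integral_norm hy.1).trans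
        (intervalIntegral.integral_mono_interval le_rfl hy.1 hy.2
          (ae_of_all _ fun _ ↦ norm_nonneg _) hf.integrable.norm)
    have h6 : ‖f c‖ ≤ ‖f y‖ + A := by
      have : f c = f y - ∫ t in c..y, f' t := by rw [h4]; ring
      rw [this]
      exact (norm_sub_le _ _).trans (by linarith)
    have h7 : ‖f c‖ ^ 2 ≤ (‖f y‖ + A) ^ 2 := by gcongr
    nlinarith [sq_nonneg (‖f y‖ - A)]
  have h8 := intervalIntegral.integral_mono_on hcd.le (by simp)
    ((hint.const_mul 2).add (by simp)) h3
  rw [intervalIntegral.integral_const, intervalIntegral.integral_add (hint.const_mul 2) (by simp),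
    intervalIntegral.integral_const_mul, intervalIntegral.integral_const, smul_eq_mul,
    smul_eq_mul] at h8
  have h9 := sq_integral_norm_le hcd hf.integrable h2
  rw [← hA] at h9
  have h10 := mul_le_mul_of_nonneg_left h9 hdc.le
  nlinarith

/-- A mesh version of the Sobolev inequality. -/
lemma IsPrimitive.sum_norm_sq_node_le (hab : a < b) {N : ℕ} (hN : 0 < N) {f f' : ℝ → ℂ}
    (hf : IsPrimitive a b f f') (h2 : MemLp f' 2 (volΩ a b)) :
    mesh a b N * ∑ j : Fin N, ‖f (node a b N j)‖ ^ 2 ≤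
      2 * l2 a b f ^ 2 + 2 * mesh a b N ^ 2 * l2 a b f' ^ 2 := by
  have hh := mesh_pos hab hN
  have hfc := hf.continuousOn hab.le
  have hN0 : (0 : ℝ) < N := by exact_mod_cast hN
  have hNh : (N : ℝ) * mesh a b N = b - a := by rw [mesh]; field_simp
  have hn0 : node a b N 0 = a := by simp [node]
  have hnN : node a b N N = b := by rw [node, hNh]; ring
  have hstep : ∀ j, node a b N (j + 1) - node a b N j = mesh a b N := by
    intro j; simp only [node]; push_cast; ring
  have hmono : ∀ j, node a b N j < node a b N (j + 1) := fun j ↦ by linarith [hstep j]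
  have ha : ∀ j, a ≤ node a b N j := fun j ↦ by
    rw [node]; have : 0 ≤ j * mesh a b N := by positivity
    linarith
  have hb : ∀ j, j ≤ N → node a b N j ≤ b := fun j hj ↦ by
    have : node a b N j ≤ node a b N N := by
      rw [node, node]
      gcongr
    linarith
  have i1 : IntervalIntegrable (fun x ↦ ‖f x‖ ^ 2) volume a b := by
    rw [← uIcc_of_le hab.le] at hfc
    exact (hfc.norm.pow 2).intervalIntegrable
  have i2 : IntervalIntegrable (fun x ↦ ‖f' x‖ ^ 2) volume a b := by
    rw [intervalIntegrable_iff_integrableOn_Ioc_of_le hab.le, IntegrableOn, restrict_Ioc_eq_volΩ]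
    exact h2.integrable_norm_pow (by norm_num)
  have hsub : ∀ j < N, uIcc (node a b N j) (node a b N (j + 1)) ⊆ uIcc a b := fun j hj ↦ by
    rw [uIcc_of_le (hmono j).le, uIcc_of_le hab.le]
    exact Icc_subset_Icc (ha j) (hb _ hj)
  rw [l2_sq hab.le (memLp_of_continuousOn hfc), l2_sq hab.le h2,
    Fin.sum_univ_eq_sum_range (fun j ↦ ‖f (node a b N j)‖ ^ 2), Finset.mul_sum]
  have s1 := intervalIntegral.sum_integral_adjacent_intervals (a := node a b N) (n := N)
    fun j hj ↦ i1.mono_set (hsub j hj)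
  have s2 := intervalIntegral.sum_integral_adjacent_intervals (a := node a b N) (n := N)
    fun j hj ↦ i2.mono_set (hsub j hj)
  rw [hn0, hnN] at s1 s2
  rw [← s1, ← s2, Finset.mul_sum, Finset.mul_sum, ← Finset.sum_add_distrib]
  refine Finset.sum_le_sum fun j hj ↦ ?_
  have hj' := Finset.mem_range.1 hj
  have := (hf.mono (ha j) (hmono j).le (hb _ hj')).norm_sq_left_le (hmono j)
    (i2.mono_set (hsub j hj'))
  rwa [hstep] at this

lemma isPrimitive_trig (N : ℕ) (c : ℤ → ℂ) :
    IsPrimitive a b (trig a b N c) (trig a b N fun l ↦ Complex.I * freq a b l * c l) := by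
  refine isPrimitive_of_hasDerivAt (fun x ↦ ?_) (continuous_trig N _)
  have := HasDerivAt.fun_sum (u := freqs N) fun l _ ↦
    (hasDerivAt_mode (a := a) (b := b) l x).const_mul (c l)
  refine this.congr_deriv ?_
  rw [trig]
  exact Finset.sum_congr rfl fun l _ ↦ by ring

/-- The discrete Fourier coefficients of a function in `H^{m+1}_per` are `O(h^{m+1})` close to the
Fourier coefficients. -/
lemma PerBound.norm_vec_fourierHat_sub_discreteHat_le (hab : a < b) {m : ℕ} {M : ℝ} {f : ℝ → ℂ}
    (hf : PerBound a b M (m + 1) f) {N : ℕ} (hN : 0 < N) (hN2 : Even N) :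
    ‖vec N (fourierHat a b f) - vec N (discreteHat a b N fun j ↦ f (node a b N j))‖ ≤
      2 * √(b - a)⁻¹ * M * mesh a b N ^ (m + 1) := by
  have hba : 0 < b - a := by linarith
  have hh := mesh_pos hab hN
  have hM := hf.nonneg
  have hN0 : (0 : ℝ) < N := by exact_mod_cast hN
  have hNh : (N : ℝ) * mesh a b N = b - a := by rw [mesh]; field_simp
  have e1 := hf.l2_sub_trig_le hab hN hN2 (fourierHat a b f)
  obtain ⟨f', h, h1, h2, -⟩ := hf
  have e2 := h.l2_sub_trig_le hab hN hN2 (fourierHat a b f')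
  rw [sub_self, norm_zero, mul_zero, add_zero] at e1 e2
  have h3 : (fourierHat a b f') = fun l ↦ Complex.I * freq a b l * fourierHat a b f l :=
    funext fun l ↦ fourierHat_deriv hab h1 h2 l
  -- `g` is the projection error; interpolation does not change trigonometric polynomials
  set g : ℝ → ℂ := fun x ↦ f x - trig a b N (fourierHat a b f) x with hg
  set g' : ℝ → ℂ := fun x ↦ f' x - trig a b N (fourierHat a b f') x with hg'
  have hprim : IsPrimitive a b g g' := by
    have := h1.add ((isPrimitive_trig N (fourierHat a b f)).const_mul (-1))
    rw [← h3] at this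
    simpa [← sub_eq_add_neg] using this
  have hg'L : MemLp g' 2 (volΩ a b) := (h.memLp hab.le).sub (memLp_trig N _)
  have h4 := hprim.sum_norm_sq_node_le hab hN hg'L
  have h5 : vec N (discreteHat a b N fun j ↦ g (node a b N j)) =
      vec N (discreteHat a b N fun j ↦ f (node a b N j)) - vec N (fourierHat a b f) := by
    rw [← vec_sub]
    refine vec_congr fun l hl ↦ ?_
    rw [hg, discreteHat_sub, discreteHat_trig hab hN _ hl]
  rw [← norm_neg, neg_sub, ← h5]
  refine le_of_sq_le_sq ?_ (by positivity)
  have h6 := norm_vec_discreteHat_sq hab hN hN2 fun j ↦ g (node a b N j)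
  simp only [Fin.val_castSucc] at h6
  rw [← h6, ← mul_assoc, mul_comm (mesh a b N), hNh] at h4
  have hle : mesh a b N / Real.pi ≤ mesh a b N := by
    rw [div_le_iff₀ Real.pi_pos]
    nlinarith [Real.pi_gt_three]
  have hpos : 0 ≤ mesh a b N / Real.pi := by positivity
  have e1' : l2 a b g ≤ mesh a b N ^ (m + 1) * M := e1.trans (by gcongr)
  have e2' : l2 a b g' ≤ mesh a b N ^ m * M := e2.trans (by gcongr)
  have e3 : l2 a b g ^ 2 ≤ (mesh a b N ^ (m + 1) * M) ^ 2 := by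
    have := l2_nonneg a b g
    gcongr
  have e4 : mesh a b N ^ 2 * l2 a b g' ^ 2 ≤ (mesh a b N ^ (m + 1) * M) ^ 2 := by
    have := l2_nonneg a b g'
    calc _ ≤ mesh a b N ^ 2 * (mesh a b N ^ m * M) ^ 2 := by gcongr
      _ = _ := by ring
  refine le_of_mul_le_mul_left (a := b - a) ?_ hba
  calc _ ≤ 4 * (mesh a b N ^ (m + 1) * M) ^ 2 := by linarith
    _ = 4 * ((b - a) * √(b - a)⁻¹ ^ 2) * (mesh a b N ^ (m + 1) * M) ^ 2 := by
      rw [Real.sq_sqrt (by positivity), mul_inv_cancel₀ hba.ne', mul_one]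
    _ = _ := by ring

end GPE

/-! ### Weak derivatives -/

namespace GPE

variable {a b : ℝ}

/-- Smooth test functions with compact support in `(a, b)`. -/
structure IsTest (a b : ℝ) (η : ℝ → ℂ) : Prop where
  contDiff : ContDiff ℝ ∞ η
  hasCompactSupport : HasCompactSupport η
  tsupport_subset : tsupport η ⊆ Ioo a b

namespace IsTest

variable {η : ℝ → ℂ}

lemma deriv (h : IsTest a b η) : IsTest a b (deriv η) :=
  ⟨(contDiff_infty_iff_deriv.1 h.contDiff).2, h.hasCompactSupport.deriv,
    tsupport_deriv_subset.trans h.tsupport_subset⟩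

lemma iteratedDeriv (h : IsTest a b η) (k : ℕ) : IsTest a b (iteratedDeriv k η) := by
  induction k with
  | zero => simpa using h
  | succ k ih => rw [iteratedDeriv_succ]; exact ih.deriv

lemma integrable_mul (h : IsTest a b η) {u : ℝ → ℂ} (hu : LocallyIntegrableOn u (Ioo a b)) :
    Integrable (fun x ↦ u x * η x) := by
  have h1 : IntegrableOn u (tsupport η) :=
    hu.integrableOn_compact_subset h.tsupport_subset h.hasCompactSupport
  have h2 : IntegrableOn (fun x ↦ u x * η x) (tsupport η) :=
    h1.mul_continuousOn h.contDiff.continuous.continuousOn h.hasCompactSupport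
  refine (integrableOn_iff_integrable_of_support_subset ?_).1 h2
  exact fun x hx ↦ subset_tsupport _ fun h0 ↦ hx (by simp [h0])

lemma integrableOn_mul (h : IsTest a b η) {u : ℝ → ℂ} (hu : LocallyIntegrableOn u (Ioo a b)) :
    Integrable (fun x ↦ u x * η x) (volΩ a b) := (h.integrable_mul hu).restrict

lemma eq_zero_of_notMem (h : IsTest a b η) {x : ℝ} (hx : x ∉ Ioo a b) : η x = 0 :=
  image_eq_zero_of_notMem_tsupport fun h' ↦ hx (h.tsupport_subset h')

lemma isPrimitive (h : IsTest a b η) : IsPrimitive a b η (_root_.deriv η) :=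
  isPrimitive_of_hasDerivAt
    (fun x ↦ (h.contDiff.differentiable (by simp) x).hasDerivAt) h.deriv.contDiff.continuous

lemma exists_integral_eq_one (hab : a < b) : ∃ θ : ℝ → ℂ, IsTest a b θ ∧ ∫ x, θ x = 1 := by
  let f : ContDiffBump ((a + b) / 2) := ⟨(b - a) / 8, (b - a) / 4, by linarith, by linarith⟩
  have hsub : tsupport (fun x ↦ ((f.normed volume x : ℝ) : ℂ)) ⊆ tsupport (f.normed volume) :=
    closure_mono fun x hx h0 ↦ hx (by simp [h0])
  refine ⟨fun x ↦ (f.normed volume x : ℝ), ⟨?_, ?_, ?_⟩, ?_⟩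
  · exact Complex.ofRealCLM.contDiff.comp f.contDiff_normed
  · exact f.hasCompactSupport_normed.of_isClosed_subset (isClosed_tsupport _) hsub
  · refine hsub.trans ?_
    rw [f.tsupport_normed_eq, Real.closedBall_eq_Icc]
    exact Icc_subset_Ioo (by simp only [f]; linarith) (by simp only [f]; linarith)
  · beta_reduce
    rw [integral_complex_ofReal, f.integral_normed, Complex.ofReal_one]

/-- A test function with integral zero is the derivative of a test function. -/
lemma exists_deriv_eq (h : IsTest a b η) (h0 : ∫ x, η x = 0) :
    ∃ ζ, IsTest a b ζ ∧ _root_.deriv ζ = η := by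
  rcases (tsupport η).eq_empty_or_nonempty with he | hne
  · refine ⟨η, h, ?_⟩
    rw [tsupport_eq_empty_iff.1 he]
    ext; simp
  have hK : IsCompact (tsupport η) := h.hasCompactSupport
  obtain ⟨c, hc, hc'⟩ := hK.exists_isLeast hne
  obtain ⟨d, hd, hd'⟩ := hK.exists_isGreatest hne
  have hac := (h.tsupport_subset hc).1
  have hdb := (h.tsupport_subset hd).2
  have hcont := h.contDiff.continuous
  have hz : ∀ x, x < c ∨ d < x → η x = 0 := fun x hx ↦
    image_eq_zero_of_notMem_tsupport fun h' ↦ by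
      rcases hx with hx | hx
      · exact absurd (hc' h') (not_le.2 hx)
      · exact absurd (hd' h') (not_le.2 hx)
  have hder : ∀ x, HasDerivAt (fun x ↦ ∫ t in a..x, η t) (η x) x := fun x ↦
    hcont.integral_hasStrictDerivAt a x |>.hasDerivAt
  have hderiv : _root_.deriv (fun x ↦ ∫ t in a..x, η t) = η := funext fun x ↦ (hder x).deriv
  have hsub : tsupport (fun x ↦ ∫ t in a..x, η t) ⊆ Icc c d := by
    refine closure_minimal (fun x hx ↦ ?_) isClosed_Icc
    by_contra hx'
    refine hx ?_
    rw [mem_Icc, not_and_or, not_le, not_le] at hx'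
    rcases hx' with hx' | hx'
    · have : ∫ t in a..x, η t = ∫ t in a..x, (0 : ℂ) :=
        intervalIntegral.integral_congr fun t ht ↦ hz t (Or.inl (by
          rcases ht with ⟨-, ht⟩
          exact ht.trans_lt (max_lt hac hx')))
      simpa using this
    · have hcd : c ≤ d := hc' hd
      rw [← h0]
      refine intervalIntegral.integral_eq_integral_of_support_subset fun t ht ↦ ?_
      have h1 := subset_tsupport _ ht
      exact ⟨hac.trans_le (hc' h1), (hd' h1).trans hx'.le⟩
  refine ⟨_, ⟨?_, isCompact_Icc.of_isClosed_subset (isClosed_tsupport _) hsub,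
    hsub.trans (Icc_subset_Ioo hac hdb)⟩, hderiv⟩
  rw [contDiff_infty_iff_deriv, hderiv]
  exact ⟨fun x ↦ (hder x).differentiableAt, h.contDiff⟩

end IsTest

/-- The fundamental lemma of the calculus of variations. -/
lemma ae_eq_zero_of_forall_isTest {u : ℝ → ℂ} (hu : LocallyIntegrableOn u (Ioo a b))
    (h : ∀ η, IsTest a b η → ∫ x in Ioo a b, u x * η x = 0) : u =ᵐ[volΩ a b] 0 := by
  refine (ae_restrict_iff' measurableSet_Ioo).2 ?_
  refine isOpen_Ioo.ae_eq_zero_of_integral_contDiff_smul_eq_zero hu fun g hg hgc hgs ↦ ?_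
  have hsub : tsupport (fun x ↦ ((g x : ℝ) : ℂ)) ⊆ tsupport g :=
    closure_mono fun x hx h0 ↦ hx (by simp [h0])
  have ht : IsTest a b (fun x ↦ ((g x : ℝ) : ℂ)) :=
    ⟨Complex.ofRealCLM.contDiff.comp hg, hgc.of_isClosed_subset (isClosed_tsupport _) hsub,
      hsub.trans hgs⟩
  rw [← h _ ht, ← setIntegral_eq_integral_of_forall_compl_eq_zero (s := Ioo a b)]
  · exact integral_congr_ae (ae_of_all _ fun x ↦ by simp [mul_comm])
  · intro x hx
    have := ht.eq_zero_of_notMem hx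
    simp only [Complex.ofReal_eq_zero] at this
    simp [this]

/-- The lemma of du Bois-Reymond. -/
lemma exists_ae_eq_const_of_forall_isTest (hab : a < b) {u : ℝ → ℂ}
    (hu : LocallyIntegrableOn u (Ioo a b))
    (h : ∀ η, IsTest a b η → ∫ x in Ioo a b, u x * deriv η x = 0) :
    ∃ c, u =ᵐ[volΩ a b] fun _ ↦ c := by
  obtain ⟨θ, hθ, hθ1⟩ := IsTest.exists_integral_eq_one hab
  set c := ∫ x in Ioo a b, u x * θ x with hc
  have hcl : LocallyIntegrableOn (fun _ : ℝ ↦ c) (Ioo a b) :=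
    (locallyIntegrable_const c).locallyIntegrableOn _
  refine ⟨c, ?_⟩
  suffices (fun x ↦ u x - c) =ᵐ[volΩ a b] 0 by
    filter_upwards [this] with x hx
    exact sub_eq_zero.1 hx
  refine ae_eq_zero_of_forall_isTest (hu.sub hcl) fun φ hφ ↦ ?_
  have hint : ∀ {η : ℝ → ℂ}, IsTest a b η → Integrable η := fun hη ↦
    hη.contDiff.continuous.integrable_of_hasCompactSupport hη.hasCompactSupport
  set s := ∫ x, φ x with hs
  have hset : ∫ x in Ioo a b, φ x = s := setIntegral_eq_integral_of_forall_compl_eq_zero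
    fun x hx ↦ hφ.eq_zero_of_notMem hx
  have ht : IsTest a b (fun x ↦ φ x - s * θ x) := by
    have hsub : tsupport (fun x ↦ φ x - s * θ x) ⊆ tsupport φ ∪ tsupport θ := by
      refine closure_minimal (fun x hx ↦ ?_)
        ((isClosed_tsupport φ).union (isClosed_tsupport θ))
      by_contra hx'
      rw [mem_union, not_or] at hx'
      refine hx ?_
      simp [image_eq_zero_of_notMem_tsupport hx'.1, image_eq_zero_of_notMem_tsupport hx'.2]
    refine ⟨hφ.contDiff.sub (contDiff_const.mul hθ.contDiff),
      (hφ.hasCompactSupport.union hθ.hasCompactSupport).of_isClosed_subset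
        (isClosed_tsupport _) hsub, hsub.trans (union_subset hφ.tsupport_subset hθ.tsupport_subset)⟩
  obtain ⟨ζ, hζ, hζ'⟩ := ht.exists_deriv_eq (by
    rw [integral_sub (hint hφ) ((hint hθ).const_mul s), integral_const_mul, hθ1, ← hs]; ring)
  have h1 := h ζ hζ
  rw [hζ'] at h1
  have e1 : ∀ x, u x * (φ x - s * θ x) = u x * φ x - s * (u x * θ x) := fun x ↦ by ring
  have e2 : ∀ x, (u x - c) * φ x = u x * φ x - c * φ x := fun x ↦ by ring
  simp only [e1] at h1
  simp only [e2]
  rw [integral_sub (hφ.integrableOn_mul hu) ((hθ.integrableOn_mul hu).const_mul s),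
    integral_const_mul, ← hc] at h1
  rw [integral_sub (hφ.integrableOn_mul hu) ((hint hφ).restrict.const_mul c),
    integral_const_mul, hset]
  linear_combination h1

namespace IsWeakDeriv

variable {k : ℕ} {u u' v v' : ℝ → ℂ}

lemma ae_eq (h : IsWeakDeriv a b k u v) (h' : IsWeakDeriv a b k u v') : v =ᵐ[volΩ a b] v' := by
  suffices (fun x ↦ v x - v' x) =ᵐ[volΩ a b] 0 by
    filter_upwards [this] with x hx
    exact sub_eq_zero.1 hx
  refine ae_eq_zero_of_forall_isTest (h.2.1.sub h'.2.1) fun η hη ↦ ?_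
  have h1 := h.2.2 η hη.1 hη.2 hη.3
  rw [h'.2.2 η hη.1 hη.2 hη.3] at h1
  have h2 := mul_left_cancel₀ (pow_ne_zero k (by norm_num : (-1 : ℂ) ≠ 0)) h1
  simp only [sub_mul]
  rw [integral_sub (hη.integrableOn_mul h.2.1) (hη.integrableOn_mul h'.2.1), h2, sub_self]

lemma add (h : IsWeakDeriv a b k u v) (h' : IsWeakDeriv a b k u' v') :
    IsWeakDeriv a b k (fun x ↦ u x + u' x) (fun x ↦ v x + v' x) := by
  refine ⟨h.1.add h'.1, h.2.1.add h'.2.1, fun η h1 h2 h3 ↦ ?_⟩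
  have hη : IsTest a b η := ⟨h1, h2, h3⟩
  simp only [add_mul]
  rw [integral_add ((hη.iteratedDeriv k).integrableOn_mul h.1)
    ((hη.iteratedDeriv k).integrableOn_mul h'.1), integral_add (hη.integrableOn_mul h.2.1)
    (hη.integrableOn_mul h'.2.1), h.2.2 η h1 h2 h3, h'.2.2 η h1 h2 h3]
  ring

end IsWeakDeriv

lemma locallyIntegrableOn_of_integrable {u : ℝ → ℂ} (hu : Integrable u (volΩ a b)) :
    LocallyIntegrableOn u (Ioo a b) := IntegrableOn.locallyIntegrableOn hu

/-- Integration by parts against a test function. -/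
lemma IsPrimitive.integral_mul_deriv (hab : a < b) {u v η : ℝ → ℂ} (h : IsPrimitive a b u v)
    (hη : IsTest a b η) :
    ∫ x in Ioo a b, u x * deriv η x = -∫ x in Ioo a b, v x * η x := by
  have hm := h.mul hab.le hη.isPrimitive
  have h1 := hm.eq_add_integral b (right_mem_Icc.2 hab.le)
  have huc : ContinuousOn u (uIcc a b) := by
    rw [uIcc_of_le hab.le]; exact h.continuousOn hab.le
  rw [hη.eq_zero_of_notMem (by simp), hη.eq_zero_of_notMem (by simp),
    intervalIntegral.integral_add (h.integrable.mul_continuousOn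
      hη.contDiff.continuous.continuousOn) (hη.isPrimitive.integrable.continuousOn_mul huc),
    intervalIntegral.integral_of_le hab.le, intervalIntegral.integral_of_le hab.le,
    restrict_Ioc_eq_volΩ] at h1
  linear_combination -h1

lemma IsPrimitive.isWeakDeriv (hab : a < b) {u v : ℝ → ℂ} (h : IsPrimitive a b u v) :
    IsWeakDeriv a b 1 u v := by
  refine ⟨locallyIntegrableOn_of_integrable
      ((memLp_of_continuousOn (h.continuousOn hab.le)).integrable one_le_two),
    locallyIntegrableOn_of_integrable ((intervalIntegrable_iff_volΩ hab.le).1 h.integrable),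
    fun η h1 h2 h3 ↦ ?_⟩
  rw [iteratedDeriv_one, h.integral_mul_deriv hab ⟨h1, h2, h3⟩]
  ring

lemma isWeakDeriv_zero {u : ℝ → ℂ} (h : LocallyIntegrableOn u (Ioo a b)) :
    IsWeakDeriv a b 0 u u :=
  ⟨h, h, fun η _ _ _ ↦ by simp⟩

/-- Consecutive weak derivatives of which the first is continuous satisfy the fundamental theorem
of calculus. -/
lemma HasWeakDerivs.isPrimitive (hab : a < b) {m : ℕ} {u : ℝ → ℂ} {D : ℕ → ℝ → ℂ}
    (h : HasWeakDerivs a b m u D) {k : ℕ} (hk : k < m) (hc : ContinuousOn (D k) (Icc a b)) :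
    IsPrimitive a b (D k) (D (k + 1)) := by
  have hL : IntervalIntegrable (D (k + 1)) volume a b := (h (k + 1) hk).2.intervalIntegrable_volΩ
    hab.le
  set w : ℝ → ℂ := fun x ↦ ∫ t in a..x, D (k + 1) t with hw
  have hwp : IsPrimitive a b w (D (k + 1)) := ⟨hL, fun x _ ↦ by simp [hw]⟩
  have hwc := hwp.continuousOn hab.le
  have hDl := (h k hk.le).1.2.1
  have hwl : LocallyIntegrableOn w (Ioo a b) :=
    locallyIntegrableOn_of_integrable ((memLp_of_continuousOn hwc).integrable one_le_two)
  obtain ⟨c, hcc⟩ := exists_ae_eq_const_of_forall_isTest hab (u := fun x ↦ D k x - w x)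
    (hDl.sub hwl) fun η hη ↦ by
      simp only [sub_mul]
      rw [integral_sub (hη.deriv.integrableOn_mul hDl) (hη.deriv.integrableOn_mul hwl),
        hwp.integral_mul_deriv hab hη]
      have hη' := hη.deriv
      have h1 := (h (k + 1) hk).1.2.2 η hη.1 hη.2 hη.3
      have h2 := (h k hk.le).1.2.2 _ hη'.1 hη'.2 hη'.3
      rw [iteratedDeriv_succ', h2, pow_succ, mul_assoc] at h1
      have h3 := mul_left_cancel₀ (pow_ne_zero k (by norm_num : (-1 : ℂ) ≠ 0)) h1
      rw [h3]
      ring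
  have heq : EqOn (fun x ↦ D k x - w x) (fun _ ↦ c) (Icc a b) := by
    refine Measure.eqOn_Icc_of_ae_eq volume hab.ne ?_ (hc.sub hwc) continuousOn_const
    rwa [← restrict_Ioo_eq_restrict_Icc]
  refine ⟨hL, fun x hx ↦ ?_⟩
  have h1 := heq hx
  have h2 := heq (left_mem_Icc.2 hab.le)
  simp only [hw, intervalIntegral.integral_same, sub_zero] at h1 h2
  rw [h2, ← h1]
  ring

/-- The Sobolev embedding `H¹(a, b) ⊆ L^∞(a, b)`. -/
lemma IsPrimitive.norm_le (hab : a < b) {f f' : ℝ → ℂ} (hf : IsPrimitive a b f f')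
    (hL : MemLp f' 2 (volΩ a b)) {B : ℝ} (h1 : l2 a b f ≤ B) (h2 : l2 a b f' ≤ B) {x : ℝ}
    (hx : x ∈ Icc a b) : ‖f x‖ ≤ (√(b - a) / (b - a) + √(b - a)) * B := by
  have hba : 0 < b - a := by linarith
  have hfc := hf.continuousOn hab.le
  have hCS : ∀ {g : ℝ → ℂ}, MemLp g 2 (volΩ a b) → l2 a b g ≤ B →
      ∫ x in a..b, ‖g x‖ ≤ √(b - a) * B := by
    intro g hg hgB
    have hB := (l2_nonneg a b g).trans hgB
    have i2 : IntervalIntegrable (fun x ↦ ‖g x‖ ^ 2) volume a b := by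
      rw [intervalIntegrable_iff_integrableOn_Ioc_of_le hab.le, IntegrableOn, restrict_Ioc_eq_volΩ]
      exact hg.integrable_norm_pow (by norm_num)
    refine le_of_sq_le_sq ?_ (by positivity)
    rw [mul_pow, Real.sq_sqrt hba.le]
    refine (sq_integral_norm_le hab (hg.intervalIntegrable_volΩ hab.le) i2).trans ?_
    rw [← l2_sq hab.le hg]
    have := l2_nonneg a b g
    gcongr
  have e1 := hCS (memLp_of_continuousOn hfc) h1
  have e2 := hCS hL h2
  set A := ∫ x in a..b, ‖f' x‖ with hA
  have h3 : ∀ y ∈ Icc a b, ‖f x‖ ≤ ‖f y‖ + A := by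
    intro y hy
    have h4 : f x = f y + ∫ t in y..x, f' t := by
      have hs : ∀ z ∈ Icc a b, IntervalIntegrable f' volume a z := fun z hz ↦
        hf.integrable.mono_set (by
          rw [uIcc_of_le hz.1, uIcc_of_le hab.le]; exact Icc_subset_Icc_right hz.2)
      rw [← intervalIntegral.integral_interval_sub_left (hs x hx) (hs y hy),
        hf.eq_add_integral x hx, hf.eq_add_integral y hy]
      ring
    have h5 : ‖∫ t in y..x, f' t‖ ≤ A := by
      refine intervalIntegral.norm_integral_le_abs_integral_norm.trans ?_
      have := intervalIntegral.abs_integral_mono_interval (μ := volume) (f := fun t ↦ ‖f' t‖)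
        (a := y) (b := x) (c := a) (d := b) ?_ (ae_of_all _ fun _ ↦ norm_nonneg _)
        hf.integrable.norm
      · refine this.trans_eq (abs_of_nonneg ?_)
        exact intervalIntegral.integral_nonneg hab.le fun _ _ ↦ norm_nonneg _
      · rw [uIoc_of_le hab.le]
        exact Ioc_subset_Ioc (le_min hy.1 hx.1) (max_le hy.2 hx.2)
    rw [h4]
    exact (norm_add_le _ _).trans (by linarith)
  have i1 : IntervalIntegrable (fun y ↦ ‖f y‖) volume a b := by
    rw [← uIcc_of_le hab.le] at hfc
    exact hfc.norm.intervalIntegrable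
  have h8 := intervalIntegral.integral_mono_on hab.le (by simp) (i1.add (by simp)) h3
  rw [intervalIntegral.integral_const, intervalIntegral.integral_add i1 (by simp),
    intervalIntegral.integral_const, smul_eq_mul, smul_eq_mul] at h8
  have h9 : ‖f x‖ = (b - a)⁻¹ * ((b - a) * ‖f x‖) := by field_simp
  calc ‖f x‖ = (b - a)⁻¹ * ((b - a) * ‖f x‖) := h9
    _ ≤ (b - a)⁻¹ * (√(b - a) * B + (b - a) * (√(b - a) * B)) := by
      gcongr
      refine h8.trans ?_
      gcongr
    _ = _ := by field_simp

end GPE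

/-! ### Uniform Sobolev bounds in time -/

namespace GPE

variable {a b : ℝ}

lemma PerBound.congr {M : ℝ} {m : ℕ} {f g : ℝ → ℂ} (hab : a ≤ b) (h : EqOn f g (Icc a b))
    (hf : PerBound a b M (m + 1) f) : PerBound a b M (m + 1) g := by
  obtain ⟨f', h0, h1, h2, h3⟩ := hf
  have ha := h (left_mem_Icc.2 hab)
  refine ⟨f', h0, ⟨h1.integrable, fun x hx ↦ ?_⟩, ?_, fun x hx ↦ ?_⟩
  · rw [← h hx, ← ha, h1.eq_add_integral x hx]
  · rw [← ha, ← h (right_mem_Icc.2 hab), h2]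
  · rw [← h hx]; exact h3 x hx

/-- `L²` bounds on the weak derivatives of an element of `H^m_per`, in the form of `PerBound`. -/
lemma HasWeakDerivs.perBound (hab : a < b) {m : ℕ} {φ : ℝ → ℂ} {D : ℕ → ℝ → ℂ}
    (hD : HasWeakDerivs a b (m + 1) φ D) (h0 : EqOn (D 0) φ (Icc a b))
    (hper : ∀ k < m + 1, ContinuousOn (D k) (Icc a b) ∧ D k a = D k b) {B : ℝ}
    (hB : ∀ k ≤ m + 1, l2 a b (D k) ≤ B) :
    PerBound a b (max B ((√(b - a) / (b - a) + √(b - a)) * B)) (m + 1) φ := by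
  have key : ∀ j k, k + j = m + 1 →
      PerBound a b (max B ((√(b - a) / (b - a) + √(b - a)) * B)) j (D k) := by
    intro j
    induction j with
    | zero =>
      intro k hk
      obtain rfl : k = m + 1 := by omega
      exact ⟨(hD _ le_rfl).2, (hB _ le_rfl).trans (le_max_left _ _)⟩
    | succ j ih =>
      intro k hk
      have hk' : k < m + 1 := by omega
      have hp := hD.isPrimitive hab hk' (hper k hk').1
      exact ⟨D (k + 1), ih (k + 1) (by omega), hp, (hper k hk').2.symm, fun x hx ↦
        (hp.norm_le hab (hD (k + 1) hk').2 (hB k hk'.le) (hB (k + 1) hk') hx).trans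
          (le_max_right _ _)⟩
  exact (key (m + 1) 0 (by omega)).congr hab.le h0

lemma exists_hasWeakDerivs_of_sobolevNorm_lt_one {m : ℕ} {u : ℝ → ℂ}
    (h : sobolevNorm a b m u < 1) :
    ∃ D, HasWeakDerivs a b m u D ∧ ∀ k ≤ m, l2 a b (D k) ≤ 1 := by
  rw [sobolevNorm, iInf_lt_iff] at h
  obtain ⟨D, h⟩ := h
  rw [iInf_lt_iff] at h
  obtain ⟨hD, h⟩ := h
  refine ⟨D, hD, fun k hk ↦ ?_⟩
  have h1 : eLpNorm (D k) 2 (volΩ a b) ^ 2 ≤ 1 := by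
    refine (Finset.single_le_sum (f := fun k ↦ eLpNorm (D k) 2 (volΩ a b) ^ 2)
      (fun _ _ ↦ zero_le) (Finset.mem_range.2 (Nat.lt_succ_of_le hk))).trans ?_
    by_contra h2
    exact absurd h (not_lt.2 (ENNReal.one_le_rpow (not_le.1 h2).le (by norm_num)))
  have h2 : eLpNorm (D k) 2 (volΩ a b) ≤ 1 := by
    by_contra h3
    exact absurd h1 (not_le.2 (one_lt_pow₀ (not_le.1 h3) (by norm_num)))
  rw [l2, ← toReal_eLpNorm (hD k hk).2.1]
  exact ENNReal.toReal_le_of_le_ofReal zero_le_one (by simpa using h2)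

lemma l2_congr_ae {f g : ℝ → ℂ} (hf : AEStronglyMeasurable f (volΩ a b))
    (h : f =ᵐ[volΩ a b] g) : l2 a b f = l2 a b g := by
  rw [l2, l2, ← toReal_eLpNorm hf, ← toReal_eLpNorm (hf.congr h), eLpNorm_congr_ae h]

/-- A curve in `C([0, T]; H^m_per)` is bounded, by compactness of `[0, T]`. -/
lemma MemCHper.exists_l2_le {T : ℝ} {m : ℕ} {ψ : ℝ → ℝ → ℂ} (hψ : MemCHper a b T m ψ) :
    ∃ B, ∀ s ∈ Icc 0 T, ∀ D, HasWeakDerivs a b m (ψ s) D → ∀ k ≤ m, l2 a b (D k) ≤ B := by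
  suffices ∃ B, ∀ s ∈ Icc 0 T, s ∈ Icc 0 T → ∀ D, HasWeakDerivs a b m (ψ s) D →
      ∀ k ≤ m, l2 a b (D k) ≤ B by
    obtain ⟨B, hB⟩ := this
    exact ⟨B, fun s hs ↦ hB s hs hs⟩
  refine (isCompact_Icc (a := (0 : ℝ)) (b := T)).induction_on
    (p := fun S ↦ ∃ B, ∀ s ∈ S, s ∈ Icc 0 T → ∀ D, HasWeakDerivs a b m (ψ s) D →
      ∀ k ≤ m, l2 a b (D k) ≤ B) ?_ ?_ ?_ ?_
  · exact ⟨0, by simp⟩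
  · rintro S S' hS ⟨B, hB⟩
    exact ⟨B, fun s hs ↦ hB s (hS hs)⟩
  · rintro S S' ⟨B, hB⟩ ⟨B', hB'⟩
    refine ⟨max B B', fun s hs hs' D hD k hk ↦ ?_⟩
    rcases hs with hs | hs
    · exact (hB s hs hs' D hD k hk).trans (le_max_left _ _)
    · exact (hB' s hs hs' D hD k hk).trans (le_max_right _ _)
  · intro t ht
    obtain ⟨E, -, hE, -⟩ := hψ.1 t ht
    refine ⟨_, (hψ.2 t ht).eventually (gt_mem_nhds one_pos),
      (∑ k ∈ Finset.range (m + 1), l2 a b (E k)) + 1, fun s hs hs' D hD k hk ↦ ?_⟩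
    obtain ⟨F, hF, hF1⟩ := exists_hasWeakDerivs_of_sobolevNorm_lt_one hs
    have h1 := (hE k hk).1.add (hF k hk).1
    have h2 : (fun x ↦ ψ t x + (ψ s x - ψ t x)) = ψ s := by ext x; ring
    rw [h2] at h1
    rw [l2_congr_ae (hD k hk).2.1 ((hD k hk).1.ae_eq h1)]
    refine (lpNorm_add_le (hE k hk).2 one_le_two).trans (add_le_add ?_ (hF1 k hk))
    exact Finset.single_le_sum (f := fun k ↦ l2 a b (E k)) (fun _ _ ↦ l2_nonneg _ _ _)
      (Finset.mem_range.2 (Nat.lt_succ_of_le hk))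

lemma MemCHper.exists_perBound (hab : a < b) {T : ℝ} {m : ℕ} {ψ : ℝ → ℝ → ℂ}
    (hψ : MemCHper a b T (m + 1) ψ) : ∃ M, ∀ t ∈ Icc 0 T, PerBound a b M (m + 1) (ψ t) := by
  obtain ⟨B, hB⟩ := hψ.exists_l2_le
  refine ⟨max B ((√(b - a) / (b - a) + √(b - a)) * B), fun t ht ↦ ?_⟩
  obtain ⟨D, h0, hD, hper⟩ := hψ.1 t ht
  exact hD.perBound hab h0 hper (hB t ht D hD)

lemma MemHper.fourierHat_of_isWeakDeriv_two (hab : a < b) {m : ℕ} (hm : 2 ≤ m) {φ v : ℝ → ℂ}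
    (hφ : MemHper a b m φ) (hv : IsWeakDeriv a b 2 φ v) (l : ℤ) :
    fourierHat a b v l = -(freq a b l : ℂ) ^ 2 * fourierHat a b φ l := by
  obtain ⟨D, h0, hD, hper⟩ := hφ
  have h1 := hD.isPrimitive hab (k := 0) (by omega) (hper 0 (by omega)).1
  have h2 := hD.isPrimitive hab (k := 1) (by omega) (hper 1 (by omega)).1
  have h3 : D 0 =ᵐ[volΩ a b] φ := ae_volΩ_of_forall_Icc h0
  rw [fourierHat_congr_ae hab.le (hv.ae_eq (hD 2 hm).1),
    fourierHat_deriv hab h2 (hper 1 (by omega)).2.symm,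
    fourierHat_deriv hab h1 (hper 0 (by omega)).2.symm, fourierHat_congr_ae hab.le h3]
  linear_combination (freq a b l : ℂ) ^ 2 * fourierHat a b φ l * Complex.I_sq

lemma MemHper.memLp_of_isWeakDeriv_two {m : ℕ} (hm : 2 ≤ m) {φ v : ℝ → ℂ}
    (hφ : MemHper a b m φ) (hv : IsWeakDeriv a b 2 φ v) : MemLp v 2 (volΩ a b) := by
  obtain ⟨D, -, hD, -⟩ := hφ
  exact (hD 2 hm).2.ae_eq ((hD 2 hm).1.ae_eq hv)

end GPE

/-! ### Regularity of the forcing and the equation for the Fourier coefficients -/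

namespace GPE

variable {a b : ℝ}

/-- The cubic nonlinearity `β |z|² z`. -/
noncomputable def cubic (β : ℝ) (z : ℂ) : ℂ := (β : ℂ) * ((‖z‖ ^ 2 : ℝ) : ℂ) * z

/-- The potential and nonlinear terms `V ψ + β |ψ|² ψ` of the Gross–Pitaevskii equation. -/
noncomputable def forcing (β : ℝ) (V : ℝ → ℝ → ℝ) (ψ : ℝ → ℝ → ℂ) (t x : ℝ) : ℂ :=
  (V t x : ℂ) * ψ t x + cubic β (ψ t x)

lemma norm_cubic (β : ℝ) (z : ℂ) : ‖cubic β z‖ = |β| * ‖z‖ ^ 2 * ‖z‖ := by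
  rw [cubic, norm_mul, norm_mul, Complex.norm_real, Complex.norm_real, Real.norm_eq_abs,
    Real.norm_eq_abs, abs_of_nonneg (by positivity : 0 ≤ ‖z‖ ^ 2)]

lemma continuous_cubic (β : ℝ) : Continuous (cubic β) := by
  unfold cubic; fun_prop

lemma norm_cubic_sub_le (β : ℝ) {K : ℝ} {z w : ℂ} (hz : ‖z‖ ≤ K) (hw : ‖w‖ ≤ K) :
    ‖cubic β z - cubic β w‖ ≤ 3 * |β| * K ^ 2 * ‖z - w‖ := by
  have hK : 0 ≤ K := (norm_nonneg z).trans hz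
  have h1 : cubic β z - cubic β w = β * ((z - w) * starRingEnd ℂ z * z +
      w * starRingEnd ℂ (z - w) * z + w * starRingEnd ℂ w * (z - w)) := by
    rw [cubic, cubic]
    push_cast
    rw [← Complex.mul_conj', ← Complex.mul_conj', map_sub]
    ring
  rw [h1, norm_mul, Complex.norm_real, Real.norm_eq_abs]
  have h2 : ‖(z - w) * starRingEnd ℂ z * z‖ ≤ ‖z - w‖ * K * K := by
    rw [norm_mul, norm_mul, RCLike.norm_conj]; gcongr
  have h3 : ‖w * starRingEnd ℂ (z - w) * z‖ ≤ K * ‖z - w‖ * K := by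
    rw [norm_mul, norm_mul, RCLike.norm_conj]; gcongr
  have h4 : ‖w * starRingEnd ℂ w * (z - w)‖ ≤ K * K * ‖z - w‖ := by
    rw [norm_mul, norm_mul, RCLike.norm_conj]; gcongr
  have h5 := (norm_add₃_le (a := (z - w) * starRingEnd ℂ z * z)
    (b := w * starRingEnd ℂ (z - w) * z) (c := w * starRingEnd ℂ w * (z - w)))
  calc _ ≤ |β| * (‖z - w‖ * K * K + K * ‖z - w‖ * K + K * K * ‖z - w‖) := by
        gcongr; linarith
    _ = _ := by ring

lemma lpNorm_coeFn {E : Type*} [NormedAddCommGroup E] {p : ℝ≥0∞} (u : Lp E p (volΩ a b)) :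
    lpNorm u p (volΩ a b) = ‖u‖ := by
  rw [Lp.norm_def, toReal_eLpNorm (Lp.aestronglyMeasurable u)]

lemma Represents.memLp {E : Type*} [NormedAddCommGroup E] {T : ℝ} {p : ℝ≥0∞} {u : ℝ → ℝ → E}
    {U : ℝ → Lp E p (volΩ a b)} (h : Represents a b T p u U) {t : ℝ} (ht : t ∈ Icc 0 T) :
    MemLp (u t) p (volΩ a b) := (Lp.memLp (U t)).ae_eq (h t ht)

/-- Curves in `C¹([0, T]; L²)` are Lipschitz continuous. -/
lemma MemC1L2.exists_lipschitz {E : Type*} [NormedAddCommGroup E] [NormedSpace ℝ E] {T : ℝ}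
    {u : ℝ → ℝ → E} (h : MemC1L2 a b T u) : ∃ L : ℝ, 0 ≤ L ∧ ∀ s ∈ Icc 0 T, ∀ t ∈ Icc 0 T,
      MemLp (fun x ↦ u t x - u s x) 2 (volΩ a b) ∧
      lpNorm (fun x ↦ u t x - u s x) 2 (volΩ a b) ≤ L * |t - s| := by
  obtain ⟨U, hU, hC⟩ := h
  obtain ⟨K, hK⟩ := hC.exists_lipschitzOnWith (by decide) (convex_Icc _ _) isCompact_Icc
  refine ⟨K, K.2, fun s hs t ht ↦ ?_⟩
  have hm : MemLp (fun x ↦ u t x - u s x) 2 (volΩ a b) := (hU.memLp ht).sub (hU.memLp hs)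
  refine ⟨hm, ?_⟩
  have h1 := hK.dist_le_mul t ht s hs
  rw [dist_eq_norm, Real.dist_eq, ← lpNorm_coeFn] at h1
  refine le_trans (le_of_eq ?_) h1
  rw [← toReal_eLpNorm hm.1, ← toReal_eLpNorm (Lp.aestronglyMeasurable _)]
  congr 1
  refine eLpNorm_congr_ae ?_
  filter_upwards [hU t ht, hU s hs, Lp.coeFn_sub (U t) (U s)] with x h2 h3 h4
  rw [h4, Pi.sub_apply, h2, h3]

lemma MemCLp.exists_ae_bound {T : ℝ} {V : ℝ → ℝ → ℝ} (h : MemCLp a b T ∞ V) :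
    ∃ M : ℝ, ∀ t ∈ Icc 0 T, AEStronglyMeasurable (V t) (volΩ a b) ∧
      ∀ᵐ x ∂volΩ a b, |V t x| ≤ M := by
  obtain ⟨U, hU, hC⟩ := h
  obtain ⟨M, hM⟩ := isCompact_Icc.exists_bound_of_continuousOn hC
  refine ⟨M, fun t ht ↦ ⟨(hU.memLp ht).1, ?_⟩⟩
  filter_upwards [ae_le_lpNorm_exponent_top (Lp.memLp (U t)), hU t ht] with x h1 h2
  rw [lpNorm_coeFn, h2] at h1
  exact h1.trans (hM t ht)

lemma norm_fourierHat_le (hab : a < b) {f : ℝ → ℂ} (hf : MemLp f 2 (volΩ a b)) (l : ℤ) :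
    ‖fourierHat a b f l‖ ≤ √(b - a)⁻¹ * l2 a b f := by
  have hba : 0 < b - a := by linarith
  refine le_of_sq_le_sq ?_ (mul_nonneg (by positivity) (l2_nonneg _ _ _))
  rw [mul_pow, Real.sq_sqrt (by positivity)]
  exact le_hasSum (hasSum_sq_fourierHat hab hf) l fun _ _ ↦ by positivity

/-- The Fourier coefficient as a continuous linear functional on `L²(a, b)`. -/
noncomputable def fourierHatCLM (hab : a < b) (l : ℤ) : Lp ℂ 2 (volΩ a b) →L[ℝ] ℂ :=
  LinearMap.mkContinuous
    { toFun := fun u ↦ fourierHat a b u l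
      map_add' := fun u v ↦ by
        rw [fourierHat_congr_ae hab.le (Lp.coeFn_add u v)]
        exact fourierHat_add ((Lp.memLp u).intervalIntegrable_volΩ hab.le)
          ((Lp.memLp v).intervalIntegrable_volΩ hab.le) l
      map_smul' := fun r u ↦ by
        rw [fourierHat_congr_ae hab.le (Lp.coeFn_smul r u)]
        exact fourierHat_const_mul (r : ℂ) u l }
    √(b - a)⁻¹ fun u ↦ by
      have := norm_fourierHat_le hab (Lp.memLp u) l
      rwa [l2, lpNorm_coeFn] at this

/-- The quantitative consequences, uniform in time, of the regularity assumptions on the potential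
and the solution, together with the equation for the Fourier coefficients of the solution. -/
structure IsRegular (a b T β : ℝ) (m : ℕ) (V : ℝ → ℝ → ℝ) (ψ : ℝ → ℝ → ℂ) (M L : ℝ) : Prop where
  perBound : ∀ t ∈ Icc 0 T, PerBound a b M (m + 1) (ψ t)
  aestronglyMeasurable : ∀ t ∈ Icc 0 T, AEStronglyMeasurable (V t) (volΩ a b)
  ae_bound : ∀ t ∈ Icc 0 T, ∀ᵐ x ∂volΩ a b, |V t x| ≤ M
  memLp_forcing : ∀ t ∈ Icc 0 T, MemLp (forcing β V ψ t) 2 (volΩ a b)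
  l2_forcing_le : ∀ t ∈ Icc 0 T, l2 a b (forcing β V ψ t) ≤ L
  l2_forcing_sub_le : ∀ s ∈ Icc 0 T, ∀ t ∈ Icc 0 T,
    l2 a b (fun x ↦ forcing β V ψ t x - forcing β V ψ s x) ≤ L * |t - s|
  continuousOn : ∀ l, ContinuousOn (fun t ↦ fourierHat a b (ψ t) l) (Icc 0 T)
  hasDerivAt : ∀ l, ∀ t ∈ Ioo 0 T, HasDerivAt (fun t ↦ fourierHat a b (ψ t) l)
    (-Complex.I * ((freq a b l : ℂ) ^ 2 * fourierHat a b (ψ t) l +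
      fourierHat a b (forcing β V ψ t) l)) t

lemma memLp_ofReal_mul {V : ℝ → ℝ} {M : ℝ} (hV : AEStronglyMeasurable V (volΩ a b))
    (hM : ∀ᵐ x ∂volΩ a b, |V x| ≤ M) {f : ℝ → ℂ} (hf : MemLp f 2 (volΩ a b)) :
    MemLp (fun x ↦ (V x : ℂ) * f x) 2 (volΩ a b) := by
  refine memLp_of_ae_le (K := M)
    ((Complex.continuous_ofReal.comp_aestronglyMeasurable hV).mul hf.1) hf ?_
  filter_upwards [hM] with x hx
  rw [norm_mul, Complex.norm_real, Real.norm_eq_abs]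
  gcongr

lemma l2_ofReal_mul_le {V : ℝ → ℝ} {M : ℝ} (hM0 : 0 ≤ M)
    (hV : AEStronglyMeasurable V (volΩ a b))
    (hM : ∀ᵐ x ∂volΩ a b, |V x| ≤ M) {f : ℝ → ℂ} (hf : MemLp f 2 (volΩ a b)) :
    l2 a b (fun x ↦ (V x : ℂ) * f x) ≤ M * l2 a b f := by
  refine lpNorm_le_of_ae_le hM0
    ((Complex.continuous_ofReal.comp_aestronglyMeasurable hV).mul hf.1) hf ?_
  filter_upwards [hM] with x hx
  rw [norm_mul, Complex.norm_real, Real.norm_eq_abs]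
  gcongr

lemma exists_isRegular (hab : a < b) {T β : ℝ} (hT : 0 < T) {m : ℕ} (hm : 1 ≤ m)
    {V : ℝ → ℝ → ℝ} {ψ₀ : ℝ → ℂ} {ψ : ℝ → ℝ → ℂ}
    (hV : MemCLp a b T ∞ V) (hV' : MemC1L2 a b T V)
    (hψ : MemCHper a b T (m + 1) ψ) (hψ' : MemC1L2 a b T ψ)
    (hsol : IsSolution a b T β V ψ₀ ψ) :
    ∃ M L, 0 ≤ M ∧ 0 ≤ L ∧ IsRegular a b T β m V ψ M L := by
  obtain ⟨Mψ, hMψ⟩ := hψ.exists_perBound hab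
  obtain ⟨MV, hMV⟩ := hV.exists_ae_bound
  obtain ⟨LV, hLV0, hLV⟩ := hV'.exists_lipschitz
  obtain ⟨Lψ, hLψ0, hLψ⟩ := hψ'.exists_lipschitz
  obtain ⟨-, U, hU, hUsol⟩ := hsol
  set M := max Mψ MV with hM
  have hper : ∀ t ∈ Icc 0 T, PerBound a b M (m + 1) (ψ t) := fun t ht ↦
    (hMψ t ht).mono (le_max_left _ _)
  have hVb : ∀ t ∈ Icc 0 T, ∀ᵐ x ∂volΩ a b, |V t x| ≤ M := fun t ht ↦ by
    filter_upwards [(hMV t ht).2] with x hx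
    exact hx.trans (le_max_right _ _)
  have hVm := fun t ht ↦ (hMV t ht).1
  have h0T : (0 : ℝ) ∈ Icc 0 T := left_mem_Icc.2 hT.le
  have hM0 : 0 ≤ M := (hper 0 h0T).nonneg
  have hψL : ∀ t ∈ Icc 0 T, MemLp (ψ t) 2 (volΩ a b) := fun t ht ↦ (hper t ht).memLp hab.le
  have hψb : ∀ t ∈ Icc 0 T, ∀ᵐ x ∂volΩ a b, ‖ψ t x‖ ≤ M := fun t ht ↦
    ae_volΩ_of_forall_Icc fun x hx ↦ (hper t ht).norm_le hx
  have hcm : ∀ t ∈ Icc 0 T, AEStronglyMeasurable (fun x ↦ cubic β (ψ t x)) (volΩ a b) :=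
    fun t ht ↦ (continuous_cubic β).comp_aestronglyMeasurable (hψL t ht).1
  have hcL : ∀ t ∈ Icc 0 T, MemLp (fun x ↦ cubic β (ψ t x)) 2 (volΩ a b) := fun t ht ↦ by
    refine memLp_of_ae_le (K := |β| * M ^ 2) (hcm t ht) (hψL t ht) ?_
    filter_upwards [hψb t ht] with x hx
    rw [norm_cubic]
    gcongr
  have hGL : ∀ t ∈ Icc 0 T, MemLp (forcing β V ψ t) 2 (volΩ a b) := fun t ht ↦
    (memLp_ofReal_mul (hVm t ht) (hVb t ht) (hψL t ht)).add (hcL t ht)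
  set L := M * Lψ + M * LV + 3 * |β| * M ^ 2 * Lψ with hL
  have hL0 : 0 ≤ L := by positivity
  have hLip : ∀ s ∈ Icc 0 T, ∀ t ∈ Icc 0 T,
      l2 a b (fun x ↦ forcing β V ψ t x - forcing β V ψ s x) ≤ L * |t - s| := by
    intro s hs t ht
    obtain ⟨m1, e1⟩ := hLψ s hs t ht
    obtain ⟨m2, e2⟩ := hLV s hs t ht
    have k1 := l2_ofReal_mul_le hM0 (hVm t ht) (hVb t ht) m1
    have n1 := memLp_ofReal_mul (hVm t ht) (hVb t ht) m1
    have q2 : ∀ᵐ x ∂volΩ a b, ‖((V t x - V s x : ℝ) : ℂ) * ψ s x‖ ≤ M * ‖V t x - V s x‖ := by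
      filter_upwards [hψb s hs] with x hx
      rw [norm_mul, Complex.norm_real, mul_comm]
      gcongr
    have p2 : AEStronglyMeasurable (fun x ↦ ((V t x - V s x : ℝ) : ℂ) * ψ s x) (volΩ a b) :=
      (Complex.continuous_ofReal.comp_aestronglyMeasurable m2.1).mul (hψL s hs).1
    have k2 := lpNorm_le_of_ae_le hM0 p2 m2 q2
    have n2 := memLp_of_ae_le p2 m2 q2
    have k3 := lpNorm_le_of_ae_le (K := 3 * |β| * M ^ 2) (by positivity)
      ((hcm t ht).sub (hcm s hs)) m1 (by
        filter_upwards [hψb t ht, hψb s hs] with x h1 h2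
        exact norm_cubic_sub_le β h1 h2)
    have heq : (fun x ↦ forcing β V ψ t x - forcing β V ψ s x) =
        ((fun x ↦ (V t x : ℂ) * (ψ t x - ψ s x)) + fun x ↦ ((V t x - V s x : ℝ) : ℂ) * ψ s x) +
          ((fun x ↦ cubic β (ψ t x)) - fun x ↦ cubic β (ψ s x)) := by
      ext x
      simp only [forcing, Pi.add_apply, Pi.sub_apply]
      push_cast
      ring
    rw [heq]
    refine (lpNorm_add_le (n1.add n2) one_le_two).trans ?_
    have e3 := lpNorm_add_le (g := fun x ↦ ((V t x - V s x : ℝ) : ℂ) * ψ s x) n1 one_le_two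
    have e4 := mul_le_mul_of_nonneg_left e1 hM0
    have e5 := mul_le_mul_of_nonneg_left e2 hM0
    have e6 := mul_le_mul_of_nonneg_left e1 (by positivity : 0 ≤ 3 * |β| * M ^ 2)
    have e7 : L * |t - s| = M * (Lψ * |t - s|) + M * (LV * |t - s|) +
      3 * |β| * M ^ 2 * (Lψ * |t - s|) := by rw [hL]; ring
    simp only [l2] at k1 ⊢
    linarith
  set B := M * (√(b - a) * M) + √(b - a) * (|β| * M ^ 2 * M) with hB
  have hB0 : 0 ≤ B := by positivity
  refine ⟨M, max L B, hM0, hL0.trans (le_max_left _ _), hper, hVm, hVb, hGL,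
    fun t ht ↦ le_trans ?_ (le_max_right _ _), fun s hs t ht ↦ (hLip s hs t ht).trans ?_,
    fun l ↦ ?_, fun l t ht ↦ ?_⟩
  · refine (lpNorm_add_le (memLp_ofReal_mul (hVm t ht) (hVb t ht) (hψL t ht))
      one_le_two).trans (add_le_add ?_ ?_)
    · refine (l2_ofReal_mul_le hM0 (hVm t ht) (hVb t ht) (hψL t ht)).trans ?_
      gcongr
      exact l2_le_of_ae_bound hab.le hM0 (hψL t ht).1 (hψb t ht)
    · refine l2_le_of_ae_bound hab.le (by positivity) (hcm t ht) ?_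
      filter_upwards [hψb t ht] with x hx
      rw [norm_cubic]
      gcongr
  · gcongr
    exact le_max_left _ _
  · refine LipschitzOnWith.continuousOn (K := (√(b - a)⁻¹ * Lψ).toNNReal)
      (LipschitzOnWith.of_dist_le_mul fun t ht s hs ↦ ?_)
    rw [dist_eq_norm, Real.dist_eq, Real.coe_toNNReal _ (by positivity),
      ← fourierHat_sub ((hψL t ht).intervalIntegrable_volΩ hab.le)
        ((hψL s hs).intervalIntegrable_volΩ hab.le), mul_assoc]
    obtain ⟨m1, e1⟩ := hLψ s hs t ht
    refine (norm_fourierHat_le hab m1 l).trans ?_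
    gcongr
  · obtain ⟨W, ψxx, hW, hxx, heq⟩ := hUsol t ht
    have ht' := Ioo_subset_Icc_self ht
    have h1 := (fourierHatCLM hab l).hasFDerivAt.comp_hasDerivAt t hW
    have h2 : fourierHat a b W l = -Complex.I * ((freq a b l : ℂ) ^ 2 * fourierHat a b (ψ t) l +
        fourierHat a b (forcing β V ψ t) l) := by
      have h3 : W =ᵐ[volΩ a b] fun x ↦ -Complex.I * (forcing β V ψ t x - ψxx x) := by
        filter_upwards [heq] with x hx
        have : forcing β V ψ t x - ψxx x = Complex.I * W x := by
          rw [hx, forcing, cubic]; ring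
        rw [this]
        linear_combination W x * Complex.I_sq
      have hxxL := (hψ.1 t ht').memLp_of_isWeakDeriv_two (by omega) hxx
      rw [fourierHat_congr_ae hab.le h3, fourierHat_const_mul,
        fourierHat_sub ((hGL t ht').intervalIntegrable_volΩ hab.le)
          (hxxL.intervalIntegrable_volΩ hab.le),
        (hψ.1 t ht').fourierHat_of_isWeakDeriv_two hab (by omega) hxx]
      ring
    rw [← h2]
    refine h1.congr_of_eventuallyEq ?_
    filter_upwards [Ioo_mem_nhds ht.1 ht.2] with s hs
    exact (fourierHat_congr_ae hab.le (hU s (Ioo_subset_Icc_self hs)) l).symm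

end GPE

/-! ### The local error in time -/

namespace GPE

variable {a b : ℝ}

/-- The multiplier `e^{-i τ μ_l²}` of the free Schrödinger flow. -/
noncomputable def phase (a b τ : ℝ) (l : ℤ) : ℂ :=
  Complex.exp (-(Complex.I * ((τ * freq a b l ^ 2 : ℝ) : ℂ)))

lemma norm_phase (τ : ℝ) (l : ℤ) : ‖phase a b τ l‖ = 1 := by
  rw [phase, mul_comm, ← neg_mul, ← Complex.ofReal_neg]
  exact Complex.norm_exp_ofReal_mul_I _

/-- `∫₀ˢ e^{i σ μ_l²} dσ`. -/
noncomputable def phaseIntegral (a b s : ℝ) (l : ℤ) : ℂ :=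
  ∫ σ in (0 : ℝ)..s, phase a b (-σ) l

lemma continuous_phase (l : ℤ) : Continuous fun s ↦ phase a b s l := by
  unfold phase; fun_prop

lemma hasDerivAt_phase_neg (l : ℤ) (s : ℝ) :
    HasDerivAt (fun s ↦ phase a b (-s) l) (Complex.I * (freq a b l : ℂ) ^ 2 * phase a b (-s) l)
      s := by
  have h1 : HasDerivAt (fun s : ℝ ↦ -(Complex.I * ((-s * freq a b l ^ 2 : ℝ) : ℂ)))
      (Complex.I * (freq a b l : ℂ) ^ 2) s := by
    have := ((((hasDerivAt_id s).neg).mul_const (freq a b l ^ 2)).ofReal_comp.const_mul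
      Complex.I).neg
    convert! this using 1
    push_cast
    ring
  have := h1.cexp
  rw [mul_comm] at this
  exact this

lemma hasDerivAt_phaseIntegral (l : ℤ) (s : ℝ) :
    HasDerivAt (fun s ↦ phaseIntegral a b s l) (phase a b (-s) l) s :=
  (((continuous_phase l).comp continuous_neg).integral_hasStrictDerivAt 0 s).hasDerivAt

lemma phase_mul_phase_neg (τ : ℝ) (l : ℤ) : phase a b τ l * phase a b (-τ) l = 1 := by
  rw [phase, phase, ← Complex.exp_add, Complex.exp_eq_one_iff]
  exact ⟨0, by push_cast; ring⟩

lemma norm_phase_sub_one_le (s : ℝ) (l : ℤ) : ‖phase a b s l - 1‖ ≤ |s| * freq a b l ^ 2 := by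
  have := Real.norm_exp_I_mul_ofReal_sub_one_le (x := -(s * freq a b l ^ 2))
  rw [norm_neg, norm_mul, Real.norm_eq_abs, Real.norm_eq_abs,
    abs_of_nonneg (sq_nonneg (freq a b l))] at this
  rwa [Complex.ofReal_neg, mul_neg] at this

lemma norm_phaseIntegral_sub_le {τ : ℝ} (hτ : 0 ≤ τ) (l : ℤ) :
    ‖phaseIntegral a b τ l - τ‖ ≤ τ * freq a b l ^ 2 * τ := by
  have h1 : phaseIntegral a b τ l - τ = ∫ σ in (0 : ℝ)..τ, (phase a b (-σ) l - 1) := by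
    have hi : IntervalIntegrable (fun σ ↦ phase a b (-σ) l) volume 0 τ :=
      ((continuous_phase l).comp continuous_neg).intervalIntegrable _ _
    rw [intervalIntegral.integral_sub hi intervalIntegrable_const]
    simp [phaseIntegral]
  rw [h1]
  refine (intervalIntegral.norm_integral_le_of_norm_le_const (C := τ * freq a b l ^ 2)
    fun σ hσ ↦ ?_).trans_eq (by rw [sub_zero, abs_of_nonneg hτ])
  rw [uIoc_of_le hτ] at hσ
  refine (norm_phase_sub_one_le _ _).trans ?_
  rw [abs_neg, abs_of_pos hσ.1]
  gcongr
  exact hσ.2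

/-- For `τ μ_l² ≤ π` the multiplier stays away from `1`, except near frequency zero. -/
lemma le_norm_one_sub_phase {τ : ℝ} (hτ : 0 ≤ τ) {l : ℤ} (hl : τ * freq a b l ^ 2 ≤ Real.pi) :
    τ * freq a b l ^ 2 ≤ 2 * ‖1 - phase a b τ l‖ := by
  set θ := τ * freq a b l ^ 2 with hθ
  have hθ0 : 0 ≤ θ := by positivity
  have h1 : ‖1 - phase a b τ l‖ = ‖2 * Real.sin (-θ / 2)‖ := by
    rw [← Complex.norm_exp_I_mul_ofReal_sub_one, norm_sub_rev, phase, ← hθ, Complex.ofReal_neg,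
      mul_neg]
  have h2 := Real.mul_le_sin (x := θ / 2) (by linarith) (by linarith)
  have h3 : 0 ≤ Real.sin (θ / 2) := Real.sin_nonneg_of_nonneg_of_le_pi (by linarith)
    (by linarith [Real.pi_pos])
  rw [h1, neg_div, Real.sin_neg, mul_neg, norm_neg, Real.norm_eq_abs, abs_of_nonneg (by linarith)]
  have h4 : 1 / 4 * θ ≤ 2 / Real.pi * (θ / 2) := by
    have : 1 / 2 ≤ 2 / Real.pi := by
      rw [div_le_div_iff₀ two_pos Real.pi_pos]
      linarith [Real.pi_le_four]
    nlinarith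
  linarith

/-- The multiplier `γ_l` of the correction that turns the local error `O(τ² μ_l²)` caused by
freezing the flow in Duhamel's formula into a telescoping term. At `μ_l = 0` both the numerator
and the denominator vanish, and `γ_l = 0`. -/
noncomputable def corrector (a b τ : ℝ) (l : ℤ) : ℂ :=
  Complex.I * phase a b τ l * (phaseIntegral a b τ l - τ) / (1 - phase a b τ l)

lemma corrector_mul {τ : ℝ} (hτ : 0 ≤ τ) {l : ℤ} (hl : τ * freq a b l ^ 2 ≤ Real.pi) :
    corrector a b τ l * (1 - phase a b τ l) =
      Complex.I * phase a b τ l * (phaseIntegral a b τ l - τ) := by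
  rw [corrector]
  by_cases h : 1 - phase a b τ l = 0
  · have h1 := le_norm_one_sub_phase hτ hl
    rw [h, norm_zero, mul_zero] at h1
    have h2 := norm_phaseIntegral_sub_le (a := a) (b := b) hτ l
    have h3 : ‖phaseIntegral a b τ l - τ‖ ≤ 0 := h2.trans (mul_nonpos_of_nonpos_of_nonneg h1 hτ)
    rw [norm_le_zero_iff.1 h3, h]
    simp
  · exact div_mul_cancel₀ _ h

lemma norm_corrector_le {τ : ℝ} (hτ : 0 ≤ τ) {l : ℤ} (hl : τ * freq a b l ^ 2 ≤ Real.pi) :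
    ‖corrector a b τ l‖ ≤ 2 * τ := by
  rw [corrector, norm_div, norm_mul, norm_mul, Complex.norm_I, norm_phase, one_mul, one_mul]
  refine div_le_of_le_mul₀ (norm_nonneg _) (by positivity) ?_
  refine (norm_phaseIntegral_sub_le hτ l).trans ?_
  have := mul_le_mul_of_nonneg_right (le_norm_one_sub_phase hτ hl) hτ
  linarith

/-- The mean value inequality for a function that is differentiable in the interior. -/
lemma norm_sub_le_of_hasDerivAt_Ioo {E : Type*} [NormedAddCommGroup E] [NormedSpace ℝ E]
    {f f' : ℝ → E} {τ C : ℝ} (hτ : 0 < τ) (hC : 0 ≤ C) (hc : ContinuousOn f (Icc 0 τ))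
    (hd : ∀ s ∈ Ioo 0 τ, HasDerivAt f (f' s) s) (hb : ∀ s ∈ Ioo 0 τ, ‖f' s‖ ≤ C) :
    ‖f τ - f 0‖ ≤ C * τ := by
  have h1 : LipschitzOnWith C.toNNReal f (Ioo 0 τ) :=
    (convex_Ioo 0 τ).lipschitzOnWith_of_nnnorm_hasDerivWithin_le
      (fun s hs ↦ (hd s hs).hasDerivWithinAt) fun s hs ↦ by
        rw [← NNReal.coe_le_coe, coe_nnnorm, Real.coe_toNNReal _ hC]
        exact hb s hs
  have h2 := h1.closure (by rwa [closure_Ioo hτ.ne])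
  rw [closure_Ioo hτ.ne] at h2
  have h3 := h2.dist_le_mul τ (right_mem_Icc.2 hτ.le) 0 (left_mem_Icc.2 hτ.le)
  rwa [dist_eq_norm, Real.dist_eq, sub_zero, abs_of_pos hτ, Real.coe_toNNReal _ hC] at h3

lemma hasDerivAt_vec {N : ℕ} {c c' : ℝ → ℤ → ℂ} {s : ℝ}
    (h : ∀ l, HasDerivAt (fun s ↦ c s l) (c' s l) s) :
    HasDerivAt (fun s ↦ vec N (c s)) (vec N (c' s)) s := by
  have h1 : HasDerivAt (fun s ↦ fun l : freqs N ↦ c s l) (fun l : freqs N ↦ c' s l) s :=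
    hasDerivAt_pi.2 fun l ↦ h l
  exact (PiLp.continuousLinearEquiv 2 ℝ
    (fun _ : freqs N ↦ ℂ)).symm.toContinuousLinearMap.hasFDerivAt.comp_hasDerivAt s h1

lemma continuousOn_vec {N : ℕ} {c : ℝ → ℤ → ℂ} {S : Set ℝ}
    (h : ∀ l, ContinuousOn (fun s ↦ c s l) S) : ContinuousOn (fun s ↦ vec N (c s)) S := by
  have h1 : ContinuousOn (fun s ↦ fun l : freqs N ↦ c s l) S := continuousOn_pi.2 fun l ↦ h l
  exact (PiLp.continuousLinearEquiv 2 ℝ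
    (fun _ : freqs N ↦ ℂ)).symm.continuous.comp_continuousOn h1

variable {T β M L : ℝ} {m : ℕ} {V : ℝ → ℝ → ℝ} {ψ : ℝ → ℝ → ℂ}

lemma IsRegular.norm_vec_forcing_le (hab : a < b) (h : IsRegular a b T β m V ψ M L) (N : ℕ)
    {t : ℝ} (ht : t ∈ Icc 0 T) :
    ‖vec N (fourierHat a b (forcing β V ψ t))‖ ≤ √(b - a)⁻¹ * L := by
  refine (norm_vec_fourierHat_le hab (h.memLp_forcing t ht) N).trans ?_
  gcongr
  exact h.l2_forcing_le t ht

lemma IsRegular.norm_vec_forcing_sub_le (hab : a < b) (h : IsRegular a b T β m V ψ M L) (N : ℕ)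
    {s t : ℝ} (hs : s ∈ Icc 0 T) (ht : t ∈ Icc 0 T) :
    ‖vec N (fun l ↦ fourierHat a b (forcing β V ψ t) l - fourierHat a b (forcing β V ψ s) l)‖ ≤
      √(b - a)⁻¹ * (L * |t - s|) := by
  have h1 := h.memLp_forcing t ht
  have h2 := h.memLp_forcing s hs
  rw [← vec_congr fun l _ ↦ fourierHat_sub (h1.intervalIntegrable_volΩ hab.le)
    (h2.intervalIntegrable_volΩ hab.le) l]
  refine (norm_vec_fourierHat_le hab (h1.sub h2) N).trans ?_
  gcongr
  exact h.l2_forcing_sub_le s hs t ht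

/-- Duhamel's formula on the Fourier side, with the forcing frozen at time `t`. -/
lemma IsRegular.norm_duhamel_le (hab : a < b) (hL : 0 ≤ L) (h : IsRegular a b T β m V ψ M L)
    (N : ℕ) {t τ : ℝ} (ht : 0 ≤ t) (hτ : 0 < τ) (htT : t + τ ≤ T) :
    ‖vec N (fun l ↦ fourierHat a b (ψ (t + τ)) l - phase a b τ l * fourierHat a b (ψ t) l +
      Complex.I * phase a b τ l * phaseIntegral a b τ l * fourierHat a b (forcing β V ψ t) l)‖ ≤
      √(b - a)⁻¹ * L * τ ^ 2 := by
  have htI : t ∈ Icc 0 T := ⟨ht, by linarith⟩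
  have hsI : ∀ s ∈ Icc 0 τ, t + s ∈ Icc 0 T := fun s hs ↦ ⟨by linarith [hs.1], by linarith [hs.2]⟩
  set c : ℝ → ℤ → ℂ := fun s l ↦ phase a b (-s) l * fourierHat a b (ψ (t + s)) l +
    Complex.I * phaseIntegral a b s l * fourierHat a b (forcing β V ψ t) l with hc
  set c' : ℝ → ℤ → ℂ := fun s l ↦ -Complex.I * phase a b (-s) l *
    (fourierHat a b (forcing β V ψ (t + s)) l - fourierHat a b (forcing β V ψ t) l) with hc'
  have h1 := norm_sub_le_of_hasDerivAt_Ioo (f := fun s ↦ vec N (c s))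
    (f' := fun s ↦ vec N (c' s)) (C := √(b - a)⁻¹ * (L * τ)) hτ (by positivity)
    (continuousOn_vec fun l ↦ ?_) (fun s hs ↦ hasDerivAt_vec fun l ↦ ?_) fun s hs ↦ ?_
  · refine le_trans ?_ (h1.trans_eq (by ring))
    rw [← vec_sub]
    refine (norm_vec_le_of_le 1 zero_le_one fun l _ ↦ ?_).trans_eq (one_mul _)
    rw [one_mul]
    have h2 : fourierHat a b (ψ (t + τ)) l - phase a b τ l * fourierHat a b (ψ t) l +
        Complex.I * phase a b τ l * phaseIntegral a b τ l *
          fourierHat a b (forcing β V ψ t) l = phase a b τ l * (c τ l - c 0 l) := by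
      have h3 : phaseIntegral a b 0 l = 0 := by simp [phaseIntegral]
      have h4 : phase a b (-0) l = 1 := by simp [phase]
      simp only [hc, h3, h4, add_zero]
      linear_combination (-fourierHat a b (ψ (t + τ)) l) * phase_mul_phase_neg (a := a) (b := b) τ l
    rw [h2, norm_mul, norm_phase, one_mul]
  · refine ContinuousOn.add (ContinuousOn.mul ?_ ?_) (ContinuousOn.mul (ContinuousOn.mul
      continuousOn_const ?_) continuousOn_const)
    · exact ((continuous_phase l).comp continuous_neg).continuousOn
    · exact (h.continuousOn l).comp (by fun_prop) hsI
    · exact fun s _ ↦ (hasDerivAt_phaseIntegral l s).continuousAt.continuousWithinAt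
  · have hd := h.hasDerivAt l (t + s) ⟨by linarith [hs.1], by linarith [hs.2]⟩
    have hd' : HasDerivAt (fun s ↦ fourierHat a b (ψ (t + s)) l) _ s :=
      HasDerivAt.comp_const_add t s hd
    refine (((hasDerivAt_phase_neg l s).mul hd').add
      (((hasDerivAt_phaseIntegral l s).const_mul Complex.I).mul_const _)).congr_deriv ?_
    simp only [hc']
    ring
  · refine (norm_vec_le_of_le 1 zero_le_one fun l _ ↦ ?_).trans
      ((one_mul _).trans_le ((h.norm_vec_forcing_sub_le hab N htI
        (hsI s (Ioo_subset_Icc_self hs))).trans ?_))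
    · simp only [hc']
      rw [norm_mul, norm_mul, norm_neg, Complex.norm_I, norm_phase]
      simp
    · rw [add_sub_cancel_left, abs_of_pos hs.1]
      gcongr
      exact hs.2.le

/-- The Fourier coefficients of the solution, corrected by a term of size `O(τ)`. -/
noncomputable def corrected (a b β : ℝ) (V : ℝ → ℝ → ℝ) (ψ : ℝ → ℝ → ℂ) (τ t : ℝ) (l : ℤ) : ℂ :=
  fourierHat a b (ψ t) l + corrector a b τ l * fourierHat a b (forcing β V ψ t) l

lemma IsRegular.norm_vec_corrected_sub_le (hab : a < b) (h : IsRegular a b T β m V ψ M L) {N : ℕ}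
    {t τ : ℝ} (ht : t ∈ Icc 0 T) (hτ : 0 ≤ τ)
    (hN : ∀ l ∈ freqs N, τ * freq a b l ^ 2 ≤ Real.pi) :
    ‖vec N (corrected a b β V ψ τ t) - vec N (fourierHat a b (ψ t))‖ ≤
      2 * τ * (√(b - a)⁻¹ * L) := by
  rw [← vec_sub]
  refine (norm_vec_le_of_le (2 * τ) (by positivity) fun l hl ↦ ?_).trans
    (mul_le_mul_of_nonneg_left (h.norm_vec_forcing_le hab N ht) (by positivity))
  rw [corrected, add_sub_cancel_left, norm_mul]
  gcongr
  exact norm_corrector_le hτ (hN l hl)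

/-- The local error of the scheme in time, measured with the corrected coefficients, is
`O(τ²)` without any spatial regularity of the forcing. -/
lemma IsRegular.norm_local_error_le (hab : a < b) (hL : 0 ≤ L) (h : IsRegular a b T β m V ψ M L)
    {N : ℕ} {t τ : ℝ} (ht : 0 ≤ t) (hτ : 0 < τ) (htT : t + τ ≤ T)
    (hN : ∀ l ∈ freqs N, τ * freq a b l ^ 2 ≤ Real.pi) :
    ‖vec N (fun l ↦ corrected a b β V ψ τ (t + τ) l - phase a b τ l *
      (corrected a b β V ψ τ t l - Complex.I * τ * fourierHat a b (forcing β V ψ t) l))‖ ≤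
      3 * √(b - a)⁻¹ * L * τ ^ 2 := by
  have h1 := h.norm_duhamel_le hab hL N ht hτ htT
  have h2 := h.norm_vec_forcing_sub_le hab N (s := t) (t := t + τ) ⟨ht, by linarith⟩
    ⟨by linarith, htT⟩
  rw [add_sub_cancel_left, abs_of_pos hτ] at h2
  have h3 := norm_vec_le_of_le (N := N)
    (c := fun l ↦ corrector a b τ l * (fourierHat a b (forcing β V ψ (t + τ)) l -
      fourierHat a b (forcing β V ψ t) l)) (d := fun l ↦ fourierHat a b (forcing β V ψ (t + τ)) l -
      fourierHat a b (forcing β V ψ t) l) (2 * τ) (by positivity) fun l hl ↦ by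
    rw [norm_mul]
    gcongr
    exact norm_corrector_le hτ.le (hN l hl)
  rw [vec_congr (d := fun l ↦ (fourierHat a b (ψ (t + τ)) l - phase a b τ l *
      fourierHat a b (ψ t) l + Complex.I * phase a b τ l * phaseIntegral a b τ l *
        fourierHat a b (forcing β V ψ t) l) +
      corrector a b τ l * (fourierHat a b (forcing β V ψ (t + τ)) l -
        fourierHat a b (forcing β V ψ t) l)) fun l hl ↦ ?_, vec_add]
  · refine (norm_add_le _ _).trans ((add_le_add h1 (h3.trans
      (mul_le_mul_of_nonneg_left h2 (by positivity)))).trans_eq (by ring))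
  · rw [corrected, corrected]
    linear_combination fourierHat a b (forcing β V ψ t) l * corrector_mul hτ.le (hN l hl)

end GPE

/-! ### Stability of one step -/

namespace GPE

variable {a b : ℝ}

/-- The increment `z (e^{-i τ β |z|²} - 1)` of the exact flow of the nonlinear part. -/
noncomputable def nonlinearIncrement (β τ : ℝ) (z : ℂ) : ℂ :=
  z * (Complex.exp (-(Complex.I * ((τ * (β * ‖z‖ ^ 2) : ℝ) : ℂ))) - 1)

lemma norm_exp_neg_I_mul_sub_le (x y : ℝ) :
    ‖Complex.exp (-(Complex.I * (x : ℂ))) - Complex.exp (-(Complex.I * (y : ℂ)))‖ ≤ |x - y| := by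
  have h1 : Complex.exp (-(Complex.I * (x : ℂ))) - Complex.exp (-(Complex.I * (y : ℂ))) =
      Complex.exp ((-y : ℝ) * Complex.I) * (Complex.exp (Complex.I * ((y - x : ℝ) : ℂ)) - 1) := by
    rw [mul_sub, ← Complex.exp_add, mul_one]
    congr 2 <;> push_cast <;> ring
  rw [h1, norm_mul, Complex.norm_exp_ofReal_mul_I, one_mul, abs_sub_comm]
  exact Real.norm_exp_I_mul_ofReal_sub_one_le

lemma norm_exp_neg_I_mul_sub_one_add_le (x : ℝ) :
    ‖Complex.exp (-(Complex.I * (x : ℂ))) - 1 + Complex.I * x‖ ≤ 2 * x ^ 2 := by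
  have hx : ‖-(Complex.I * (x : ℂ))‖ = |x| := by simp
  rcases le_or_gt |x| 1 with h | h
  · have := Complex.norm_exp_sub_one_sub_id_le (x := -(Complex.I * (x : ℂ))) (by rwa [hx])
    rw [hx, sq_abs, sub_neg_eq_add] at this
    nlinarith [sq_nonneg x]
  · have h1 := norm_exp_neg_I_mul_sub_le x 0
    simp only [Complex.ofReal_zero, mul_zero, neg_zero, Complex.exp_zero, sub_zero] at h1
    have h2 := norm_add_le (Complex.exp (-(Complex.I * (x : ℂ))) - 1) (Complex.I * x)
    rw [← norm_neg (Complex.I * (x : ℂ)), hx] at h2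
    have := sq_abs x
    nlinarith

variable {β τ K : ℝ} {z w : ℂ}

lemma norm_nonlinearIncrement_le (hτ : 0 ≤ τ) (hz : ‖z‖ ≤ K) :
    ‖nonlinearIncrement β τ z‖ ≤ |β| * K ^ 2 * K * τ := by
  have hK : 0 ≤ K := (norm_nonneg z).trans hz
  have h1 := norm_exp_neg_I_mul_sub_le (τ * (β * ‖z‖ ^ 2)) 0
  simp only [Complex.ofReal_zero, mul_zero, neg_zero, Complex.exp_zero, sub_zero] at h1
  rw [abs_mul, abs_mul, abs_of_nonneg hτ, abs_of_nonneg (by positivity : 0 ≤ ‖z‖ ^ 2)] at h1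
  rw [nonlinearIncrement, norm_mul]
  calc _ ≤ K * (τ * (|β| * K ^ 2)) := by
        gcongr
        refine h1.trans ?_
        gcongr
    _ = _ := by ring

lemma norm_nonlinearIncrement_sub_le (hτ : 0 ≤ τ) (hz : ‖z‖ ≤ K) (hw : ‖w‖ ≤ K) :
    ‖nonlinearIncrement β τ z - nonlinearIncrement β τ w‖ ≤
      3 * |β| * K ^ 2 * τ * ‖z - w‖ := by
  have hK : 0 ≤ K := (norm_nonneg z).trans hz
  set e : ℂ → ℂ := fun z ↦ Complex.exp (-(Complex.I * ((τ * (β * ‖z‖ ^ 2) : ℝ) : ℂ))) with he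
  have h0 : nonlinearIncrement β τ z - nonlinearIncrement β τ w =
      (z - w) * (e z - 1) + w * (e z - e w) := by
    simp only [nonlinearIncrement, he]; ring
  have h1 : ‖e z - 1‖ ≤ τ * (|β| * K ^ 2) := by
    have h1 := norm_exp_neg_I_mul_sub_le (τ * (β * ‖z‖ ^ 2)) 0
    simp only [Complex.ofReal_zero, mul_zero, neg_zero, Complex.exp_zero, sub_zero] at h1
    rw [abs_mul, abs_mul, abs_of_nonneg hτ, abs_of_nonneg (by positivity : 0 ≤ ‖z‖ ^ 2)] at h1
    refine h1.trans ?_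
    gcongr
  have h2 : ‖e z - e w‖ ≤ τ * (|β| * (2 * K * ‖z - w‖)) := by
    refine (norm_exp_neg_I_mul_sub_le _ _).trans ?_
    rw [← mul_sub, ← mul_sub, abs_mul, abs_mul, abs_of_nonneg hτ, sq_sub_sq, abs_mul]
    have h3 : |‖z‖ + ‖w‖| ≤ 2 * K := by rw [abs_of_nonneg (by positivity)]; linarith
    have h4 : |‖z‖ - ‖w‖| ≤ ‖z - w‖ := abs_norm_sub_norm_le z w
    gcongr
  rw [h0]
  refine (norm_add_le _ _).trans ?_
  rw [norm_mul, norm_mul]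
  calc _ ≤ ‖z - w‖ * (τ * (|β| * K ^ 2)) + K * (τ * (|β| * (2 * K * ‖z - w‖))) := by gcongr
    _ = _ := by ring

lemma norm_nonlinearIncrement_add_cubic_le (hz : ‖z‖ ≤ K) :
    ‖nonlinearIncrement β τ z + Complex.I * τ * cubic β z‖ ≤ 2 * K * (|β| * K ^ 2) ^ 2 * τ ^ 2 := by
  have hK : 0 ≤ K := (norm_nonneg z).trans hz
  have h0 : nonlinearIncrement β τ z + Complex.I * τ * cubic β z =
      z * (Complex.exp (-(Complex.I * ((τ * (β * ‖z‖ ^ 2) : ℝ) : ℂ))) - 1 +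
        Complex.I * ((τ * (β * ‖z‖ ^ 2) : ℝ) : ℂ)) := by
    rw [nonlinearIncrement, cubic]; push_cast; ring
  rw [h0, norm_mul]
  have h1 := norm_exp_neg_I_mul_sub_one_add_le (τ * (β * ‖z‖ ^ 2))
  have h2 : (τ * (β * ‖z‖ ^ 2)) ^ 2 = τ ^ 2 * (|β| * ‖z‖ ^ 2) ^ 2 := by
    rw [mul_pow, mul_pow, mul_pow, sq_abs]
  rw [h2] at h1
  calc _ ≤ K * (2 * (τ ^ 2 * (|β| * K ^ 2) ^ 2)) := by
        gcongr
        refine h1.trans ?_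
        gcongr
    _ = _ := by ring

/-- The cubic nonlinearity preserves `H^m_per`, `m ≥ 1`. -/
lemma exists_perBound_cubic (hab : a ≤ b) (m : ℕ) (β M : ℝ) : ∃ M', ∀ f : ℝ → ℂ,
    PerBound a b M (m + 1) f → PerBound a b M' (m + 1) (fun x ↦ cubic β (f x)) := by
  obtain ⟨C, hC, H⟩ := PerBound.exists_mul hab m
  refine ⟨‖(β : ℂ)‖ * (C * (C * M * M) * M), fun f hf ↦ ?_⟩
  have h1 := (H _ _ _ _ (H _ _ _ _ hf hf.conj) hf).const_mul (β : ℂ)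
  refine h1.congr hab fun x _ ↦ ?_
  simp only [cubic, Complex.mul_conj']
  push_cast
  ring

variable {V : ℝ → ℝ → ℝ} {ψ : ℝ → ℝ → ℂ} {N : ℕ}

/-- The grid values after the nonlinear substep. -/
noncomputable def nonlinearStep (β τ : ℝ) (v : Fin (N + 1) → ℂ) (j : Fin (N + 1)) : ℂ :=
  v j + nonlinearIncrement β τ (v j)

lemma discreteHat_schemeStep (hab : a < b) (hN : 0 < N) {T M L : ℝ} {m : ℕ}
    (h : IsRegular a b T β m V ψ M L) {t : ℝ} (ht : t ∈ Icc 0 T) (v : Fin (N + 1) → ℂ) {l : ℤ}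
    (hl : l ∈ freqs N) :
    discreteHat a b N (schemeStep a b β V N τ t v) l = phase a b τ l *
      (discreteHat a b N (nonlinearStep β τ v) l - Complex.I * τ * fourierHat a b
        (fun x ↦ (V t x : ℂ) * interp a b N (nonlinearStep β τ v) x) l) := by
  set u := nonlinearStep β τ v with hu
  have h1 : (fun j ↦ v j * Complex.exp (-(Complex.I * ((τ * (β * ‖v j‖ ^ 2) : ℝ) : ℂ)))) = u := by
    ext j
    simp only [hu, nonlinearStep, nonlinearIncrement]
    ring
  have hI : interp a b N u = trig a b N (discreteHat a b N u) := rfl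
  have hIL : MemLp (interp a b N u) 2 (volΩ a b) := hI ▸ memLp_trig N _
  have hVL := memLp_ofReal_mul (h.aestronglyMeasurable t ht) (h.ae_bound t ht) hIL
  have h2 : schemeStep a b β V N τ t v = fun j : Fin (N + 1) ↦ trig a b N
      (fun l ↦ phase a b τ l * fourierHat a b (potentialStep a b β V N τ t v) l)
      (node a b N j) := rfl
  have h3 : potentialStep a b β V N τ t v = fun x ↦ interp a b N u x -
      Complex.I * τ * ((V t x : ℂ) * interp a b N u x) := by
    ext x
    rw [potentialStep, h1]
    ring
  rw [h2, discreteHat_trig hab hN _ hl, h3, fourierHat_sub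
    (hIL.intervalIntegrable_volΩ hab.le) ((hVL.const_mul _).intervalIntegrable_volΩ hab.le),
    fourierHat_const_mul]
  congr 2
  rw [hI, fourierHat_trig hab, if_pos hl]

/-- One step of the scheme: if the grid values are bounded by `K`, the error in the corrected
coefficients grows at most by the factor `1 + C τ`, up to the local error. -/
lemma exists_step_bound (hab : a < b) {T M L : ℝ} {m : ℕ} (hM : 0 ≤ M) (hL : 0 ≤ L)
    (h : IsRegular a b T β m V ψ M L) (hMK : M ≤ K) :
    ∃ C, 0 ≤ C ∧ ∀ N : ℕ, 0 < N → Even N → ∀ τ t : ℝ, 0 < τ → 0 ≤ t → t + τ ≤ T →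
      (∀ l ∈ freqs N, τ * freq a b l ^ 2 ≤ Real.pi) → ∀ v : Fin (N + 1) → ℂ,
      (∀ j : Fin N, ‖v j.castSucc‖ ≤ K) →
      ‖vec N (corrected a b β V ψ τ (t + τ)) -
          vec N (discreteHat a b N (schemeStep a b β V N τ t v))‖ ≤
        (1 + C * τ) * ‖vec N (corrected a b β V ψ τ t) - vec N (discreteHat a b N v)‖ +
          C * τ * (τ + mesh a b N ^ (m + 1)) := by
  have hba : 0 < b - a := by linarith
  have hK : 0 ≤ K := hM.trans hMK
  obtain ⟨Mc, hMc⟩ := exists_perBound_cubic hab.le m β M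
  set s := √(b - a)⁻¹ with hs
  have hs0 : 0 ≤ s := Real.sqrt_nonneg _
  set B := |β| * K ^ 2 with hB
  have hB0 : 0 ≤ B := by positivity
  -- the constants of the contributions of `‖e‖`, of `τ` and of `h ^ (m + 1)`
  set C1 := 3 * B + M with hC1
  set C2 := 3 * s * L + 2 * K * B ^ 2 + 3 * B * (2 * (s * L)) + M * (2 * (s * L) + B * K) with hC2
  set C3 := 3 * B * (2 * s * M) + 2 * s * |Mc| + s * M * M with hC3
  have hC10 : 0 ≤ C1 := by positivity
  have hC20 : 0 ≤ C2 := by positivity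
  have hC30 : 0 ≤ C3 := by positivity
  refine ⟨C1 + C2 + C3, by positivity, fun N hN hN2 τ t hτ ht htT hfr v hv ↦ ?_⟩
  have htI : t ∈ Icc 0 T := ⟨ht, by linarith⟩
  have hh := mesh_pos hab hN
  set H := mesh a b N ^ (m + 1) with hH
  have hH0 : 0 ≤ H := by positivity
  have hper := h.perBound t htI
  have hψL := hper.memLp hab.le
  set p := vec N (fourierHat a b (ψ t)) with hp
  set q := vec N (discreteHat a b N v) with hq
  set e := vec N (corrected a b β V ψ τ t) - q with he
  set ψn : Fin (N + 1) → ℂ := fun j ↦ ψ t (node a b N j) with hψn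
  have hψK : ∀ j : Fin N, ‖ψn j.castSucc‖ ≤ K := fun j ↦
    (hper.norm_le (node_mem_Icc hab hN _)).trans hMK
  -- distances of the coefficients
  have d1 := h.norm_vec_corrected_sub_le hab htI hτ.le hfr
  rw [← hp] at d1
  have d2 : ‖p - q‖ ≤ ‖e‖ + 2 * τ * (s * L) := by
    have : p - q = e - (vec N (corrected a b β V ψ τ t) - p) := by rw [he]; abel
    rw [this]
    exact (norm_sub_le _ _).trans (by gcongr)
  have d3 := hper.norm_vec_fourierHat_sub_discreteHat_le hab hN hN2
  rw [← hp] at d3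
  have d4 : ‖vec N (discreteHat a b N fun j ↦ v j - ψn j)‖ ≤
      ‖e‖ + 2 * τ * (s * L) + 2 * s * M * H := by
    have : vec N (discreteHat a b N fun j ↦ v j - ψn j) =
        (p - vec N (discreteHat a b N ψn)) - (p - q) := by
      rw [vec_congr fun l _ ↦ discreteHat_sub v ψn l, vec_sub, ← hq]
      abel
    rw [this]
    refine (norm_sub_le _ _).trans ?_
    linarith
  -- the nonlinear part
  have n1 : ‖vec N (discreteHat a b N fun j ↦ nonlinearIncrement β τ (v j) -
      nonlinearIncrement β τ (ψn j))‖ ≤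
      3 * B * τ * (‖e‖ + 2 * τ * (s * L) + 2 * s * M * H) := by
    refine (norm_vec_discreteHat_le_of_le hab hN hN2 (r := 3 * B * τ) (by positivity)
      fun j ↦ ?_).trans (mul_le_mul_of_nonneg_left d4 (by positivity))
    rw [hB, ← mul_assoc]
    exact norm_nonlinearIncrement_sub_le hτ.le (hv j) (hψK j)
  have n2 : ‖vec N (discreteHat a b N fun j ↦ nonlinearIncrement β τ (ψn j) +
      Complex.I * τ * cubic β (ψn j))‖ ≤ 2 * K * B ^ 2 * τ ^ 2 :=
    norm_vec_discreteHat_le_of_bound hab hN hN2 (by positivity) fun j ↦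
      norm_nonlinearIncrement_add_cubic_le (hψK j)
  have n3 : ‖vec N (fourierHat a b fun x ↦ cubic β (ψ t x)) -
      vec N (discreteHat a b N fun j ↦ cubic β (ψn j))‖ ≤ 2 * s * |Mc| * H :=
    ((hMc _ hper).norm_vec_fourierHat_sub_discreteHat_le hab hN hN2).trans (by
      gcongr
      exact le_abs_self _)
  have n4 : ‖vec N (discreteHat a b N fun j ↦ nonlinearIncrement β τ (v j))‖ ≤ B * K * τ :=
    norm_vec_discreteHat_le_of_bound hab hN hN2 (by positivity) fun j ↦
      norm_nonlinearIncrement_le hτ.le (hv j)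
  -- the potential part
  set u := nonlinearStep β τ v with hu
  have hu' : vec N (discreteHat a b N u) =
      q + vec N (discreteHat a b N fun j ↦ nonlinearIncrement β τ (v j)) := by
    rw [hq, ← vec_add]
    exact vec_congr fun l _ ↦ discreteHat_add v (fun j ↦ nonlinearIncrement β τ (v j)) l
  have hIL : MemLp (interp a b N u) 2 (volΩ a b) := memLp_trig N (discreteHat a b N u)
  have hdL : MemLp (fun x ↦ ψ t x - interp a b N u x) 2 (volΩ a b) := hψL.sub hIL
  have v1 : l2 a b (fun x ↦ ψ t x - interp a b N u x) ≤
      H * M + √(b - a) * (‖e‖ + 2 * τ * (s * L) + B * K * τ) := by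
    refine (hper.l2_sub_trig_le hab hN hN2 (discreteHat a b N u)).trans ?_
    have hle : mesh a b N / Real.pi ≤ mesh a b N := by
      rw [div_le_iff₀ Real.pi_pos]
      nlinarith [Real.pi_gt_three]
    have hpos : 0 ≤ mesh a b N / Real.pi := div_nonneg hh.le Real.pi_pos.le
    have g1 : (mesh a b N / Real.pi) ^ (m + 1) * M ≤ H * M := by
      rw [hH]
      gcongr
    have g2 : ‖p - vec N (discreteHat a b N u)‖ ≤ ‖e‖ + 2 * τ * (s * L) + B * K * τ := by
      rw [hu', ← sub_sub]
      exact (norm_sub_le _ _).trans (add_le_add d2 n4)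
    exact add_le_add g1 (mul_le_mul_of_nonneg_left g2 (Real.sqrt_nonneg _))
  have hss : s * √(b - a) = 1 := by
    rw [hs, ← Real.sqrt_mul (by positivity), inv_mul_cancel₀ hba.ne', Real.sqrt_one]
  have v2 : ‖vec N (fourierHat a b fun x ↦ (V t x : ℂ) * (ψ t x - interp a b N u x))‖ ≤
      s * M * M * H + M * (‖e‖ + 2 * τ * (s * L) + B * K * τ) := by
    have hVm := h.aestronglyMeasurable t htI
    have hVb := h.ae_bound t htI
    refine (norm_vec_fourierHat_le hab (memLp_ofReal_mul hVm hVb hdL) N).trans ?_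
    rw [← hs]
    calc _ ≤ s * (M * (H * M + √(b - a) * (‖e‖ + 2 * τ * (s * L) + B * K * τ))) := by
          gcongr
          refine (l2_ofReal_mul_le hM hVm hVb hdL).trans ?_
          gcongr
      _ = s * M * M * H + (s * √(b - a)) * (M * (‖e‖ + 2 * τ * (s * L) + B * K * τ)) := by ring
      _ = _ := by rw [hss, one_mul]
  -- combination
  have hloc := h.norm_local_error_le hab hL ht hτ htT hfr
  set R := vec N (fun l ↦ corrected a b β V ψ τ (t + τ) l - phase a b τ l *
      (corrected a b β V ψ τ t l - Complex.I * τ * fourierHat a b (forcing β V ψ t) l)) with hR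
  set E1 := vec N (discreteHat a b N fun j ↦ nonlinearIncrement β τ (v j) -
      nonlinearIncrement β τ (ψn j)) with hE1
  set E2 := vec N (discreteHat a b N fun j ↦ nonlinearIncrement β τ (ψn j) +
      Complex.I * τ * cubic β (ψn j)) with hE2
  set E3 := vec N (fourierHat a b fun x ↦ cubic β (ψ t x)) -
      vec N (discreteHat a b N fun j ↦ cubic β (ψn j)) with hE3
  set E4 := vec N (fourierHat a b fun x ↦ (V t x : ℂ) * (ψ t x - interp a b N u x)) with hE4
  set Z : ℤ → ℂ := fun l ↦ corrected a b β V ψ τ t l -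
    Complex.I * τ * fourierHat a b (forcing β V ψ t) l -
    (discreteHat a b N u l - Complex.I * τ * fourierHat a b
        (fun x ↦ (V t x : ℂ) * interp a b N u x) l) with hZ
  have hsplit : vec N (corrected a b β V ψ τ (t + τ)) -
      vec N (discreteHat a b N (schemeStep a b β V N τ t v)) =
      R + vec N (fun l ↦ phase a b τ l * Z l) := by
    rw [hR, ← vec_add, ← vec_sub]
    refine vec_congr fun l hl ↦ ?_
    rw [discreteHat_schemeStep hab hN h htI v hl]
    ring
  have hZe : vec N Z = e - (E1 + E2 + (Complex.I * τ) • E3) - (Complex.I * τ) • E4 := by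
    rw [he, hq, hE1, hE2, hE3, hE4, ← vec_sub, ← vec_sub, ← vec_add, ← vec_const_mul,
      ← vec_const_mul, ← vec_add, ← vec_sub, ← vec_sub]
    refine vec_congr fun l hl ↦ ?_
    have hVψ := memLp_ofReal_mul (h.aestronglyMeasurable t htI) (h.ae_bound t htI) hψL
    have hVI := memLp_ofReal_mul (h.aestronglyMeasurable t htI) (h.ae_bound t htI) hIL
    have f1 : fourierHat a b (forcing β V ψ t) l = fourierHat a b (fun x ↦ (V t x : ℂ) * ψ t x) l +
        fourierHat a b (fun x ↦ cubic β (ψ t x)) l :=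
      fourierHat_add (hVψ.intervalIntegrable_volΩ hab.le)
        (((hMc _ hper).memLp hab.le).intervalIntegrable_volΩ hab.le) l
    have f2 : fourierHat a b (fun x ↦ (V t x : ℂ) * (ψ t x - interp a b N u x)) l =
        fourierHat a b (fun x ↦ (V t x : ℂ) * ψ t x) l -
          fourierHat a b (fun x ↦ (V t x : ℂ) * interp a b N u x) l := by
      rw [← fourierHat_sub (hVψ.intervalIntegrable_volΩ hab.le)
        (hVI.intervalIntegrable_volΩ hab.le)]
      simp only [mul_sub]
    have f3 : discreteHat a b N u l = discreteHat a b N v l +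
        discreteHat a b N (fun j ↦ nonlinearIncrement β τ (v j)) l :=
      discreteHat_add v _ l
    rw [hZ]
    simp only
    rw [f1, f2, f3, discreteHat_sub, discreteHat_add, discreteHat_const_mul]
    ring
  have hZn : ‖vec N (fun l ↦ phase a b τ l * Z l)‖ ≤ ‖vec N Z‖ := by
    refine (norm_vec_le_of_le 1 zero_le_one fun l _ ↦ ?_).trans_eq (one_mul _)
    rw [norm_mul, norm_phase]
  have hIτ : ‖(Complex.I * τ : ℂ)‖ = τ := by
    rw [norm_mul, Complex.norm_I, Complex.norm_real, Real.norm_eq_abs, abs_of_pos hτ, one_mul]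
  have hZ2 : ‖vec N Z‖ ≤ ‖e‖ + (‖E1‖ + ‖E2‖ + τ * ‖E3‖) + τ * ‖E4‖ := by
    rw [hZe]
    refine (norm_sub_le _ _).trans ?_
    rw [norm_smul, hIτ]
    gcongr
    refine (norm_sub_le _ _).trans ?_
    gcongr
    refine (norm_add₃_le).trans ?_
    rw [norm_smul, hIτ]
  rw [hsplit]
  have hn3 := mul_le_mul_of_nonneg_left n3 hτ.le
  have hv2 := mul_le_mul_of_nonneg_left v2 hτ.le
  have hfin : ‖R + vec N (fun l ↦ phase a b τ l * Z l)‖ ≤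
      ‖e‖ + (C1 * τ * ‖e‖ + C2 * τ * τ + C3 * τ * H) := by
    refine (norm_add_le _ _).trans ?_
    rw [hC1, hC2, hC3]
    linarith
  have he0 := norm_nonneg e
  have g1 : 0 ≤ (C2 + C3) * τ * ‖e‖ := by positivity
  have g2 : 0 ≤ (C1 + C3) * τ * τ := by positivity
  have g3 : 0 ≤ (C1 + C2) * τ * H := by positivity
  linarith

end GPE

/-! ### Convergence -/

namespace GPE

variable {a b T β M L : ℝ} {m : ℕ} {V : ℝ → ℝ → ℝ} {ψ : ℝ → ℝ → ℂ}

lemma mul_freq_sq_le_pi (hab : a < b) {N : ℕ} (hN : 0 < N) (hN2 : Even N) {τ : ℝ}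
    (hτh : τ ≤ mesh a b N ^ 2 / Real.pi) {l : ℤ} (hl : l ∈ freqs N) :
    τ * freq a b l ^ 2 ≤ Real.pi := by
  have hh := mesh_pos hab hN
  have hpi := Real.pi_pos
  have h1 := abs_freq_le_of_mem hab hN hN2 hl
  calc τ * freq a b l ^ 2 = τ * |freq a b l| ^ 2 := by rw [sq_abs]
    _ ≤ mesh a b N ^ 2 / Real.pi * (Real.pi / mesh a b N) ^ 2 := by gcongr
    _ = Real.pi := by field_simp

/-- A discrete Gronwall inequality in which the recursion is only known as long as the resulting
bound holds. -/
lemma discrete_gronwall {e : ℕ → ℝ} {C C₀ τ δ : ℝ} (hC : 0 ≤ C) (hC₀ : 0 ≤ C₀) (hτ : 0 ≤ τ)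
    (hδ : 0 ≤ δ) (h0 : e 0 ≤ C₀ * δ)
    (hs : ∀ n : ℕ, n * τ + τ ≤ T → e n ≤ Real.exp (C * T) * (C₀ + C * T) * δ →
      e (n + 1) ≤ (1 + C * τ) * e n + C * τ * δ) (n : ℕ) (hn : n * τ ≤ T) :
    e n ≤ Real.exp (C * T) * (C₀ + C * T) * δ := by
  have hA : ∀ n : ℕ, (n : ℝ) * τ ≤ T →
      (1 + C * τ) ^ n * (C₀ + C * (n * τ)) ≤ Real.exp (C * T) * (C₀ + C * T) := by
    intro n hn
    have h1 : (1 + C * τ) ^ n ≤ Real.exp (C * T) := by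
      calc (1 + C * τ) ^ n ≤ Real.exp (C * τ) ^ n := by
            gcongr
            linarith [Real.add_one_le_exp (C * τ)]
        _ = Real.exp (C * (n * τ)) := by rw [← Real.exp_nat_mul]; congr 1; ring
        _ ≤ _ := by gcongr
    gcongr
  suffices ∀ n : ℕ, (n : ℝ) * τ ≤ T → e n ≤ (1 + C * τ) ^ n * (C₀ + C * (n * τ)) * δ from
    (this n hn).trans (mul_le_mul_of_nonneg_right (hA n hn) hδ)
  intro n
  induction n with
  | zero => intro _; simpa using h0
  | succ n ih =>
    intro hn
    push_cast at hn
    have hn1 : n * τ + τ ≤ T := by linarith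
    have hn' : n * τ ≤ T := by linarith
    have h1 := hs n hn1 ((ih hn').trans (mul_le_mul_of_nonneg_right (hA n hn') hδ))
    have h2 := mul_le_mul_of_nonneg_left (ih hn') (by positivity : 0 ≤ 1 + C * τ)
    have h3 : C * τ * δ ≤ (1 + C * τ) ^ (n + 1) * (C * τ * δ) := by
      refine le_mul_of_one_le_left (by positivity) (one_le_pow₀ ?_)
      linarith [mul_nonneg hC hτ]
    refine (h1.trans (add_le_add h2 h3)).trans_eq ?_
    push_cast
    ring

/-- An `L²` error of size `O(h²)` implies, by the inverse inequality, that the grid values stay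
close to those of the solution. -/
lemma PerBound.norm_le_of_norm_vec_sub_le (hab : a < b) (hm : 1 ≤ m) {f : ℝ → ℂ}
    (hf : PerBound a b M (m + 1) f) {N : ℕ} (hN : 0 < N) (hN2 : Even N) (hN1 : mesh a b N ≤ 1)
    {A : ℝ} (hA : 0 ≤ A) (hAN : mesh a b N * (√(b - a) * (A + 2 * √(b - a)⁻¹ * M)) ≤ 1)
    {v : Fin (N + 1) → ℂ}
    (hv : ‖vec N (fourierHat a b f) - vec N (discreteHat a b N v)‖ ≤ A * mesh a b N ^ 2)
    (j : Fin N) : ‖v j.castSucc‖ ≤ M + 1 := by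
  have hM := hf.nonneg
  have hh := mesh_pos hab hN
  have hNmesh : (N : ℝ) * mesh a b N = b - a := by
    have : (N : ℝ) ≠ 0 := by exact_mod_cast hN.ne'
    rw [mesh]; field_simp
  have h1 := hf.norm_vec_fourierHat_sub_discreteHat_le hab hN hN2
  have h2 : mesh a b N ^ (m + 1) ≤ mesh a b N ^ 2 := pow_le_pow_of_le_one hh.le hN1 (by omega)
  have h3 : vec N (discreteHat a b N fun j : Fin (N + 1) ↦ v j - f (node a b N j)) =
      (vec N (fourierHat a b f) -
        vec N (discreteHat a b N fun j : Fin (N + 1) ↦ f (node a b N j))) -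
      (vec N (fourierHat a b f) - vec N (discreteHat a b N v)) := by
    rw [vec_congr fun l _ ↦ discreteHat_sub v _ l, vec_sub]
    abel
  have h4 : ‖vec N (discreteHat a b N fun j : Fin (N + 1) ↦ v j - f (node a b N j))‖ ≤
      (A + 2 * √(b - a)⁻¹ * M) * mesh a b N ^ 2 := by
    rw [h3]
    refine (norm_sub_le _ _).trans ((add_le_add h1 hv).trans ?_)
    have := mul_le_mul_of_nonneg_left h2 (by positivity : 0 ≤ 2 * √(b - a)⁻¹ * M)
    linarith
  have h5 := norm_le_sqrt_mul_norm_vec hab hN hN2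
    (fun j : Fin (N + 1) ↦ v j - f (node a b N j)) j
  have h6 : √N * mesh a b N ≤ √(b - a) := by
    refine Real.le_sqrt_of_sq_le ?_
    rw [mul_pow, Real.sq_sqrt (by positivity), ← hNmesh, sq, ← mul_assoc]
    exact mul_le_of_le_one_right (by positivity) hN1
  have h7 : ‖v j.castSucc - f (node a b N j.castSucc)‖ ≤ 1 := by
    refine h5.trans ?_
    calc _ ≤ √N * ((A + 2 * √(b - a)⁻¹ * M) * mesh a b N ^ 2) := by gcongr
      _ = √N * mesh a b N * ((A + 2 * √(b - a)⁻¹ * M) * mesh a b N) := by ring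
      _ ≤ √(b - a) * ((A + 2 * √(b - a)⁻¹ * M) * mesh a b N) := by gcongr
      _ ≤ 1 := by linarith
  have h8 := norm_le_norm_add_norm_sub' (v j.castSucc) (f (node a b N j.castSucc))
  have h9 := hf.norm_le (node_mem_Icc hab hN j.castSucc)
  linarith

/-- The error in the Fourier coefficients. The error bound at time `t_n` gives, through the inverse
inequality and the step size restriction, the bound on the grid values that the next step needs. -/
lemma exists_coefficient_error_bound (hab : a < b) (hT : 0 < T) (hm : 1 ≤ m) {ψ₀ : ℝ → ℂ}
    (hψ₀ : ∀ x ∈ Icc a b, ψ 0 x = ψ₀ x) (hM : 0 ≤ M) (hL : 0 ≤ L)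
    (h : IsRegular a b T β m V ψ M L) :
    ∃ h₀ : ℝ, 0 < h₀ ∧ h₀ ≤ 1 ∧ ∃ A : ℝ, 0 ≤ A ∧ ∀ N : ℕ, 0 < N → Even N → mesh a b N < h₀ →
      ∀ τ : ℝ, 0 < τ → τ ≤ mesh a b N ^ 2 / Real.pi → ∀ n : ℕ, (n : ℝ) * τ ≤ T →
        ‖vec N (fourierHat a b (ψ (n * τ))) -
          vec N (discreteHat a b N (scheme a b β V ψ₀ N τ n))‖ ≤
            A * (τ + mesh a b N ^ (m + 1)) := by
  have hba : 0 < b - a := by linarith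
  obtain ⟨C, hC, hstep⟩ := exists_step_bound (K := M + 1) hab hM hL h (by linarith)
  set s := √(b - a)⁻¹ with hs
  have hs0 : 0 ≤ s := Real.sqrt_nonneg _
  set C₀ := 2 * (s * L) + 2 * s * M with hC₀
  have hC₀0 : 0 ≤ C₀ := by positivity
  set A := Real.exp (C * T) * (C₀ + C * T) with hA
  have hA0 : 0 ≤ A := by positivity
  set D := √(b - a) * (2 * (A + C₀) + 2 * s * M) with hD
  have hD0 : 0 ≤ D := by positivity
  refine ⟨min 1 (1 / (D + 1)), by positivity, min_le_left _ _, A + C₀,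
    by positivity, fun N hN hN2 hNh τ hτ hτh ↦ ?_⟩
  have hh := mesh_pos hab hN
  have hh1 : mesh a b N ≤ 1 := (hNh.trans_le (min_le_left _ _)).le
  have hh2 : mesh a b N * D ≤ 1 := by
    have := (hNh.trans_le (min_le_right _ _)).le
    rw [le_div_iff₀ (by positivity)] at this
    linarith
  have hfr : ∀ l ∈ freqs N, τ * freq a b l ^ 2 ≤ Real.pi := fun l hl ↦
    mul_freq_sq_le_pi hab hN hN2 hτh hl
  set H := mesh a b N ^ (m + 1) with hH
  have hH0 : 0 ≤ H := by positivity
  have hδ : 0 ≤ τ + H := by positivity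
  have hδ2 : τ + H ≤ 2 * mesh a b N ^ 2 := by
    have hτ2 : τ ≤ mesh a b N ^ 2 := hτh.trans (div_le_self (by positivity)
      (by linarith [Real.pi_gt_three]))
    have hH2 : H ≤ mesh a b N ^ 2 := pow_le_pow_of_le_one hh.le hh1 (by omega)
    linarith
  have hC₀1 : 2 * τ * (s * L) + 2 * s * M * H ≤ C₀ * (τ + H) := by
    have g1 : 0 ≤ 2 * s * M * τ := by positivity
    have g2 : 0 ≤ 2 * (s * L) * H := by positivity
    rw [hC₀]
    linarith
  have hsMH : 0 ≤ 2 * s * M * H := by positivity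
  -- the error in the corrected coefficients
  set e : ℕ → EuclideanSpace ℂ (freqs N) := fun n ↦ vec N (corrected a b β V ψ τ (n * τ)) -
    vec N (discreteHat a b N (scheme a b β V ψ₀ N τ n)) with he
  have hcorr : ∀ n : ℕ, (n : ℝ) * τ ≤ T → ‖e n‖ ≤ A * (τ + H) →
      ‖vec N (fourierHat a b (ψ (n * τ))) -
        vec N (discreteHat a b N (scheme a b β V ψ₀ N τ n))‖ ≤ (A + C₀) * (τ + H) := by
    intro n hn hen
    have h1 := h.norm_vec_corrected_sub_le hab (t := n * τ) ⟨by positivity, hn⟩ hτ.le hfr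
    have h2 : vec N (fourierHat a b (ψ (n * τ))) -
        vec N (discreteHat a b N (scheme a b β V ψ₀ N τ n)) =
        e n - (vec N (corrected a b β V ψ τ (n * τ)) - vec N (fourierHat a b (ψ (n * τ)))) := by
      simp only [he]; abel
    rw [h2]
    refine (norm_sub_le _ _).trans ((add_le_add hen h1).trans ?_)
    linarith
  intro n hn
  refine hcorr n hn (discrete_gronwall (e := fun n ↦ ‖e n‖) hC hC₀0 hτ.le hδ ?_
    (fun n hn1 hen ↦ ?_) n hn)
  · have h1 := h.norm_vec_corrected_sub_le hab (N := N) (t := 0) (left_mem_Icc.2 hT.le) hτ.le hfr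
    have h2 := (h.perBound 0 (left_mem_Icc.2 hT.le)).norm_vec_fourierHat_sub_discreteHat_le
      hab hN hN2
    have h3 : scheme a b β V ψ₀ N τ 0 = fun j : Fin (N + 1) ↦ ψ 0 (node a b N j) := by
      ext j
      rw [scheme, hψ₀ _ (node_mem_Icc hab hN j)]
    have h4 : e 0 = (vec N (corrected a b β V ψ τ 0) - vec N (fourierHat a b (ψ 0))) +
        (vec N (fourierHat a b (ψ 0)) -
          vec N (discreteHat a b N fun j : Fin (N + 1) ↦ ψ 0 (node a b N j))) := by
      simp only [he, h3, Nat.cast_zero, zero_mul]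
      abel
    rw [h4]
    exact (norm_add_le _ _).trans ((add_le_add h1 h2).trans hC₀1)
  · have hn' : (n : ℝ) * τ ≤ T := by linarith
    have hbd := (h.perBound _ ⟨by positivity, hn'⟩).norm_le_of_norm_vec_sub_le hab hm hN hN2 hh1
      (A := 2 * (A + C₀)) (by positivity) hh2 ((hcorr n hn' hen).trans (by
        have := mul_le_mul_of_nonneg_left hδ2 (by positivity : 0 ≤ A + C₀)
        linarith))
    have h1 := hstep N hN hN2 τ (n * τ) hτ (by positivity) hn1 hfr _ hbd
    have h2 : e (n + 1) = vec N (corrected a b β V ψ τ (n * τ + τ)) -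
        vec N (discreteHat a b N (schemeStep a b β V N τ (n * τ)
          (scheme a b β V ψ₀ N τ n))) := by
      have : (((n + 1 : ℕ) : ℝ)) * τ = n * τ + τ := by push_cast; ring
      simp only [he, this, scheme]
    simp only [h2]
    exact h1

lemma eLpNorm_eq_ofReal_l2 {f : ℝ → ℂ} (hf : MemLp f 2 (volΩ a b)) :
    eLpNorm f 2 (volΩ a b) = ENNReal.ofReal (l2 a b f) := (ofReal_lpNorm hf).symm

lemma sobolevNorm_one_le (hab : a < b) {f f' : ℝ → ℂ} (hf : IsPrimitive a b f f')
    (hf' : MemLp f' 2 (volΩ a b)) :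
    sobolevNorm a b 1 f ≤ ENNReal.ofReal (l2 a b f + l2 a b f') := by
  have hfL := memLp_of_continuousOn (hf.continuousOn hab.le)
  have hD : HasWeakDerivs a b 1 f fun k ↦ if k = 0 then f else f' := by
    intro k hk
    interval_cases k
    · exact ⟨isWeakDeriv_zero (locallyIntegrableOn_of_integrable (hfL.integrable one_le_two)), hfL⟩
    · exact ⟨hf.isWeakDeriv hab, hf'⟩
  refine (iInf₂_le _ hD).trans ?_
  rw [ENNReal.ofReal_add (l2_nonneg _ _ _) (l2_nonneg _ _ _), ← eLpNorm_eq_ofReal_l2 hfL,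
    ← eLpNorm_eq_ofReal_l2 hf', Finset.sum_range_succ, Finset.sum_range_one]
  simp only [if_true, one_ne_zero, if_false]
  set x := eLpNorm f 2 (volΩ a b)
  set y := eLpNorm f' 2 (volΩ a b)
  calc (x ^ 2 + y ^ 2) ^ (1 / 2 : ℝ) ≤ ((x + y) ^ 2) ^ (1 / 2 : ℝ) := by
        refine ENNReal.rpow_le_rpow ?_ (by norm_num)
        rw [add_sq]
        gcongr
        exact le_self_add
    _ = x + y := by
        rw [← ENNReal.rpow_natCast, ← ENNReal.rpow_mul]
        norm_num

end GPE

theorem theorem3p1 (a b T β : ℝ) (hab : a < b) (hT : 0 < T) (m : ℕ) (hm : 2 ≤ m)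
    (V : ℝ → ℝ → ℝ) (ψ₀ : ℝ → ℂ) (ψ : ℝ → ℝ → ℂ)
    (hV : GPE.MemCLp a b T ∞ V) (hV' : GPE.MemC1L2 a b T V)
    (hψ : GPE.MemCHper a b T m ψ) (hψ' : GPE.MemC1L2 a b T ψ)
    (hsol : GPE.IsSolution a b T β V ψ₀ ψ) :
    ∃ h₀ : ℝ, 0 < h₀ ∧ ∃ C : ℝ, 0 < C ∧
      ∀ N : ℕ, 0 < N → Even N → GPE.mesh a b N < h₀ →
        ∀ τ : ℝ, 0 < τ → τ ≤ GPE.mesh a b N ^ 2 / Real.pi →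
          ∀ n : ℕ, (n : ℝ) ≤ T / τ →
            eLpNorm (GPE.error a b β V ψ₀ ψ N τ n) 2 (GPE.volΩ a b)
                ≤ ENNReal.ofReal (C * (τ + GPE.mesh a b N ^ m)) ∧
            GPE.sobolevNorm a b 1 (GPE.error a b β V ψ₀ ψ N τ n)
                ≤ ENNReal.ofReal (C * (τ ^ (1 / 2 : ℝ) + GPE.mesh a b N ^ (m - 1))) := by
  open GPE in
  obtain ⟨k, rfl⟩ : ∃ k, m = k + 1 := ⟨m - 1, by omega⟩
  have hk : 1 ≤ k := by omega
  obtain ⟨M, L, hM, hL, hreg⟩ := exists_isRegular hab hT hk hV hV' hψ hψ' hsol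
  obtain ⟨h₀, hh₀, hh₀1, A, hA, key⟩ :=
    exists_coefficient_error_bound hab hT hk hsol.1 hM hL hreg
  have hba : 0 < b - a := by linarith
  have hpi := Real.pi_pos
  set D₀ := M + √(b - a) * A with hD₀
  set D₁ := M + √(b - a) * (Real.pi * A) with hD₁
  have hD₀0 : 0 ≤ D₀ := by positivity
  have hD₁0 : 0 ≤ D₁ := by positivity
  refine ⟨h₀, hh₀, D₀ + D₁ + 1, by positivity, fun N hN hN2 hNh τ hτ hτh n hn ↦ ?_⟩
  rw [le_div_iff₀ hτ] at hn
  have hh := mesh_pos hab hN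
  have hh1 : mesh a b N ≤ 1 := (hNh.trans_le hh₀1).le
  have hp := key N hN hN2 hNh τ hτ hτh n hn
  have hper := hreg.perBound (n * τ) ⟨by positivity, hn⟩
  set q := discreteHat a b N (scheme a b β V ψ₀ N τ n) with hq
  have herr : error a b β V ψ₀ ψ N τ n = fun x ↦ ψ (n * τ) x - trig a b N q x := rfl
  have hle : mesh a b N / Real.pi ≤ mesh a b N := by
    rw [div_le_iff₀ Real.pi_pos]
    nlinarith [Real.pi_gt_three]
  have hpos : 0 ≤ mesh a b N / Real.pi := by positivity
  have hL2 : MemLp (error a b β V ψ₀ ψ N τ n) 2 (volΩ a b) :=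
    (hper.memLp hab.le).sub (memLp_trig N q)
  have e0 : l2 a b (error a b β V ψ₀ ψ N τ n) ≤ D₀ * (τ + mesh a b N ^ (k + 1)) := by
    rw [herr]
    refine (hper.l2_sub_trig_le hab hN hN2 q).trans ?_
    calc _ ≤ mesh a b N ^ (k + 1) * M + √(b - a) * (A * (τ + mesh a b N ^ (k + 1))) := by
          gcongr
      _ ≤ _ := by
          have : 0 ≤ M * τ := by positivity
          rw [hD₀]
          linarith
  obtain ⟨f', hf', hf1, hf2, -⟩ := hper
  have hprim : IsPrimitive a b (error a b β V ψ₀ ψ N τ n)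
      (fun x ↦ f' x - trig a b N (fun l ↦ Complex.I * freq a b l * q l) x) := by
    have := hf1.add ((isPrimitive_trig N q).const_mul (-1))
    rw [herr]
    simpa [← sub_eq_add_neg] using this
  have hL2' : MemLp (fun x ↦ f' x - trig a b N (fun l ↦ Complex.I * freq a b l * q l) x) 2
      (volΩ a b) := (hf'.memLp hab.le).sub (memLp_trig N _)
  have hr : τ ^ (1 / 2 : ℝ) = √τ := (Real.sqrt_eq_rpow τ).symm
  have hsq : √τ * √τ = τ := Real.mul_self_sqrt hτ.le
  have hs0 : 0 ≤ √τ := Real.sqrt_nonneg τ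
  -- the step size restriction bounds `τ / h` by `τ ^ (1 / 2)`
  have hsh : √τ ≤ mesh a b N := by
    refine Real.sqrt_le_iff.2 ⟨hh.le, hτh.trans (div_le_self (by positivity) ?_)⟩
    linarith [Real.pi_gt_three]
  have e1 : l2 a b (fun x ↦ f' x - trig a b N (fun l ↦ Complex.I * freq a b l * q l) x) ≤
      D₁ * (√τ + mesh a b N ^ k) := by
    refine (hf'.l2_sub_trig_le hab hN hN2 _).trans ?_
    have h1 : ‖vec N (fourierHat a b f') - vec N fun l ↦ Complex.I * freq a b l * q l‖ ≤
        Real.pi / mesh a b N * ‖vec N (fourierHat a b (ψ (n * τ))) - vec N q‖ := by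
      rw [← vec_sub, ← vec_sub]
      refine norm_vec_le_of_le _ (by positivity) fun l hl ↦ ?_
      rw [fourierHat_deriv hab hf1 hf2, ← mul_sub, norm_mul, norm_mul, Complex.norm_I, one_mul,
        Complex.norm_real, Real.norm_eq_abs]
      gcongr
      exact abs_freq_le_of_mem hab hN hN2 hl
    have h2 : Real.pi / mesh a b N * (A * (τ + mesh a b N ^ (k + 1))) ≤
        Real.pi * A * (√τ + mesh a b N ^ k) := by
      have h3 : τ ≤ mesh a b N * √τ := by
        calc τ = √τ * √τ := hsq.symm
          _ ≤ _ := by gcongr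
      calc _ ≤ Real.pi / mesh a b N * (A * (mesh a b N * √τ + mesh a b N ^ (k + 1))) := by
            gcongr
        _ = _ := by field_simp; ring
    calc _ ≤ mesh a b N ^ k * M + √(b - a) * (Real.pi * A * (√τ + mesh a b N ^ k)) := by
          gcongr
          exact h1.trans ((mul_le_mul_of_nonneg_left hp (by positivity)).trans h2)
      _ ≤ _ := by
          have : 0 ≤ M * √τ := by positivity
          rw [hD₁]
          linarith
  constructor
  · rw [eLpNorm_eq_ofReal_l2 hL2]
    refine ENNReal.ofReal_le_ofReal (e0.trans ?_)
    gcongr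
    linarith
  · refine (sobolevNorm_one_le hab hprim hL2').trans (ENNReal.ofReal_le_ofReal ?_)
    rw [hr, Nat.add_sub_cancel]
    have h1 : τ + mesh a b N ^ (k + 1) ≤ √τ + mesh a b N ^ k := by
      have h3 : τ ≤ √τ := by
        calc τ = √τ * √τ := hsq.symm
          _ ≤ √τ * 1 := by gcongr; exact hsh.trans hh1
          _ = √τ := mul_one _
      have h4 : mesh a b N ^ (k + 1) ≤ mesh a b N ^ k :=
        pow_le_pow_of_le_one hh.le hh1 (Nat.le_succ k)
      exact add_le_add h3 h4
    have h2 := mul_le_mul_of_nonneg_left h1 hD₀0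
    have h3 : 0 ≤ √τ + mesh a b N ^ k := by positivity
    linarith
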